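/- Let $\tau$ be a complex number with $\operatorname{Im}\tau>0$, $\Lambda=\mathbb{Z}+\mathbb{Z}\tau$, $E=\mathbb{C}/\Lambda$ and $X=E\setminus\{0\}$. For $n\ge 0$ let $\Gamma_n$ be the coordinate ring of $F(X,n)=\{x\in X^n \mid x_i\neq x_j \text{ for } i\ne j\}$, i.e. the ring of meromorphic functions on $E^n$ with poles only along the divisors $x_i=0$ and $x_i=x_j$, and let $\partial_i$ be the derivation $\partial/\partial x_i$ of $\Gamma_n$. Let $G_{-n+p}\Gamma_n\subset\Gamma_n$ be the space of functions which, locally on $E^n$, are sums of products of at most $p$ functions each having poles along a single one of these divisors. Let $V=\bigoplus_{\Delta\ge 0}V_\Delta$ be a graded vertex algebra over $\mathbb{C}$ with translation operator $Ta=a_{(-2)}\mathbf 1$, and let $G_pV$ ($p\in\mathbb{Z}$) be a good increasing filtration: it is increasing and exhaustive, and for $a\in G_pV$, $b\in G_qV$ one has $a_{(m)}b\in G_{p+q}V$ for all $m\in\mathbb{Z}$ and $a_{(m)}b\in G_{p+q-1}V$ for $m\ge 0$. Give $V^{\otimes n+1}$ the induced filtration $G_rV^{\otimes n+1}=\sum_{r_1+\dots+r_{n+1}\le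 r}G_{r_1}V\otimes\dots\otimes G_{r_{n+1}}V$. Put $$\widetilde C_n=\Gamma_n\otimes V^{\otimes n+1},\qquad C_n=\widetilde C_n\Big/\sum_{i=1}^n(\partial_i+T_i)\widetilde C_n,$$ where $T_i$ is $T$ acting on the $i$-th tensor factor, and let $G_pC_n$ be the image in $C_n$ of $\sum_{p'+p''\le p}G_{p'}\Gamma_n\otimes G_{p''}V^{\otimes n+1}$. Let $d:C_n\to C_{n-1}$ ($n\ge1$) be the map induced by $$d=\sum_{1\le i<j\le n}(-1)^{n-i}d^{(ij)}+\sum_{1\le i\le n}(-1)^{n-i}p^{(i)},$$ $$d^{(ij)}(f\,a^1\otimes\cdots\otimes a^n\otimes b)=\operatorname{Res}_{x_i=x_j}f\,a^1\otimes\cdots\widehat{a^i}\cdots\otimes Y(a^i,x_i-x_j)a^j\otimes\cdots\otimes a^n\otimes b,$$ $$p^{(i)}(f\,a^1\otimes\cdots\otimes a^n\otimes b)=\operatorname{Res}_{x_i=0}f\,a^1\otimes\cdots\widehat{a^i}\cdots\otimes a^n\otimes Y(a^i,x_i)b,$$ where $Y(a,z)=\sum_{m}a_{(m)}z^{-m-1}$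 and the remaining variables are relabelled $x_1,\dots,x_{n-1}$. For a filtered space $M$ write $\mathrm{gr}^G_pM=G_pM/G_{p-1}M$ and $\mathrm{gr}^GM=\bigoplus_{p\in\mathbb{Z}}\mathrm{gr}^G_pM$. Let $$\pi:\mathrm{gr}^G(\Gamma_n)\otimes\mathrm{gr}^G(V^{\otimes n+1})\to\mathrm{gr}^G(\Gamma_n\otimes V^{\otimes n+1})\to\mathrm{gr}^G(C_n)$$ be the canonical map, and for $q\in\mathbb{Z}$ put $$E^q\,\mathrm{gr}^G(C_n)=\pi\Big(\bigoplus_{p\ge q}\mathrm{gr}^G_p(\Gamma_n)\otimes\mathrm{gr}^G(V^{\otimes n+1})\Big).$$ Then $(C_\bullet,d)$ is a well-defined complex ($d\circ d=0$) filtered by the $G_pC_\bullet$ ($d(G_pC_n)\subset G_pC_{n-1}$), so that $\mathrm{gr}^GC_\bullet$ is a complex with the induced differential, and the subspaces $E^q\,\mathrm{gr}^G(C_n)$ form a decreasing filtration of the complex $\mathrm{gr}^GC_\bullet$: one has $E^{q+1}\,\mathrm{gr}^G(C_n)\subset E^{q}\,\mathrm{gr}^G(C_n)$, and the differential maps $E^q\,\mathrm{gr}^G(C_n)$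 into $E^q\,\mathrm{gr}^G(C_{n-1})$. This filtration is concentrated in degrees $-n,\dots,0$: $E^{-n}\,\mathrm{gr}^G(C_n)=\mathrm{gr}^G(C_n)$ and $E^{1}\,\mathrm{gr}^G(C_n)=0$ for all $n\ge0$. -/

import Mathlib

open Filter Topology
open scoped TensorProduct DirectSum

noncomputable section

namespace ChiralHodge

/-! ### Vertex algebras and good filtrations -/

/-- A vertex algebra: a vector space with products `a_(n) b` (written `prod n a b`), `n ∈ ℤ`, and a
nonzero vacuum vector, satisfying the quantum field property, the unit axiom and the Borcherds
identity.  By the quantum field property all the sums over `j` are finite. -/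
structure VertexAlgebra (V : Type*) [AddCommGroup V] [Module ℂ V] where
  prod : ℤ → V →ₗ[ℂ] V →ₗ[ℂ] V
  vac : V
  vac_ne_zero : vac ≠ 0
  field : ∀ a b : V, ∃ N : ℤ, ∀ n : ℤ, N ≤ n → prod n a b = 0
  vac_prod : ∀ (n : ℤ) (a : V), prod n vac a = if n = -1 then a else 0
  prod_vac : ∀ a : V, prod (-1) a vac = a
  prod_vac_of_nonneg : ∀ (a : V) (n : ℤ), 0 ≤ n → prod n a vac = 0
  borcherds : ∀ (a b c : V) (m n k : ℤ),
    ∑ᶠ j : ℕ, Ring.choose m j • prod (m + k - j) (prod (n + j) a b) c =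
      ∑ᶠ j : ℕ, ((-1 : ℤ) ^ j * Ring.choose n j) •
        (prod (n + m - j) a (prod (k + j) b c) -
          (n.negOnePow : ℤ) • prod (n + k - j) b (prod (m + j) a c))

variable {V : Type*} [AddCommGroup V] [Module ℂ V]

/-- The translation operator `T a = a_(-2) 1`. -/
def VertexAlgebra.T (A : VertexAlgebra V) : V →ₗ[ℂ] V := (A.prod (-2)).flip A.vac

/-- A graded vertex algebra: `V = ⨁_{n ≥ 0} V_n` with `1 ∈ V_0`, `T V_n ⊆ V_{n+1}` and
`Δ(a_(n) b) = Δ(a) + Δ(b) - n - 1` (in particular `a_(n) b = 0` when the right hand side is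
negative). -/
structure GradedVertexAlgebra (V : Type*) [AddCommGroup V] [Module ℂ V]
    extends VertexAlgebra V where
  wt : ℕ → Submodule ℂ V
  isInternal : DirectSum.IsInternal wt
  vac_mem : vac ∈ wt 0
  T_mem : ∀ (p : ℕ) (a : V), a ∈ wt p → toVertexAlgebra.T a ∈ wt (p + 1)
  prod_mem : ∀ (n : ℤ) (p q r : ℕ) (a b : V), a ∈ wt p → b ∈ wt q →
    (r : ℤ) = p + q - n - 1 → prod n a b ∈ wt r
  prod_eq_zero : ∀ (n : ℤ) (p q : ℕ) (a b : V), a ∈ wt p → b ∈ wt q →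
    (p + q - n - 1 : ℤ) < 0 → prod n a b = 0

/-- A good increasing filtration of a vertex algebra. -/
structure IsGoodFiltration (A : VertexAlgebra V) (G : ℤ → Submodule ℂ V) : Prop where
  mono : Monotone G
  exhaustive : ∀ v : V, ∃ p : ℤ, v ∈ G p
  prod_mem : ∀ (p q n : ℤ) (a b : V), a ∈ G p → b ∈ G q → A.prod n a b ∈ G (p + q)
  prod_mem_of_nonneg : ∀ (p q n : ℤ) (a b : V), a ∈ G p → b ∈ G q → 0 ≤ n →
    A.prod n a b ∈ G (p + q - 1)

/-! ### Associated graded spaces of filtered vector spaces -/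

section Graded

variable {M M' N : Type*} [AddCommGroup M] [Module ℂ M] [AddCommGroup M'] [Module ℂ M']
  [AddCommGroup N] [Module ℂ N]

/-- `gr_p M = F_p M / F_{p-1} M` for an increasing filtration `F` of `M`. -/
abbrev GrPiece (F : ℤ → Submodule ℂ M) (p : ℤ) : Type _ :=
  ↥(F p) ⧸ (F (p - 1)).submoduleOf (F p)

/-- `gr M = ⨁_p gr_p M`. -/
abbrev Gr (F : ℤ → Submodule ℂ M) : Type _ := ⨁ p : ℤ, GrPiece F p

/-- The map `gr M → gr N` induced by a linear map `M → N` that respects the filtrations. -/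
def grMap (F : ℤ → Submodule ℂ M) (F' : ℤ → Submodule ℂ N) (f : M →ₗ[ℂ] N)
    (hf : ∀ p, F p ≤ (F' p).comap f) : Gr F →ₗ[ℂ] Gr F' :=
  DirectSum.lmap fun p =>
    Submodule.mapQ _ _ (f.restrict (hf p)) fun _ hx => hf (p - 1) hx

/-- The map `gr_p M × gr_r M' → gr_{p+r} N` induced by a bilinear map that is additive on
filtration degrees. -/
def grPieceBilin (F : ℤ → Submodule ℂ M) (F' : ℤ → Submodule ℂ M') (F'' : ℤ → Submodule ℂ N)
    (B : M →ₗ[ℂ] M' →ₗ[ℂ] N)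
    (hB : ∀ p r x y, x ∈ F p → y ∈ F' r → B x y ∈ F'' (p + r)) (p r : ℤ) :
    GrPiece F p →ₗ[ℂ] GrPiece F' r →ₗ[ℂ] GrPiece F'' (p + r) :=
  let β : ↥(F p) →ₗ[ℂ] ↥(F' r) →ₗ[ℂ] GrPiece F'' (p + r) :=
    LinearMap.mk₂ ℂ (fun x y => Submodule.Quotient.mk ⟨B x y, hB p r x y x.2 y.2⟩)
      (fun x x' y => by simp only [← Submodule.Quotient.mk_add]; congr 1; ext; simp)
      (fun c x y => by simp only [← Submodule.Quotient.mk_smul]; congr 1; ext; simp)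
      (fun x y y' => by simp only [← Submodule.Quotient.mk_add]; congr 1; ext; simp)
      (fun c x y => by simp only [← Submodule.Quotient.mk_smul]; congr 1; ext; simp)
  Submodule.liftQ _
    (LinearMap.flip (Submodule.liftQ _ β.flip (fun y hy => by
      rw [LinearMap.mem_ker]
      ext x
      have h := hB p (r - 1) x y x.2 hy
      rw [← add_sub_assoc] at h
      exact (Submodule.Quotient.mk_eq_zero _).mpr h)))
    (fun x hx => by
      rw [LinearMap.mem_ker]
      ext y
      have h := hB (p - 1) r x y hx y.2
      rw [show p - 1 + r = p + r - 1 by ring] at h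
      exact (Submodule.Quotient.mk_eq_zero _).mpr h)

/-- The map `gr M ⊗ gr M' → gr N` induced by a bilinear map that is additive on filtration
degrees. -/
def grBilin (F : ℤ → Submodule ℂ M) (F' : ℤ → Submodule ℂ M') (F'' : ℤ → Submodule ℂ N)
    (B : M →ₗ[ℂ] M' →ₗ[ℂ] N)
    (hB : ∀ p r x y, x ∈ F p → y ∈ F' r → B x y ∈ F'' (p + r)) :
    Gr F ⊗[ℂ] Gr F' →ₗ[ℂ] Gr F'' :=
  TensorProduct.lift <|
    DirectSum.toModule ℂ ℤ _ fun p =>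
      LinearMap.flip <| DirectSum.toModule ℂ ℤ _ fun r =>
        LinearMap.flip <|
          (grPieceBilin F F' F'' B hB p r).compr₂ (DirectSum.lof ℂ ℤ (GrPiece F'') (p + r))

end Graded

/-! ### Functions on configuration spaces of the punctured elliptic curve -/

/-- The lattice `Λ = ℤ + ℤ τ`. -/
def periods (τ : UpperHalfPlane) : PeriodPair where
  ω₁ := 1
  ω₂ := τ
  indep := by
    rw [LinearIndependent.pair_iff]
    intro s t h
    have h1 := congrArg Complex.im h
    have h2 := congrArg Complex.re h
    have ht : t = 0 := by simpa [τ.im_pos.ne'] using h1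
    subst ht
    simpa using h2

/-- `(x_1, …, x_n) ↦ (x_1, …, x_n, 0)`: the marked point `0` is appended as the last point. -/
def pts {n : ℕ} (x : Fin n → ℂ) : Fin (n + 1) → ℂ := Fin.snoc x 0

/-- Index set of the divisors `x_i = x_j` (`i < j ≤ n`) and `x_i = 0` in `E^n`; the latter is
`x_i = x_j` for `j` the last index, `x_j` being the marked point. -/
abbrev DivIdx (n : ℕ) : Type := {k : Fin (n + 1) × Fin (n + 1) // k.1 < k.2}

/-- The function `x_i - x_j` (or `x_i`). -/
def divFun {n : ℕ} (k : DivIdx n) (x : Fin n → ℂ) : ℂ := pts x k.1.1 - pts x k.1.2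

/-- The preimage in `ℂ^n` of the configuration space
`F(X, n) = {x ∈ X^n | x_i ≠ x_j for i ≠ j}`, `X = E \ 0`, `E = ℂ / Λ`. -/
def conf (τ : UpperHalfPlane) (n : ℕ) : Set (Fin n → ℂ) :=
  {x | ∀ k : DivIdx n, divFun k x ∉ (periods τ).lattice}

open Classical in
/-- The divisors passing through (the image in `E^n` of) `P`. -/
def through (τ : UpperHalfPlane) {n : ℕ} (P : Fin n → ℂ) : Finset (DivIdx n) :=
  Finset.univ.filter fun k => divFun k P ∈ (periods τ).lattice

/-- The product of the local equations at `P` of the divisors in `S`. -/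
def locEq {n : ℕ} (P : Fin n → ℂ) (S : Finset (DivIdx n)) (x : Fin n → ℂ) : ℂ :=
  ∏ k ∈ S, (divFun k x - divFun k P)

lemma analyticAt_divFun {n : ℕ} (k : DivIdx n) (P : Fin n → ℂ) : AnalyticAt ℂ (divFun k) P := by
  have h : ∀ j : Fin (n + 1), AnalyticAt ℂ (fun x : Fin n → ℂ => pts x j) P := by
    intro j
    induction j using Fin.lastCases with
    | last => simpa [pts] using analyticAt_const
    | cast j =>
      have h := (ContinuousLinearMap.proj (R := ℂ) (φ := fun _ : Fin n => ℂ) j).analyticAt P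
      simp only [pts, Fin.snoc_castSucc]
      exact h
  exact (h _).sub (h _)

lemma analyticAt_locEq {n : ℕ} (P : Fin n → ℂ) (S : Finset (DivIdx n)) (Q : Fin n → ℂ) :
    AnalyticAt ℂ (locEq P S) Q := by
  unfold locEq
  exact Finset.analyticAt_fun_prod _ fun k _ => (analyticAt_divFun k Q).sub analyticAt_const

lemma locEq_ne_zero {τ : UpperHalfPlane} {n : ℕ} {P x : Fin n → ℂ} {S : Finset (DivIdx n)}
    (hS : S ⊆ through τ P) (hx : x ∈ conf τ n) : locEq P S x ≠ 0 := by
  refine Finset.prod_ne_zero_iff.mpr fun k hk h => hx k ?_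
  have := hS hk
  simp only [through, Finset.mem_filter, Finset.mem_univ, true_and] at this
  rwa [sub_eq_zero.mp h]

lemma isOpen_conf (τ : UpperHalfPlane) (n : ℕ) : IsOpen (conf τ n) := by
  have : conf τ n = ⋂ k : DivIdx n, divFun k ⁻¹' ((periods τ).lattice : Set ℂ)ᶜ := by
    ext x; simp [conf]
  rw [this]
  refine isOpen_iInter_of_finite fun k => (periods τ).isClosed_lattice.isOpen_compl.preimage ?_
  exact continuous_iff_continuousAt.mpr fun P => (analyticAt_divFun k P).continuousAt

lemma divFun_add_mem {τ : UpperHalfPlane} {n : ℕ} {v : Fin n → ℂ}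
    (hv : ∀ i, v i ∈ (periods τ).lattice) (k : DivIdx n) (x : Fin n → ℂ) :
    ∃ w ∈ (periods τ).lattice, divFun k (x + v) = divFun k x + w := by
  have h : ∀ j : Fin (n + 1), ∃ w ∈ (periods τ).lattice, pts (x + v) j = pts x j + w := by
    intro j
    induction j using Fin.lastCases with
    | last => exact ⟨0, zero_mem _, by simp [pts]⟩
    | cast j => exact ⟨v j, hv j, by simp [pts]⟩
  obtain ⟨w, hw, h1⟩ := h k.1.1
  obtain ⟨w', hw', h2⟩ := h k.1.2
  exact ⟨w - w', sub_mem hw hw', by simp only [divFun, h1, h2]; ring⟩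

lemma add_mem_conf {τ : UpperHalfPlane} {n : ℕ} {v : Fin n → ℂ}
    (hv : ∀ i, v i ∈ (periods τ).lattice) (x : Fin n → ℂ) :
    x + v ∈ conf τ n ↔ x ∈ conf τ n := by
  refine forall_congr' fun k => not_congr ?_
  obtain ⟨w, hw, h⟩ := divFun_add_mem hv k x
  rw [h]
  exact Submodule.add_mem_iff_left _ hw

/-- The coordinate ring `Γ_n` of `F(X, n)`, as a space of functions: the `Λ^n`-periodic functions on the preimage of
`F(X, n)` in `ℂ^n` (extended by zero) which are meromorphic on `ℂ^n` with poles, of some finite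
order, at most along the divisors `x_i = 0` and `x_i = x_j` of `E^n`.  For `P ∈ conf τ n` no divisor
passes through `P` and the last condition says that `f` is holomorphic at `P`. -/
def gamSubmodule (τ : UpperHalfPlane) (n : ℕ) : Submodule ℂ ((Fin n → ℂ) → ℂ) where
  carrier := {f | (∀ x, x ∉ conf τ n → f x = 0) ∧
    (∀ x v : Fin n → ℂ, (∀ i, v i ∈ (periods τ).lattice) → f (x + v) = f x) ∧
    ∃ N : ℕ, ∀ P : Fin n → ℂ, ∃ g : (Fin n → ℂ) → ℂ, AnalyticAt ℂ g P ∧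
      ∀ᶠ x in 𝓝 P, x ∈ conf τ n → f x = g x / locEq P (through τ P) x ^ N}
  zero_mem' := ⟨fun _ _ => rfl, fun _ _ _ => rfl, 0, fun P =>
    ⟨fun _ => 0, analyticAt_const, by simp⟩⟩
  add_mem' := by
    rintro f f' ⟨h1, h2, N, h3⟩ ⟨h1', h2', N', h3'⟩
    refine ⟨fun x hx => by simp [h1 x hx, h1' x hx],
      fun x v hv => by simp [h2 x v hv, h2' x v hv], N + N', fun P => ?_⟩
    obtain ⟨g, hg, hfg⟩ := h3 P
    obtain ⟨g', hg', hfg'⟩ := h3' P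
    have hl := analyticAt_locEq P (through τ P) P
    refine ⟨fun x => g x * locEq P (through τ P) x ^ N' + g' x * locEq P (through τ P) x ^ N,
      (hg.mul (hl.pow _)).add (hg'.mul (hl.pow _)), ?_⟩
    filter_upwards [hfg, hfg'] with x hx hx' hxc
    have hne := locEq_ne_zero (P := P) subset_rfl hxc
    rw [Pi.add_apply, hx hxc, hx' hxc]
    field_simp
    ring
  smul_mem' := by
    rintro c f ⟨h1, h2, N, h3⟩
    refine ⟨fun x hx => by simp [h1 x hx], fun x v hv => by simp [h2 x v hv], N, fun P => ?_⟩
    obtain ⟨g, hg, hfg⟩ := h3 P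
    refine ⟨fun x => c * g x, analyticAt_const.mul hg, ?_⟩
    filter_upwards [hfg] with x hx hxc
    simp [hx hxc, mul_div_assoc]

/-- The coordinate ring `Γ_n` of `F(X, n)`, as a vector space. -/
def Gam (τ : UpperHalfPlane) (n : ℕ) : Type := ↥(gamSubmodule τ n)

instance (τ : UpperHalfPlane) (n : ℕ) : AddCommGroup (Gam τ n) :=
  inferInstanceAs (AddCommGroup ↥(gamSubmodule τ n))

instance (τ : UpperHalfPlane) (n : ℕ) : Module ℂ (Gam τ n) :=
  inferInstanceAs (Module ℂ ↥(gamSubmodule τ n))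

/-- An element of `Γ_n` as a function on `ℂ^n`. -/
def toFun (τ : UpperHalfPlane) (n : ℕ) : Gam τ n →ₗ[ℂ] ((Fin n → ℂ) → ℂ) :=
  (gamSubmodule τ n).subtype

/-- The filtration `G` on `Γ_n`: `f ∈ G_{-n+p} Γ_n` if, locally on `E^n`, `f` is a sum of products of
at most `p` functions each of which has poles on a single one of the divisors `x_i = 0` and
`x_i = x_j`.  Such a product is a holomorphic function divided by (powers of) the local equations
of a set `S` of at most `p` divisors. -/
def GGam (τ : UpperHalfPlane) (n : ℕ) (q : ℤ) : Submodule ℂ (Gam τ n) where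
  carrier := {f | ∀ P : Fin n → ℂ, ∃ (N : ℕ) (g : Finset (DivIdx n) → (Fin n → ℂ) → ℂ),
    (∀ S, AnalyticAt ℂ (g S) P) ∧
    ∀ᶠ x in 𝓝 P, x ∈ conf τ n →
      toFun τ n f x = ∑ S ∈ (through τ P).powerset with (S.card : ℤ) ≤ q + n, g S x / locEq P S x ^ N}
  zero_mem' := fun P => ⟨0, fun _ _ => 0, fun _ => analyticAt_const, by simp⟩
  add_mem' := by
    intro f f' h h' P
    obtain ⟨N, g, hg, hfg⟩ := h P
    obtain ⟨N', g', hg', hfg'⟩ := h' P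
    refine ⟨N + N', fun S x => g S x * locEq P S x ^ N' + g' S x * locEq P S x ^ N,
      fun S => ((hg S).mul ((analyticAt_locEq P S P).pow _)).add
        ((hg' S).mul ((analyticAt_locEq P S P).pow _)), ?_⟩
    filter_upwards [hfg, hfg'] with x hx hx' hxc
    rw [map_add, Pi.add_apply, hx hxc, hx' hxc, ← Finset.sum_add_distrib]
    refine Finset.sum_congr rfl fun S hS => ?_
    have hne := locEq_ne_zero (P := P)
      (Finset.mem_powerset.mp (Finset.mem_filter.mp hS).1) hxc
    field_simp
    ring
  smul_mem' := by
    intro c f h P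
    obtain ⟨N, g, hg, hfg⟩ := h P
    refine ⟨N, fun S x => c * g S x, fun S => analyticAt_const.mul (hg S), ?_⟩
    filter_upwards [hfg] with x hx hxc
    simp [hx hxc, mul_div_assoc, Finset.mul_sum]

lemma exists_nhds_conf {τ : UpperHalfPlane} {n : ℕ} {P : Fin n → ℂ}
    {p : (Fin n → ℂ) → Prop} (h : ∀ᶠ x in 𝓝 P, p x) :
    ∀ᶠ x in 𝓝 P, x ∈ conf τ n → ∀ᶠ y in 𝓝 x, y ∈ conf τ n ∧ p y := by
  filter_upwards [eventually_eventually_nhds.mpr h] with x hx hxc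
  exact Filter.Eventually.and (show ∀ᶠ y in 𝓝 x, y ∈ conf τ n from (isOpen_conf τ n).mem_nhds hxc) hx

lemma differentiableAt_of_mem {τ : UpperHalfPlane} {n : ℕ} {f : (Fin n → ℂ) → ℂ}
    (hf : f ∈ gamSubmodule τ n) {x : Fin n → ℂ} (hx : x ∈ conf τ n) : DifferentiableAt ℂ f x := by
  obtain ⟨-, -, N, h⟩ := hf
  obtain ⟨g, hg, hfg⟩ := h x
  have hg' : DifferentiableAt ℂ (fun y => g y / locEq x (through τ x) y ^ N) x :=
    (hg.div ((analyticAt_locEq x _ x).pow N)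
      (pow_ne_zero _ (locEq_ne_zero subset_rfl hx))).differentiableAt
  refine hg'.congr_of_eventuallyEq ?_
  filter_upwards [hfg, (isOpen_conf τ n).mem_nhds hx] with y hy hyc using hy hyc

/-- The derivation `∂_i` of `Γ_n`. -/
def pdAux (τ : UpperHalfPlane) {n : ℕ} (i : Fin n) :
    gamSubmodule τ n →ₗ[ℂ] gamSubmodule τ n where
  toFun f := ⟨(conf τ n).indicator fun x => fderiv ℂ f.1 x (Pi.single i 1), by
    obtain ⟨f, hf⟩ := f
    obtain ⟨h1, h2, N, h3⟩ := id hf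
    refine ⟨fun x hx => Set.indicator_of_notMem hx _, fun x v hv => ?_, N + 1, fun P => ?_⟩
    · have hfv : (fun y => f (y + v)) = f := funext fun y => h2 y v hv
      have : fderiv ℂ f (x + v) = fderiv ℂ f x := by
        rw [← fderiv_comp_add_right, hfv]
      by_cases hx : x ∈ conf τ n
      · rw [Set.indicator_of_mem hx, Set.indicator_of_mem ((add_mem_conf hv x).mpr hx), this]
      · rw [Set.indicator_of_notMem hx,
          Set.indicator_of_notMem (fun h => hx ((add_mem_conf hv x).mp h))]
    · obtain ⟨g, hg, hfg⟩ := h3 P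
      set l := locEq P (through τ P) with hl
      have hla : ∀ Q, AnalyticAt ℂ l Q := fun Q => analyticAt_locEq P _ Q
      refine ⟨fun x => fderiv ℂ g x (Pi.single i 1) * l x -
        N * g x * fderiv ℂ l x (Pi.single i 1), ?_, ?_⟩
      · have e : ∀ u : (Fin n → ℂ) → ℂ, AnalyticAt ℂ u P →
            AnalyticAt ℂ (fun x => fderiv ℂ u x (Pi.single i 1)) P := fun u hu =>
          ((ContinuousLinearMap.apply ℂ ℂ (Pi.single i (1 : ℂ))).analyticAt _).fun_comp hu.fderiv
        exact ((e g hg).mul (hla P)).sub ((analyticAt_const.mul hg).mul (e l (hla P)))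
      · filter_upwards [exists_nhds_conf (τ := τ) hfg, hg.eventually_analyticAt]
          with x hx hgx hxc
        have hne : l x ≠ 0 := locEq_ne_zero subset_rfl hxc
        have hEq : f =ᶠ[𝓝 x] fun y => g y * (l y ^ N)⁻¹ := by
          filter_upwards [hx hxc] with y hy
          rw [hy.2 hy.1, div_eq_mul_inv]
        have d1 := hgx.differentiableAt.hasFDerivAt
        have d2 := (hla x).differentiableAt.hasFDerivAt
        have d3 : HasFDerivAt (fun y => (l y ^ N)⁻¹)
            ((-((l x ^ N) ^ 2)⁻¹ * (N * l x ^ (N - 1))) • fderiv ℂ l x) x := by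
          have a := ((hasDerivAt_inv (pow_ne_zero N hne)).comp (l x)
            (hasDerivAt_pow N (l x))).comp_hasFDerivAt x d2
          exact a
        rw [Set.indicator_of_mem hxc, hEq.fderiv_eq, (d1.fun_mul d3).fderiv]
        rcases N with _ | N
        · simp; field_simp
        · simp
          field_simp
          ring⟩
  map_add' f f' := by
    ext x
    by_cases hx : x ∈ conf τ n
    · simp [hx, fderiv_add (differentiableAt_of_mem f.2 hx) (differentiableAt_of_mem f'.2 hx)]
    · simp [hx]
  map_smul' c f := by
    ext x
    by_cases hx : x ∈ conf τ n
    · simp [hx, fderiv_const_smul (differentiableAt_of_mem f.2 hx) c]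
    · simp [hx]

/-- The derivation `∂_i` of `Γ_n`. -/
def pd (τ : UpperHalfPlane) {n : ℕ} (i : Fin n) : Gam τ n →ₗ[ℂ] Gam τ n := pdAux τ i

/-- The coefficient `f^(m)` of `(x_i - x_j)^m` in the Laurent expansion along `x_i = x_j` of a
function of `n + 1` variables, as a function of the `n` variables that remain when `x_i` is deleted
(relabelled `x_1, …, x_n`).  Here `i ≤ j`, and `j` is the position of `x_j` *after* the deletion of
`x_i`; for `j` the last position the divisor is `x_i = 0`.  The contour integral does not depend on
the radius `r` once `r` is small. -/
def laurentCoeff (τ : UpperHalfPlane) {n : ℕ} (i j : Fin (n + 1)) (m : ℤ)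
    (f : (Fin (n + 1) → ℂ) → ℂ) : (Fin n → ℂ) → ℂ :=
  (conf τ n).indicator fun y =>
    limUnder (𝓝[>] (0 : ℝ)) fun r =>
      (2 * Real.pi * Complex.I)⁻¹ *
        ∮ t in C(0, r), f (i.insertNth (pts y j + t) y) * t ^ (-m - 1)

/-! ### The ordered chiral complex and its Hodge filtration -/

/-- `V^{⊗ N}`. -/
abbrev TP (V : Type*) [AddCommGroup V] [Module ℂ V] (N : ℕ) : Type _ := ⨂[ℂ] _ : Fin N, V

/-- `C̃_n = Γ_n ⊗ V^{⊗ n+1}`. -/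
abbrev PreChain (τ : UpperHalfPlane) (V : Type*) [AddCommGroup V] [Module ℂ V] (n : ℕ) : Type _ :=
  Gam τ n ⊗[ℂ] TP V (n + 1)

/-- `T_i`: the translation operator acting on the `i`-th tensor factor. -/
def TAt (A : VertexAlgebra V) {n : ℕ} (i : Fin n) : TP V (n + 1) →ₗ[ℂ] TP V (n + 1) :=
  PiTensorProduct.map (Function.update (fun _ => LinearMap.id) i.castSucc A.T)

/-- `∑_i (∂_i + T_i) C̃_n`. -/
def rel (τ : UpperHalfPlane) (A : VertexAlgebra V) (n : ℕ) : Submodule ℂ (PreChain τ V n) :=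
  ⨆ i : Fin n, LinearMap.range
    (TensorProduct.map (pd τ i) LinearMap.id + TensorProduct.map LinearMap.id (TAt A i) :
      PreChain τ V n →ₗ[ℂ] PreChain τ V n)

/-- `C_n = C̃_n / ∑_i (∂_i + T_i) C̃_n`. -/
abbrev Chain (τ : UpperHalfPlane) (A : VertexAlgebra V) (n : ℕ) : Type _ :=
  PreChain τ V n ⧸ rel τ A n

/-- The tuple obtained from `a` by deleting `a^i` and replacing `a^j` by `a^i_(m) a^j`, where `i ≤ j`
and `j` is the position of `a^j` after the deletion. -/
def merge (A : VertexAlgebra V) {n : ℕ} (i j : Fin (n + 1)) (m : ℤ) (a : Fin (n + 2) → V) :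
    Fin (n + 1) → V :=
  Function.update (i.castSucc.removeNth a) j (A.prod m (a i.castSucc) (a j.succ))

/-- The value of the differential on `f ⊗ a^1 ⊗ ⋯ ⊗ a^{n+1} ⊗ b`, in
`{functions on ℂ^n} ⊗ V^{⊗ n+1}`, namely
`∑_{i < j} (-1)^{n+1-i} Res_{x_i = x_j} f · a^1 ⊗ ⋯ â^i ⋯ ⊗ Y(a^i, x_i - x_j) a^j ⊗ ⋯ ⊗ b`,
`1 ≤ i < j ≤ n + 2`, in which the terms with `j = n + 2` are those for which `a^i` acts on `b` and
the residue is along `x_i = 0`.  The residue is the (finite) sum over `m` of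
`f^(m) ⊗ (⋯ a^i_(m) a^j ⋯)`.  In the formula below `i` counts from `0`. -/
def dFormula (τ : UpperHalfPlane) (A : VertexAlgebra V) {n : ℕ} (f : Gam τ (n + 1))
    (a : Fin (n + 2) → V) : ((Fin n → ℂ) → ℂ) ⊗[ℂ] TP V (n + 1) :=
  ∑ i : Fin (n + 1), ∑ j : Fin (n + 1) with i ≤ j, (-1 : ℂ) ^ (n - (i : ℕ)) •
    ∑ᶠ m : ℤ, laurentCoeff τ i j m (toFun τ (n + 1) f) ⊗ₜ[ℂ] PiTensorProduct.tprod ℂ (merge A i j m a)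

/-- `d` is the differential of the ordered chiral complex: it is induced by the map
`C̃_{n+1} → C̃_n` given on `f ⊗ a` by `dFormula`.  (`Γ_n ⊗ V^{⊗ n+1}` embeds in
`{functions} ⊗ V^{⊗ n+1}`, so `w` and `d` are determined.) -/
def IsChiralDifferential (τ : UpperHalfPlane) (A : VertexAlgebra V)
    (d : ∀ n, Chain τ A (n + 1) →ₗ[ℂ] Chain τ A n) : Prop :=
  ∀ (n : ℕ) (f : Gam τ (n + 1)) (a : Fin (n + 2) → V), ∃ w : PreChain τ V n,
    TensorProduct.map (toFun τ n) LinearMap.id w = dFormula τ A f a ∧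
    d n (Submodule.Quotient.mk (f ⊗ₜ[ℂ] PiTensorProduct.tprod ℂ a)) = Submodule.Quotient.mk w

/-- The filtration of `V^{⊗ N}` induced by a filtration of `V`. -/
def GTP (G : ℤ → Submodule ℂ V) (N : ℕ) (r : ℤ) : Submodule ℂ (TP V N) :=
  Submodule.span ℂ {z | ∃ (s : Fin N → ℤ) (a : Fin N → V), (∀ k, a k ∈ G (s k)) ∧
    ∑ k, s k ≤ r ∧ z = PiTensorProduct.tprod ℂ a}

/-- `G_p C̃_n = ∑_{p' + p'' ≤ p} G_{p'} Γ_n ⊗ G_{p''} V^{⊗ n+1}`. -/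
def GPre (τ : UpperHalfPlane) (G : ℤ → Submodule ℂ V) (n : ℕ) (p : ℤ) :
    Submodule ℂ (PreChain τ V n) :=
  ⨆ (s : ℤ) (r : ℤ) (_ : s + r ≤ p),
    Submodule.map₂ (TensorProduct.mk ℂ (Gam τ n) (TP V (n + 1))) (GGam τ n s) (GTP G (n + 1) r)

/-- The Hodge filtration: `G_p C_n` is the image of `G_p C̃_n`. -/
def GC (τ : UpperHalfPlane) (A : VertexAlgebra V) (G : ℤ → Submodule ℂ V) (n : ℕ) (p : ℤ) :
    Submodule ℂ (Chain τ A n) :=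
  (GPre τ G n p).map (rel τ A n).mkQ

lemma mk_mem_GPre (τ : UpperHalfPlane) (G : ℤ → Submodule ℂ V) (n : ℕ) (s r : ℤ) (f : Gam τ n)
    (a : TP V (n + 1)) (hf : f ∈ GGam τ n s) (ha : a ∈ GTP G (n + 1) r) :
    TensorProduct.mk ℂ (Gam τ n) (TP V (n + 1)) f a ∈ GPre τ G n (s + r) :=
  (le_iSup₂_of_le s r (le_iSup_of_le le_rfl le_rfl) :
    Submodule.map₂ (TensorProduct.mk ℂ (Gam τ n) (TP V (n + 1))) (GGam τ n s) (GTP G (n + 1) r) ≤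
      GPre τ G n (s + r)) (Submodule.apply_mem_map₂ _ hf ha)

/-- `π : gr(Γ_n) ⊗ gr(V^{⊗ n+1}) → gr(Γ_n ⊗ V^{⊗ n+1}) → gr(C_n)`. -/
def piMap (τ : UpperHalfPlane) (A : VertexAlgebra V) (G : ℤ → Submodule ℂ V) (n : ℕ) :
    Gr (GGam τ n) ⊗[ℂ] Gr (GTP G (n + 1)) →ₗ[ℂ] Gr (GC τ A G n) :=
  grMap (GPre τ G n) (GC τ A G n) (rel τ A n).mkQ (fun _ => Submodule.le_comap_map _ _) ∘ₗ
    grBilin (GGam τ n) (GTP G (n + 1)) (GPre τ G n) (TensorProduct.mk ℂ (Gam τ n) (TP V (n + 1)))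
      (mk_mem_GPre τ G n)

/-- `E^q gr(C_n) = π (⨁_{p ≥ q} gr_p(Γ_n) ⊗ gr(V^{⊗ n+1}))`. -/
def E (τ : UpperHalfPlane) (A : VertexAlgebra V) (G : ℤ → Submodule ℂ V) (n : ℕ) (q : ℤ) :
    Submodule ℂ (Gr (GC τ A G n)) :=
  (⨆ (p : ℤ) (_ : q ≤ p), LinearMap.range
    (TensorProduct.map (DirectSum.lof ℂ ℤ (GrPiece (GGam τ n)) p)
      (LinearMap.id : Gr (GTP G (n + 1)) →ₗ[ℂ] Gr (GTP G (n + 1))))).map (piMap τ A G n)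

end ChiralHodge

end

/-!
The chain complex is `Γ_n ⊗ V^{⊗ n+1}` modulo total derivatives, and its differential takes residues
along the divisors `x_i = x_j` and `x_i = 0`. Treating the marked point `0` as one more point, with label
`n + 1`, makes all these residues instances of a single operation `resTerm`: expand the function as a
Laurent series `∑ f^(m) (x_i - x_j)^m`, delete `x_i`, and replace `a^i ⊗ a^j` by `a^i_(m) a^j`.

*The differential is well defined.* Each Laurent coefficient is again an element of `Γ`
(`laurentCoeff_mem`), and `resTerm` annihilates `∂_i + T_i` for the deleted variable and commutes with
`∂_l + T_l` for the others (`resTerm_relOp_self`, `relOp_resTerm`); the latter uses that `T` is a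
derivation of all products.

*The differential squares to zero.* In `d ∘ d` two points `x_p`, `x_q` are removed, and the terms are
grouped by the labels `c`, `c'` of the points which absorb them. For `c ≠ c'` the divisors are transversal
and the two residues commute (`resTerm_comm`). For `c = c'` there are three iterated residues, those at
`x_p → x_c`, `x_q → x_c` in both orders and the one in which `x_p → x_q` first; a function with poles on
the three lines `u = 0`, `v = 0`, `u = v` is expanded in three domains, and the relation between the
expansions is the Borcherds identity in residue form (`finsum_lc_borcherds`, `resTerm_borcherds`). That
identity reduces to functions `u^a v^b (u - v)^c`, where it is the Borcherds identity itself, because only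
finitely many Taylor coefficients of the numerator matter. The signs make the groups cancel
(`preD_preD`).

*The filtrations.* If `f ∈ G_p Γ_n` then `f^(m) ∈ G_{p+1} Γ_{n-1}`, since one variable disappears and
the number of divisors does not increase, and `f^(m) ∈ G_p Γ_{n-1}` for `m < 0`, since then only the
terms with a pole along `x_i = x_j` contribute and this divisor is dropped (`lcoeff_mem_GGam`).
Correspondingly `a_(m) b` loses one degree for `m ≥ 0`. So the differential preserves the total degree
and does not lower the degree of the function (`preD_mem_bigPre`), which says that it respects both `G`
and `E`.

*The range of degrees.* `G_p Γ_n = 0` for `p < -n` by definition. On the other side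
`G_0 Γ_n = Γ_n` (`GGam_zero`), by partial fractions: if more than `n` of the linear equations
`x_i - x_j`, `x_i` occur in a denominator they are linearly dependent, one of them, `ℓ`, is a combination
of the others, and a high power of this combination divided by the same power of `ℓ` splits the function
into terms from each of which another equation has been cancelled.
-/

noncomputable section

namespace ChiralHodge

/-! ### Laurent coefficients in one variable -/

/-- The contour integral over the circle of radius `r` that computes the `m`-th Laurent coefficient
at `0`. -/
def contourCoeff (m : ℤ) (φ : ℂ → ℂ) (r : ℝ) : ℂ :=
  (2 * Real.pi * Complex.I)⁻¹ * ∮ t in C(0, r), φ t * t ^ (-m - 1)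

/-- The `m`-th Laurent coefficient of `φ` at `0`. -/
def lc (m : ℤ) (φ : ℂ → ℂ) : ℂ := limUnder (𝓝[>] (0 : ℝ)) (contourCoeff m φ)

/-- The `k`-th Taylor coefficient of `h` at `0`, equal to `0` for `k < 0`. -/
def tc (k : ℤ) (h : ℂ → ℂ) : ℂ :=
  if 0 ≤ k then iteratedDeriv k.toNat h 0 / (k.toNat.factorial : ℂ) else 0

lemma tc_of_neg {k : ℤ} (hk : k < 0) (h : ℂ → ℂ) : tc k h = 0 := by
  simp [tc, hk]

lemma tc_natCast (k : ℕ) (h : ℂ → ℂ) : tc k h = iteratedDeriv k h 0 / (k.factorial : ℂ) := by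
  simp [tc]

lemma contourCoeff_congr {m : ℤ} {φ ψ : ℂ → ℂ} {r : ℝ} (hr : 0 ≤ r)
    (H : ∀ t ∈ Metric.sphere (0 : ℂ) r, φ t = ψ t) : contourCoeff m φ r = contourCoeff m ψ r := by
  unfold contourCoeff
  rw [circleIntegral.integral_congr hr fun t ht => by
    show φ t * t ^ (-m - 1) = ψ t * t ^ (-m - 1)
    rw [H t ht]]

lemma contourCoeff_eq_tc {h φ : ℂ → ℂ} {r : ℝ} (hr : 0 < r) (N : ℕ) (m : ℤ)
    (hh : DifferentiableOn ℂ h (Metric.closedBall 0 r))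
    (hφ : ∀ t ∈ Metric.sphere (0 : ℂ) r, φ t = h t / t ^ N) :
    contourCoeff m φ r = tc (m + N) h := by
  have hne : ∀ t ∈ Metric.sphere (0 : ℂ) r, t ≠ 0 := fun t ht => by
    rintro rfl
    simp at ht
    exact hr.ne ht
  rcases le_or_gt 0 (m + N) with hk | hk
  · obtain ⟨k, hk⟩ := Int.eq_ofNat_of_zero_le hk
    rw [hk, tc_natCast, contourCoeff]
    rw [circleIntegral.integral_congr hr.le (g := fun z => (1 / (z - 0) ^ (k + 1)) • h z) fun t ht => by
      have h1 : t ^ (-m - 1) = t ^ N / t ^ (k + 1) := by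
        rw [show -m - 1 = (N : ℤ) - ((k + 1 : ℕ) : ℤ) by push_cast; omega,
          zpow_sub₀ (hne t ht), zpow_natCast, zpow_natCast]
      have h2 := hne t ht
      simp only [hφ t ht, h1, smul_eq_mul, sub_zero]
      field_simp]
    rw [hh.circleIntegral_one_div_sub_center_pow_smul hr]
    have := Complex.two_pi_I_ne_zero
    simp only [smul_eq_mul]
    field_simp
  · rw [tc_of_neg hk, contourCoeff]
    obtain ⟨k, hk⟩ : ∃ k : ℕ, -m - 1 - N = k := Int.eq_ofNat_of_zero_le (by omega)
    rw [circleIntegral.integral_congr hr.le (g := fun z => h z * z ^ k) fun t ht => by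
      have h1 : t ^ (-m - 1) = t ^ N * t ^ k := by
        rw [show -m - 1 = (N : ℤ) + (k : ℕ) by omega,
          zpow_add₀ (hne t ht), zpow_natCast, zpow_natCast]
      have h2 := hne t ht
      simp only [hφ t ht, h1]
      field_simp]
    have hd : DifferentiableOn ℂ (fun z => h z * z ^ k) (Metric.closedBall 0 r) :=
      hh.mul (by fun_prop)
    rw [(hd.mono Metric.closure_ball_subset_closedBall).diffContOnCl.circleIntegral_eq_zero hr.le,
      mul_zero]

lemma eventually_contourCoeff {h φ : ℂ → ℂ} (N : ℕ) (m : ℤ) (hh : AnalyticAt ℂ h 0)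
    (hφ : ∀ᶠ t in 𝓝[≠] 0, φ t = h t / t ^ N) :
    ∀ᶠ r in 𝓝[>] (0 : ℝ), contourCoeff m φ r = tc (m + N) h := by
  have h1 := hh.eventually_analyticAt
  obtain ⟨ε, hε, H1⟩ := Metric.eventually_nhds_iff_ball.mp h1
  obtain ⟨δ, hδ, H2⟩ := Metric.eventually_nhds_iff_ball.mp (eventually_nhdsWithin_iff.mp hφ)
  have : Set.Ioo (0 : ℝ) (min ε δ) ∈ 𝓝[>] (0 : ℝ) := Ioo_mem_nhdsGT (lt_min hε hδ)
  filter_upwards [this] with r hr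
  refine contourCoeff_eq_tc hr.1 N m (fun t ht => ?_) fun t ht => ?_
  · exact (H1 t (Metric.closedBall_subset_ball (hr.2.trans_le (min_le_left _ _)) ht)).differentiableAt.differentiableWithinAt
  · refine H2 t (Metric.sphere_subset_ball (hr.2.trans_le (min_le_right _ _)) ht) ?_
    rintro rfl
    simp at ht
    exact hr.1.ne ht

lemma lc_eq_tc {h φ : ℂ → ℂ} (N : ℕ) (m : ℤ) (hh : AnalyticAt ℂ h 0)
    (hφ : ∀ᶠ t in 𝓝[≠] 0, φ t = h t / t ^ N) : lc m φ = tc (m + N) h :=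
  Tendsto.limUnder_eq ((tendsto_congr' (eventually_contourCoeff N m hh hφ)).mpr tendsto_const_nhds)

lemma lc_congr {m : ℤ} {φ ψ : ℂ → ℂ} (H : ∀ᶠ t in 𝓝[≠] 0, φ t = ψ t) : lc m φ = lc m ψ := by
  have : contourCoeff m φ =ᶠ[𝓝[>] (0 : ℝ)] contourCoeff m ψ := by
    obtain ⟨δ, hδ, H2⟩ := Metric.eventually_nhds_iff_ball.mp (eventually_nhdsWithin_iff.mp H)
    filter_upwards [Ioo_mem_nhdsGT hδ] with r hr
    refine contourCoeff_congr hr.1.le fun t ht => H2 t (Metric.sphere_subset_ball hr.2 ht) ?_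
    rintro rfl
    simp at ht
    exact hr.1.ne ht
  unfold lc limUnder
  rw [Filter.map_congr this]

/-- A function that is meromorphic at `0` is `h / t ^ N` with `h` holomorphic. -/
lemma exists_eq_div_pow {φ : ℂ → ℂ} (H : MeromorphicAt φ 0) :
    ∃ (N : ℕ) (h : ℂ → ℂ), AnalyticAt ℂ h 0 ∧ ∀ᶠ t in 𝓝[≠] 0, φ t = h t / t ^ N := by
  obtain ⟨N, hN⟩ := H
  refine ⟨N, _, hN, ?_⟩
  filter_upwards [self_mem_nhdsWithin] with t ht
  have : t ≠ 0 := ht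
  simp only [sub_zero, smul_eq_mul]
  field_simp

lemma meromorphicAt_of_eq_div_pow {φ h : ℂ → ℂ} {N : ℕ} (hh : AnalyticAt ℂ h 0)
    (hφ : ∀ᶠ t in 𝓝[≠] 0, φ t = h t / t ^ N) : MeromorphicAt φ 0 :=
  ((hh.meromorphicAt).div ((MeromorphicAt.id 0).pow N)).congr
    (by filter_upwards [hφ] with t ht; simp [ht])

/-- A common pole order for two meromorphic functions. -/
lemma exists_eq_div_pow₂ {φ ψ : ℂ → ℂ} (H : MeromorphicAt φ 0) (H' : MeromorphicAt ψ 0) :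
    ∃ (N : ℕ) (h k : ℂ → ℂ), AnalyticAt ℂ h 0 ∧ AnalyticAt ℂ k 0 ∧
      (∀ᶠ t in 𝓝[≠] 0, φ t = h t / t ^ N) ∧ ∀ᶠ t in 𝓝[≠] 0, ψ t = k t / t ^ N := by
  obtain ⟨N, h, hh, h1⟩ := exists_eq_div_pow H
  obtain ⟨N', h', hh', h1'⟩ := exists_eq_div_pow H'
  refine ⟨N + N', fun t => h t * t ^ N', fun t => h' t * t ^ N, hh.mul (by fun_prop),
    hh'.mul (by fun_prop), ?_, ?_⟩
  · filter_upwards [h1, self_mem_nhdsWithin] with t ht ht'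
    have : t ≠ 0 := ht'
    rw [ht]; field_simp; ring
  · filter_upwards [h1', self_mem_nhdsWithin] with t ht ht'
    have : t ≠ 0 := ht'
    rw [ht]; field_simp; ring

lemma tc_add {k : ℤ} {h h' : ℂ → ℂ} (hh : AnalyticAt ℂ h 0) (hh' : AnalyticAt ℂ h' 0) :
    tc k (fun t => h t + h' t) = tc k h + tc k h' := by
  unfold tc
  split_ifs
  · rw [← add_div, iteratedDeriv_fun_add hh.contDiffAt hh'.contDiffAt]
  · simp

lemma tc_const_mul {k : ℤ} {h : ℂ → ℂ} (c : ℂ) :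
    tc k (fun t => c * h t) = c * tc k h := by
  unfold tc
  split_ifs
  · rw [iteratedDeriv_const_mul_field]; ring
  · simp

lemma lc_add {m : ℤ} {φ ψ : ℂ → ℂ} (H : MeromorphicAt φ 0) (H' : MeromorphicAt ψ 0) :
    lc m (fun t => φ t + ψ t) = lc m φ + lc m ψ := by
  obtain ⟨N, h, k, hh, hk, h1, h2⟩ := exists_eq_div_pow₂ H H'
  rw [lc_eq_tc N m hh h1, lc_eq_tc N m hk h2, ← tc_add hh hk]
  refine lc_eq_tc N m (hh.add hk) ?_
  filter_upwards [h1, h2] with t e1 e2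
  rw [e1, e2, add_div]

lemma lc_const_mul {m : ℤ} {φ : ℂ → ℂ} (c : ℂ) (H : MeromorphicAt φ 0) :
    lc m (fun t => c * φ t) = c * lc m φ := by
  obtain ⟨N, h, hh, h1⟩ := exists_eq_div_pow H
  rw [lc_eq_tc N m hh h1, ← tc_const_mul]
  refine lc_eq_tc N m (analyticAt_const.mul hh) ?_
  filter_upwards [h1] with t e1
  rw [e1, mul_div_assoc]

lemma lc_sum {ι : Type*} {m : ℤ} (s : Finset ι) {φ : ι → ℂ → ℂ}
    (H : ∀ i ∈ s, MeromorphicAt (φ i) 0) :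
    lc m (fun t => ∑ i ∈ s, φ i t) = ∑ i ∈ s, lc m (φ i) := by
  classical
  induction s using Finset.induction_on with
  | empty =>
    have := lc_const_mul (m := m) (φ := fun _ => 0) 0 (MeromorphicAt.const 0 0)
    simpa using this
  | insert i s hi ih =>
    simp only [Finset.sum_insert hi]
    rw [← ih fun j hj => H j (Finset.mem_insert_of_mem hj)]
    exact lc_add (H i (Finset.mem_insert_self _ _))
      (MeromorphicAt.fun_sum fun j hj => H j (Finset.mem_insert_of_mem hj))

lemma lc_eq_zero_of_lt {h φ : ℂ → ℂ} {N : ℕ} {m : ℤ} (hm : m < -N) (hh : AnalyticAt ℂ h 0)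
    (hφ : ∀ᶠ t in 𝓝[≠] 0, φ t = h t / t ^ N) : lc m φ = 0 := by
  rw [lc_eq_tc N m hh hφ, tc_of_neg (by omega)]

/-- Taylor coefficients of `t h' - N h`, which is the numerator of the derivative of `h / t ^ N`. -/
lemma tc_deriv_mul_sub {h : ℂ → ℂ} (hh : AnalyticAt ℂ h 0) (N k : ℤ) :
    tc k (fun t => deriv h t * t - N * h t) = (k - N) * tc k h := by
  have e1 : tc k (fun t => deriv h t * t) = k * tc k h := by
    rcases lt_or_ge k 0 with hk | hk
    · simp [tc_of_neg hk]
    obtain ⟨k, rfl⟩ := Int.eq_ofNat_of_zero_le hk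
    simp only [tc_natCast]
    have hd := hh.deriv
    have := iteratedDeriv_fun_mul (n := k) (x := 0) (f := deriv h) (g := fun t => t)
      hd.contDiffAt contDiffAt_id
    rw [this]
    rcases k with _ | k
    · simp
    · rw [Finset.sum_eq_single k]
      · rw [iteratedDeriv_succ' (f := h)]
        simp
        ring
      · intro b hb hbk
        have : b < k + 2 := Finset.mem_range.mp hb
        rcases Nat.lt_or_ge b k with h3 | h3
        · have : iteratedDeriv (k + 1 - b) (fun t : ℂ => t) 0 = 0 := by
            rw [show k + 1 - b = (k - b - 1) + 1 + 1 by omega, iteratedDeriv_succ', iteratedDeriv_succ']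
            simp
          rw [this, mul_zero]
        · have : b = k + 1 := by omega
          subst this
          simp
      · simp
  have e2 : (fun t => deriv h t * t - N * h t) = fun t => deriv h t * t + (-N : ℂ) * h t := by
    ext t; ring
  rw [e2, tc_add (h := fun t => deriv h t * t) (hh.deriv.fun_mul analyticAt_id)
    (analyticAt_const.fun_mul hh), e1, tc_const_mul]
  ring

lemma lc_deriv {φ : ℂ → ℂ} (m : ℤ) (H : MeromorphicAt φ 0) :
    lc m (deriv φ) = (m + 1) * lc (m + 1) φ := by
  obtain ⟨N, h, hh, h1⟩ := exists_eq_div_pow H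
  rw [lc_eq_tc N (m + 1) hh h1]
  have h2 : ∀ᶠ t in 𝓝[≠] 0, deriv φ t = (deriv h t * t - N * h t) / t ^ (N + 1) := by
    have h3 : ∀ᶠ t in 𝓝[≠] (0 : ℂ), t ∈ ({0}ᶜ : Set ℂ) → ∀ᶠ s in 𝓝 t, φ s = h s / s ^ N := by
      filter_upwards [eventually_eventually_nhdsWithin.mpr h1] with t ht ht0
      rwa [isOpen_compl_singleton.nhdsWithin_eq ht0] at ht
    filter_upwards [h3, self_mem_nhdsWithin, hh.eventually_analyticAt.filter_mono nhdsWithin_le_nhds]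
      with t ht ht0 hta
    rw [EventuallyEq.deriv_eq (ht ht0)]
    have ht0 : t ≠ 0 := ht0
    rw [deriv_fun_div (d := fun t => t ^ N) hta.differentiableAt (by fun_prop) (pow_ne_zero _ ht0)]
    rcases N with _ | N
    · simp; field_simp
    · simp
      field_simp
      ring
  rw [lc_eq_tc (h := fun t => deriv h t * t - N * h t) (N + 1) m ((hh.deriv.fun_mul analyticAt_id).fun_sub (analyticAt_const.fun_mul hh)) h2]
  have := tc_deriv_mul_sub hh N (m + (N + 1 : ℕ))
  push_cast at this
  rw [show (m + 1 + N : ℤ) = m + (N + 1) by ring]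
  push_cast
  rw [this]
  ring

/-- A function of order `t ^ k` at `0` has no Laurent coefficients of degree below `k`. -/
lemma lc_eq_zero_of_bound {φ : ℂ → ℂ} {m k : ℤ} (C : ℝ) (hm : m < k)
    (H : ∀ᶠ t in 𝓝[≠] 0, ‖φ t‖ ≤ C * ‖t‖ ^ k) : lc m φ = 0 := by
  refine Tendsto.limUnder_eq ?_
  obtain ⟨δ, hδ, H2⟩ := Metric.eventually_nhds_iff_ball.mp (eventually_nhdsWithin_iff.mp H)
  have hb : ∀ᶠ r in 𝓝[>] (0 : ℝ), ‖contourCoeff m φ r‖ ≤ C * r ^ (k - m) := by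
    filter_upwards [Ioo_mem_nhdsGT hδ] with r hr
    have h0 : ‖(2 * Real.pi * Complex.I : ℂ)⁻¹ • ∮ t in C(0, r), φ t * t ^ (-m - 1)‖
        ≤ r * (C * r ^ k * r ^ (-m - 1)) := by
      refine circleIntegral.norm_two_pi_i_inv_smul_integral_le_of_norm_le_const hr.1.le fun t ht => ?_
      have ht' : ‖t‖ = r := by simpa using ht
      rw [norm_mul, norm_zpow, ht']
      have := H2 t (Metric.sphere_subset_ball hr.2 ht) (by rintro rfl; simp at ht'; exact hr.1.ne ht')
      rw [ht'] at this
      exact mul_le_mul_of_nonneg_right this (zpow_nonneg hr.1.le _)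
    refine h0.trans_eq ?_
    have := hr.1.ne'
    rw [show k - m = 1 + k + (-m - 1) by ring, zpow_add₀ this, zpow_add₀ this, zpow_one]
    ring
  refine squeeze_zero_norm' hb ?_
  obtain ⟨l, hl⟩ : ∃ l : ℕ, k - m = (l + 1 : ℕ) := ⟨(k - m - 1).toNat, by omega⟩
  simp only [hl, zpow_natCast]
  have : Tendsto (fun r : ℝ => C * r ^ (l + 1)) (𝓝 0) (𝓝 (C * 0 ^ (l + 1))) :=
    (continuous_const.mul (continuous_id.pow _)).tendsto 0
  simpa using this.mono_left nhdsWithin_le_nhds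

/-! ### Directional derivatives of analytic functions -/

section Directional

variable {E : Type*} [NormedAddCommGroup E] [NormedSpace ℂ E]

/-- The derivative of `h` in the direction `v`. -/
def dd (v : E) (h : E → ℂ) (x : E) : ℂ := fderiv ℂ h x v

lemma analyticAt_dd {h : E → ℂ} {x : E} (v : E) (hh : AnalyticAt ℂ h x) :
    AnalyticAt ℂ (dd v h) x :=
  ((ContinuousLinearMap.apply ℂ ℂ v).analyticAt _).fun_comp hh.fderiv

lemma analyticAt_dd_iterate {h : E → ℂ} {x : E} (v : E) (hh : AnalyticAt ℂ h x) (M : ℕ) :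
    AnalyticAt ℂ ((dd v)^[M] h) x := by
  induction M generalizing h with
  | zero => exact hh
  | succ M ih => exact ih (analyticAt_dd v hh)

lemma dd_congr {h h' : E → ℂ} {x : E} (v : E) (H : h =ᶠ[𝓝 x] h') : dd v h =ᶠ[𝓝 x] dd v h' := by
  filter_upwards [H.fderiv (𝕜 := ℂ)] with y hy
  simp only [dd, hy]

lemma dd_iterate_congr {h h' : E → ℂ} {x : E} (v : E) (H : h =ᶠ[𝓝 x] h') (M : ℕ) :
    (dd v)^[M] h =ᶠ[𝓝 x] (dd v)^[M] h' := by
  induction M generalizing h h' with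
  | zero => exact H
  | succ M ih => exact ih (dd_congr v H)

lemma dd_comm {h : E → ℂ} {x : E} (v w : E) (hh : AnalyticAt ℂ h x) :
    dd v (dd w h) =ᶠ[𝓝 x] dd w (dd v h) := by
  filter_upwards [hh.eventually_analyticAt] with y hy
  have hs : IsSymmSndFDerivAt ℂ h y := (hy.contDiffAt (n := ⊤)).isSymmSndFDerivAt (by simp)
  have e : ∀ a b : E, dd a (dd b h) y = fderiv ℂ (fderiv ℂ h) y a b := by
    intro a b
    have := ((ContinuousLinearMap.apply ℂ ℂ b).hasFDerivAt.comp y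
      hy.fderiv.differentiableAt.hasFDerivAt).fderiv
    exact congrArg (fun L => L a) this
  rw [e, e, hs]

lemma dd_dd_iterate {h : E → ℂ} {x : E} (v w : E) (hh : AnalyticAt ℂ h x) (M : ℕ) :
    dd w ((dd v)^[M] h) =ᶠ[𝓝 x] (dd v)^[M] (dd w h) := by
  induction M generalizing h with
  | zero => rfl
  | succ M ih =>
    exact (ih (analyticAt_dd v hh)).trans (dd_iterate_congr v (dd_comm w v hh) M)

lemma dd_iterate_comm {h : E → ℂ} {x : E} (v w : E) (hh : AnalyticAt ℂ h x) (M M' : ℕ) :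
    (dd w)^[M'] ((dd v)^[M] h) =ᶠ[𝓝 x] (dd v)^[M] ((dd w)^[M'] h) := by
  induction M' generalizing h with
  | zero => rfl
  | succ M' ih =>
    exact (dd_iterate_congr w (dd_dd_iterate v w hh M) M').trans (ih (analyticAt_dd w hh))

lemma tendsto_line (x v : E) : Tendsto (fun t : ℂ => x + t • v) (𝓝 0) (𝓝 x) := by
  have : Continuous fun t : ℂ => x + t • v := by fun_prop
  simpa using this.tendsto 0

lemma deriv_line {h : E → ℂ} {x v : E} {t : ℂ} (hh : DifferentiableAt ℂ h (x + t • v)) :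
    deriv (fun s : ℂ => h (x + s • v)) t = dd v h (x + t • v) := by
  have h1 : HasDerivAt (fun s : ℂ => x + s • v) v t := by
    simpa using ((hasDerivAt_id t).smul_const v).const_add x
  exact (hh.hasFDerivAt.comp_hasDerivAt t h1).deriv

lemma iteratedDeriv_line {h : E → ℂ} {x : E} (v : E) (hh : AnalyticAt ℂ h x) (M : ℕ) :
    iteratedDeriv M (fun t : ℂ => h (x + t • v)) =ᶠ[𝓝 0] fun t => (dd v)^[M] h (x + t • v) := by
  induction M generalizing h with
  | zero => simp
  | succ M ih =>
    rw [iteratedDeriv_succ']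
    have h1 : deriv (fun t : ℂ => h (x + t • v)) =ᶠ[𝓝 0] fun t => dd v h (x + t • v) := by
      filter_upwards [(tendsto_line x v).eventually hh.eventually_analyticAt] with t ht
      exact deriv_line ht.differentiableAt
    exact (h1.iteratedDeriv M).trans (ih (analyticAt_dd v hh))

/-- The `k`-th Taylor coefficient of `h` at `x` along the line through `x` in direction `v`. -/
def ddc (k : ℤ) (v : E) (h : E → ℂ) (x : E) : ℂ :=
  if 0 ≤ k then (dd v)^[k.toNat] h x / (k.toNat.factorial : ℂ) else 0

lemma tc_line {h : E → ℂ} {x : E} (k : ℤ) (v : E) (hh : AnalyticAt ℂ h x) :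
    tc k (fun t : ℂ => h (x + t • v)) = ddc k v h x := by
  unfold tc ddc
  rw [(iteratedDeriv_line v hh _).eq_of_nhds]
  simp

lemma analyticAt_ddc {h : E → ℂ} {x : E} (k : ℤ) (v : E) (hh : AnalyticAt ℂ h x) :
    AnalyticAt ℂ (ddc k v h) x := by
  unfold ddc
  split_ifs
  · exact (analyticAt_dd_iterate v hh _).div_const
  · exact analyticAt_const

lemma dd_const_mul {h : E → ℂ} {x : E} (v : E) (c : ℂ) (hh : DifferentiableAt ℂ h x) :
    dd v (fun y => c * h y) x = c * dd v h x := by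
  simp [dd, fderiv_const_mul hh]

lemma dd_ddc {h : E → ℂ} {x : E} (k : ℤ) (v w : E) (hh : AnalyticAt ℂ h x) :
    dd w (ddc k v h) x = ddc k v (dd w h) x := by
  unfold ddc
  split_ifs with hk
  · rw [← (dd_dd_iterate v w hh k.toNat).eq_of_nhds]
    have := dd_const_mul w ((k.toNat.factorial : ℂ)⁻¹)
      (analyticAt_dd_iterate v hh k.toNat).differentiableAt
    simpa [div_eq_inv_mul] using this
  · simp [dd]

lemma dd_iterate_const_mul {h : E → ℂ} {x : E} (v : E) (c : ℂ) (hh : AnalyticAt ℂ h x) (M : ℕ) :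
    (dd v)^[M] (fun y => c * h y) =ᶠ[𝓝 x] fun y => c * (dd v)^[M] h y := by
  induction M generalizing h with
  | zero => rfl
  | succ M ih =>
    refine (dd_iterate_congr v ?_ M).trans (ih (analyticAt_dd v hh))
    filter_upwards [hh.eventually_analyticAt] with y hy
    exact dd_const_mul v c hy.differentiableAt

lemma ddc_comm {h : E → ℂ} {x : E} (k l : ℤ) (v w : E) (hh : AnalyticAt ℂ h x) :
    ddc l w (ddc k v h) x = ddc k v (ddc l w h) x := by
  unfold ddc
  split_ifs with hk hl hl
  · simp only [div_eq_inv_mul]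
    rw [(dd_iterate_const_mul w _ (analyticAt_dd_iterate v hh _) _).eq_of_nhds,
      (dd_iterate_const_mul v _ (analyticAt_dd_iterate w hh _) _).eq_of_nhds,
      (dd_iterate_comm v w hh _ _).eq_of_nhds]
    ring
  · have := (dd_iterate_const_mul w 0 hh l.toNat).eq_of_nhds
    simp only [zero_mul] at this
    simp [this]
  · have := (dd_iterate_const_mul v 0 hh k.toNat).eq_of_nhds
    simp only [zero_mul] at this
    simp [this]
  · rfl

/-- Differentiating a quotient `g / D ^ K` repeatedly raises the pole order along `D = 0` by one
each time. -/
lemma dd_iterate_div_pow {g D : E → ℂ} {x : E} (v : E) (hg : AnalyticAt ℂ g x)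
    (hD : AnalyticAt ℂ D x) (K M : ℕ) : ∃ G : E → ℂ, AnalyticAt ℂ G x ∧
      ∀ᶠ y in 𝓝 x, D y ≠ 0 → (dd v)^[M] (fun z => g z / D z ^ K) y = G y / D y ^ (K + M) := by
  induction M with
  | zero => exact ⟨g, hg, by simp⟩
  | succ M ih =>
    obtain ⟨G, hG, H⟩ := ih
    refine ⟨fun y => dd v G y * D y - (K + M : ℕ) * G y * dd v D y,
      ((analyticAt_dd v hG).mul hD).sub ((analyticAt_const.mul hG).mul (analyticAt_dd v hD)), ?_⟩
    filter_upwards [H.eventually_nhds, hG.eventually_analyticAt, hD.eventually_analyticAt]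
      with y hy hGy hDy hne
    have hne' : ∀ᶠ z in 𝓝 y, D z ≠ 0 := hDy.continuousAt.eventually_ne hne
    have hEq : (dd v)^[M] (fun z => g z / D z ^ K) =ᶠ[𝓝 y] fun z => G z * (D z ^ (K + M))⁻¹ := by
      filter_upwards [hy, hne'] with z h1 h2
      rw [h1 h2, div_eq_mul_inv]
    have d1 := hGy.differentiableAt.hasFDerivAt
    have d2 := hDy.differentiableAt.hasFDerivAt
    have d3 : HasFDerivAt (fun z => (D z ^ (K + M))⁻¹)
        ((-((D y ^ (K + M)) ^ 2)⁻¹ * ((K + M : ℕ) * D y ^ (K + M - 1))) • fderiv ℂ D y) y :=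
      ((hasDerivAt_inv (pow_ne_zero (K + M) hne)).comp (D y)
        (hasDerivAt_pow (K + M) (D y))).comp_hasFDerivAt y d2
    rw [Function.iterate_succ_apply', dd, hEq.fderiv_eq, (d1.fun_mul d3).fderiv]
    rw [← add_assoc]
    generalize K + M = L
    unfold dd
    rcases L with _ | L
    · simp; field_simp
    · simp
      field_simp
      ring

/-- Laurent coefficients of a family of functions `t ↦ g (x + t v) / (t ^ N D (x + t v) ^ K)`, as
functions of `x`, have poles of bounded order along `D = 0`. -/
lemma exists_lc_eq_div_pow {g D : E → ℂ} {P : E} (v : E) (hg : AnalyticAt ℂ g P)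
    (hD : AnalyticAt ℂ D P) (N K : ℕ) (m : ℤ) : ∃ G : E → ℂ, AnalyticAt ℂ G P ∧
      (m + N < 0 → G = fun _ => 0) ∧
      ∀ᶠ x in 𝓝 P, D x ≠ 0 → ∀ φ : ℂ → ℂ,
        (∀ᶠ t in 𝓝[≠] 0, φ t = g (x + t • v) / (t ^ N * D (x + t • v) ^ K)) →
        lc m φ = G x / D x ^ (K + (m + N).toNat) := by
  obtain ⟨G, hG, H⟩ := dd_iterate_div_pow v hg hD K (m + N).toNat
  by_cases hm : m + N < 0
  · refine ⟨fun _ => 0, analyticAt_const, fun _ => rfl, ?_⟩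
    filter_upwards [hg.eventually_analyticAt, hD.eventually_analyticAt] with x hgx hDx hne φ hφ
    have ha : AnalyticAt ℂ (fun z => g z / D z ^ K) x := hgx.div (hDx.pow K) (pow_ne_zero _ hne)
    rw [zero_div]
    refine lc_eq_zero_of_lt (h := fun t => g (x + t • v) / D (x + t • v) ^ K) (N := N)
      (by omega) ?_ ?_
    · refine AnalyticAt.comp_of_eq (f := fun t : ℂ => x + t • v) ha (by fun_prop) (by simp)
    · filter_upwards [hφ] with t ht
      rw [ht, div_div, mul_comm]
  · refine ⟨fun x => G x / ((m + N).toNat.factorial : ℂ), hG.div_const, fun h => absurd h hm, ?_⟩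
    filter_upwards [H, hg.eventually_analyticAt, hD.eventually_analyticAt]
      with x hx hgx hDx hne φ hφ
    have ha : AnalyticAt ℂ (fun z => g z / D z ^ K) x := hgx.div (hDx.pow K) (pow_ne_zero _ hne)
    rw [lc_eq_tc (h := fun t => g (x + t • v) / D (x + t • v) ^ K) N m]
    · rw [tc_line (h := fun z => g z / D z ^ K) _ v ha, ddc, if_pos (by omega), hx hne]
      ring
    · refine AnalyticAt.comp_of_eq (f := fun t : ℂ => x + t • v) ha (by fun_prop) (by simp)
    · filter_upwards [hφ] with t ht
      rw [ht, div_div, mul_comm]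

end Directional

/-! ### Laurent expansion along a divisor -/

/-- The point of the divisor `x_i = x_j` obtained from a point `y` in the remaining variables by
inserting `x_i := x_j`. -/
def diag {n : ℕ} (i j : Fin (n + 1)) (y : Fin n → ℂ) : Fin (n + 1) → ℂ :=
  i.insertNth (pts y j) y

lemma insertNth_eq_diag {n : ℕ} (i j : Fin (n + 1)) (y : Fin n → ℂ) (t : ℂ) :
    (i.insertNth (pts y j + t) y : Fin (n + 1) → ℂ) = diag i j y + t • Pi.single i 1 := by
  ext k
  induction k using Fin.succAboveCases i with
  | x => simp [diag]
  | p k => simp [diag]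

lemma pts_insertNth {n : ℕ} (i : Fin (n + 1)) (c : ℂ) (y : Fin n → ℂ) :
    pts (i.insertNth c y : Fin (n + 1) → ℂ) = i.castSucc.insertNth c (pts y) := by
  ext k
  induction k using Fin.succAboveCases i.castSucc with
  | x => simp [pts]
  | p k =>
    rw [Fin.insertNth_apply_succAbove]
    induction k using Fin.lastCases with
    | last => simp [pts]
    | cast k => rw [Fin.castSucc_succAbove_castSucc]; simp [pts]

lemma pts_add {n : ℕ} (x y : Fin n → ℂ) (k : Fin (n + 1)) :
    pts (x + y) k = pts x k + pts y k := by
  induction k using Fin.lastCases <;> simp [pts]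

lemma pts_smul {n : ℕ} (c : ℂ) (x : Fin n → ℂ) (k : Fin (n + 1)) :
    pts (c • x) k = c * pts x k := by
  induction k using Fin.lastCases <;> simp [pts]

/-- The relabelling of points under which the divisor `x_i = x_j` is the configuration space with
`x_i` deleted. -/
def relabel {n : ℕ} (i j : Fin (n + 1)) : Fin (n + 2) → Fin (n + 1) :=
  i.castSucc.insertNth j id

lemma pts_diag {n : ℕ} (i j : Fin (n + 1)) (y : Fin n → ℂ) (k : Fin (n + 2)) :
    pts (diag i j y) k = pts y (relabel i j k) := by
  rw [diag, pts_insertNth]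
  induction k using Fin.succAboveCases i.castSucc <;> simp [relabel]

/-- The divisor `x_i = x_j`, where `j` is the position of `x_j` after deletion of `x_i`. -/
def divIdx {n : ℕ} {i j : Fin (n + 1)} (hij : i ≤ j) : DivIdx (n + 1) :=
  ⟨(i.castSucc, j.succ), Fin.castSucc_lt_succ_iff.mpr hij⟩

lemma succAbove_of_le {n : ℕ} {i j : Fin (n + 1)} (hij : i ≤ j) :
    i.castSucc.succAbove j = j.succ := Fin.succAbove_castSucc_of_le _ _ hij

lemma relabel_ne {n : ℕ} {i j : Fin (n + 1)} (hij : i ≤ j) {k : DivIdx (n + 1)}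
    (hk : k ≠ divIdx hij) : relabel i j k.1.1 ≠ relabel i j k.1.2 := by
  obtain ⟨⟨a, b⟩, hab⟩ := k
  have hab : a < b := hab
  intro h
  induction a using Fin.succAboveCases i.castSucc with
  | x =>
    induction b using Fin.succAboveCases i.castSucc with
    | x => exact hab.ne rfl
    | p b =>
      simp only [relabel, Fin.insertNth_apply_same, Fin.insertNth_apply_succAbove, id] at h
      subst h
      exact hk (Subtype.ext (Prod.ext rfl (succAbove_of_le hij)))
  | p a =>
    induction b using Fin.succAboveCases i.castSucc with
    | x =>
      simp only [relabel, Fin.insertNth_apply_same, Fin.insertNth_apply_succAbove, id] at h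
      subst h
      rw [succAbove_of_le hij] at hab
      exact absurd hab (Fin.castSucc_lt_succ_iff.mpr hij).not_gt
    | p b =>
      simp only [relabel, Fin.insertNth_apply_succAbove, id] at h
      subst h
      exact hab.ne rfl

/-- A divisor other than `x_i = x_j` restricts to a divisor in the remaining variables. -/
lemma exists_divFun_diag {n : ℕ} {i j : Fin (n + 1)} (hij : i ≤ j) {k : DivIdx (n + 1)}
    (hk : k ≠ divIdx hij) : ∃ (k' : DivIdx n) (ε : ℤ), ε * ε = 1 ∧
      ∀ y : Fin n → ℂ, divFun k (diag i j y) = ε * divFun k' y := by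
  rcases lt_or_gt_of_ne (relabel_ne hij hk) with h | h
  · exact ⟨⟨(relabel i j k.1.1, relabel i j k.1.2), h⟩, 1, by norm_num, fun y => by simp [divFun, pts_diag]⟩
  · exact ⟨⟨(relabel i j k.1.2, relabel i j k.1.1), h⟩, -1, by norm_num, fun y => by simp [divFun, pts_diag]⟩

open Classical in
/-- The divisor in the remaining variables to which a divisor other than `x_i = x_j` restricts. -/
def divRestr {n : ℕ} {i j : Fin (n + 1)} (hij : i ≤ j)
    (k : {k : DivIdx (n + 1) // k ≠ divIdx hij}) : DivIdx n :=
  (exists_divFun_diag hij k.2).choose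

/-- The sign relating the equations of a divisor and of its restriction to `x_i = x_j`. -/
def divSign {n : ℕ} {i j : Fin (n + 1)} (hij : i ≤ j)
    (k : {k : DivIdx (n + 1) // k ≠ divIdx hij}) : ℤ :=
  (exists_divFun_diag hij k.2).choose_spec.choose

lemma divSign_mul_self {n : ℕ} {i j : Fin (n + 1)} (hij : i ≤ j)
    (k : {k : DivIdx (n + 1) // k ≠ divIdx hij}) : divSign hij k * divSign hij k = 1 :=
  (exists_divFun_diag hij k.2).choose_spec.choose_spec.1

lemma divFun_diag {n : ℕ} {i j : Fin (n + 1)} (hij : i ≤ j)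
    (k : {k : DivIdx (n + 1) // k ≠ divIdx hij}) (y : Fin n → ℂ) :
    divFun k.1 (diag i j y) = divSign hij k * divFun (divRestr hij k) y :=
  (exists_divFun_diag hij k.2).choose_spec.choose_spec.2 y

lemma divFun_divIdx_diag {n : ℕ} {i j : Fin (n + 1)} (hij : i ≤ j) (y : Fin n → ℂ) :
    divFun (divIdx hij) (diag i j y) = 0 := by
  simp only [divFun, divIdx, pts_diag, relabel, Fin.insertNth_apply_same]
  rw [← succAbove_of_le hij, Fin.insertNth_apply_succAbove]
  simp

lemma divFun_add {n : ℕ} (k : DivIdx n) (x y : Fin n → ℂ) :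
    divFun k (x + y) = divFun k x + divFun k y := by
  simp only [divFun, pts_add]; ring

lemma divFun_smul {n : ℕ} (k : DivIdx n) (c : ℂ) (x : Fin n → ℂ) :
    divFun k (c • x) = c * divFun k x := by
  simp only [divFun, pts_smul]; ring

lemma divFun_divIdx_single {n : ℕ} {i j : Fin (n + 1)} (hij : i ≤ j) :
    divFun (divIdx hij) (Pi.single i 1) = 1 := by
  have h : pts (Pi.single i 1 : Fin (n + 1) → ℂ) i.castSucc = 1 := by simp [pts]
  have h' : pts (Pi.single i 1 : Fin (n + 1) → ℂ) j.succ = 0 := by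
    rcases Fin.eq_castSucc_or_eq_last j.succ with ⟨k, hk⟩ | hk
    · rw [hk]
      simp only [pts, Fin.snoc_castSucc]
      rw [Pi.single_eq_of_ne]
      rintro rfl
      have := Fin.castSucc_lt_succ_iff.mpr hij
      rw [hk] at this
      exact this.ne rfl
    · rw [hk]; simp [pts]
  simp only [divFun, divIdx, h, h', sub_zero]

lemma sign_mul_mem_lattice {τ : UpperHalfPlane} {ε : ℤ} (hε : ε * ε = 1) (w : ℂ) :
    (ε : ℂ) * w ∈ (periods τ).lattice ↔ w ∈ (periods τ).lattice := by
  rcases mul_self_eq_one_iff.mp hε with rfl | rfl <;> simp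

lemma mem_through {τ : UpperHalfPlane} {n : ℕ} {P : Fin n → ℂ} {k : DivIdx n} :
    k ∈ through τ P ↔ divFun k P ∈ (periods τ).lattice := by
  simp [through]

lemma divRestr_mem_through {τ : UpperHalfPlane} {n : ℕ} {i j : Fin (n + 1)} (hij : i ≤ j)
    (k : {k : DivIdx (n + 1) // k ≠ divIdx hij}) (P : Fin n → ℂ) :
    k.1 ∈ through τ (diag i j P) ↔ divRestr hij k ∈ through τ P := by
  rw [mem_through, mem_through, divFun_diag, sign_mul_mem_lattice (divSign_mul_self hij k)]

lemma continuous_diag {n : ℕ} (i j : Fin (n + 1)) :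
    Continuous (diag i j : (Fin n → ℂ) → Fin (n + 1) → ℂ) := by
  refine continuous_pi fun k => ?_
  have h : ∀ l : Fin (n + 1), Continuous fun y : Fin n → ℂ => pts y l := fun l => by
    induction l using Fin.lastCases with
    | last => simpa [pts] using continuous_const
    | cast l => simpa [pts] using continuous_apply l
  induction k using Fin.succAboveCases i with
  | x => simpa [diag] using h j
  | p k => simpa [diag] using continuous_apply k

/-- `diag` as a linear map. -/
def diagL {n : ℕ} (i j : Fin (n + 1)) : (Fin n → ℂ) →L[ℂ] (Fin (n + 1) → ℂ) where
  toFun := diag i j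
  map_add' x y := by
    ext k
    induction k using Fin.succAboveCases i <;> simp [diag, pts_add]
  map_smul' c x := by
    ext k
    induction k using Fin.succAboveCases i <;> simp [diag, pts_smul]
  cont := continuous_diag i j

lemma analyticAt_diag {n : ℕ} (i j : Fin (n + 1)) (P : Fin n → ℂ) :
    AnalyticAt ℂ (diag i j) P := (diagL i j).analyticAt P

lemma tendsto_diag {n : ℕ} (i j : Fin (n + 1)) (P : Fin n → ℂ) :
    Tendsto (diag i j) (𝓝 P) (𝓝 (diag i j P)) := (continuous_diag i j).tendsto P

lemma eventually_notMem_lattice (τ : UpperHalfPlane) {w : ℂ} (hw : w ∉ (periods τ).lattice) :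
    ∀ᶠ z in 𝓝 w, z ∉ (periods τ).lattice :=
  (periods τ).isClosed_lattice.isOpen_compl.mem_nhds hw

lemma eventually_notMem_lattice_zero (τ : UpperHalfPlane) :
    ∀ᶠ z in 𝓝[≠] (0 : ℂ), z ∉ (periods τ).lattice := by
  have := (periods τ).compl_lattice_sdiff_singleton_mem_nhds 0
  filter_upwards [mem_nhdsWithin_of_mem_nhds this, self_mem_nhdsWithin] with z hz hz0 h
  exact hz ⟨h, hz0⟩

/-- Near a generic point of the divisor `x_i = x_j`, only points of that divisor are not in the
configuration space. -/
lemma eventually_mem_conf {τ : UpperHalfPlane} {n : ℕ} {i j : Fin (n + 1)} (hij : i ≤ j)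
    {y : Fin n → ℂ} (hy : y ∈ conf τ n) :
    ∀ᶠ t in 𝓝[≠] (0 : ℂ), diag i j y + t • Pi.single i 1 ∈ conf τ (n + 1) := by
  refine eventually_all.mpr fun k => ?_
  by_cases hk : k = divIdx hij
  · filter_upwards [eventually_notMem_lattice_zero τ] with t ht
    rwa [hk, divFun_add, divFun_smul, divFun_divIdx_diag, divFun_divIdx_single, zero_add, mul_one]
  · have h1 : divFun k (diag i j y) ∉ (periods τ).lattice := by
      rw [divFun_diag hij ⟨k, hk⟩, sign_mul_mem_lattice (divSign_mul_self hij _)]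
      exact hy _
    have h2 : Tendsto (fun t : ℂ => divFun k (diag i j y + t • Pi.single i 1)) (𝓝 0)
        (𝓝 (divFun k (diag i j y))) :=
      (analyticAt_divFun k _).continuousAt.tendsto.comp (tendsto_line _ _)
    exact (h2.eventually (eventually_notMem_lattice τ h1)).filter_mono nhdsWithin_le_nhds

lemma laurentCoeff_of_mem {τ : UpperHalfPlane} {n : ℕ} (i j : Fin (n + 1)) (m : ℤ)
    (f : (Fin (n + 1) → ℂ) → ℂ) {y : Fin n → ℂ} (hy : y ∈ conf τ n) :
    laurentCoeff τ i j m f y = lc m fun t => f (diag i j y + t • Pi.single i 1) := by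
  simp only [laurentCoeff, Set.indicator_of_mem hy, insertNth_eq_diag]
  rfl

lemma laurentCoeff_of_notMem {τ : UpperHalfPlane} {n : ℕ} (i j : Fin (n + 1)) (m : ℤ)
    (f : (Fin (n + 1) → ℂ) → ℂ) {y : Fin n → ℂ} (hy : y ∉ conf τ n) :
    laurentCoeff τ i j m f y = 0 := Set.indicator_of_notMem hy _

lemma locEq_insert_line {n : ℕ} {i j : Fin (n + 1)} (hij : i ≤ j) (P y : Fin n → ℂ) (t : ℂ)
    (S : Finset (DivIdx (n + 1))) (hS : divIdx hij ∈ S) :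
    locEq (diag i j P) S (diag i j y + t • Pi.single i 1) =
      t * locEq (diag i j P) (S.erase (divIdx hij)) (diag i j y + t • Pi.single i 1) := by
  unfold locEq
  rw [← Finset.mul_prod_erase S _ hS, divFun_add, divFun_smul, divFun_divIdx_diag,
    divFun_divIdx_diag, divFun_divIdx_single]
  simp

/-- The local equation of divisors other than `x_i = x_j`, restricted to `x_i = x_j`, divides a power
of the local equation of their restrictions. -/
lemma exists_locEq_diag {n : ℕ} {i j : Fin (n + 1)} (hij : i ≤ j) (S : Finset (DivIdx (n + 1)))
    (hS : divIdx hij ∉ S) : ∃ S' : Finset (DivIdx n), S'.card ≤ S.card ∧ ∀ P : Fin n → ℂ,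
      (∀ τ, S ⊆ through τ (diag i j P) → S' ⊆ through τ P) ∧
      ∃ B : (Fin n → ℂ) → ℂ, (∀ Q, AnalyticAt ℂ B Q) ∧ ∀ y,
        locEq (diag i j P) S (diag i j y) * B y = locEq P S' y ^ Fintype.card (DivIdx (n + 1)) := by
  classical
  have hne : ∀ k ∈ S, k ≠ divIdx hij := fun k hk h => hS (h ▸ hk)
  set f : {k // k ∈ S} → DivIdx n := fun k => divRestr hij ⟨k.1, hne k.1 k.2⟩ with hf
  refine ⟨S.attach.image f, Finset.card_image_le.trans (Finset.card_attach).le, fun P =>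
    ⟨fun τ h k' hk' => ?_, ?_⟩⟩
  · obtain ⟨k, -, rfl⟩ := Finset.mem_image.mp hk'
    exact (divRestr_mem_through hij _ P).mp (h k.2)
  · set C := Fintype.card (DivIdx (n + 1))
    refine ⟨fun y => (∏ k : {k // k ∈ S}, (divSign hij ⟨k.1, hne k.1 k.2⟩ : ℂ)) *
      ∏ k' ∈ S.attach.image f,
        (divFun k' y - divFun k' P) ^ (C - (S.attach.filter fun k => f k = k').card), ?_, ?_⟩
    · intro Q
      refine analyticAt_const.mul (Finset.analyticAt_fun_prod _ fun k _ => ?_)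
      exact ((analyticAt_divFun k Q).sub analyticAt_const).pow _
    · intro y
      have h1 : locEq (diag i j P) S (diag i j y) =
          (∏ k : {k // k ∈ S}, (divSign hij ⟨k.1, hne k.1 k.2⟩ : ℂ)) *
            ∏ k' ∈ S.attach.image f,
              (divFun k' y - divFun k' P) ^ (S.attach.filter fun k => f k = k').card := by
        have h2 : ∏ k' ∈ S.attach.image f,
              (divFun k' y - divFun k' P) ^ (S.attach.filter fun k => f k = k').card =
              ∏ k ∈ S.attach, (divFun (f k) y - divFun (f k) P) :=
          (Finset.prod_comp (fun k' => divFun k' y - divFun k' P) f).symm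
        rw [h2, Finset.univ_eq_attach, ← Finset.prod_mul_distrib, locEq, ← Finset.prod_attach]
        refine Finset.prod_congr rfl fun k _ => ?_
        rw [divFun_diag hij ⟨k.1, hne k.1 k.2⟩, divFun_diag hij ⟨k.1, hne k.1 k.2⟩, mul_sub]
      have h3 : (∏ k : {k // k ∈ S}, (divSign hij ⟨k.1, hne k.1 k.2⟩ : ℂ)) *
          (∏ k : {k // k ∈ S}, (divSign hij ⟨k.1, hne k.1 k.2⟩ : ℂ)) = 1 := by
        rw [← Finset.prod_mul_distrib]
        refine Finset.prod_eq_one fun k _ => ?_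
        exact_mod_cast divSign_mul_self hij ⟨k.1, hne k.1 k.2⟩
      rw [h1, mul_mul_mul_comm, h3, one_mul, ← Finset.prod_mul_distrib, locEq, ← Finset.prod_pow]
      refine Finset.prod_congr rfl fun k' _ => ?_
      rw [← pow_add]
      congr 1
      have : (S.attach.filter fun k => f k = k').card ≤ C :=
        (Finset.card_filter_le _ _).trans (by rw [Finset.card_attach]; exact Finset.card_le_univ S)
      omega

/-- Local form of the Laurent coefficients along `x_i = x_j` of a function with poles along a set `S`
of divisors: they have poles along the restrictions of the divisors in `S` other than `x_i = x_j`, and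
those of negative degree vanish unless `x_i = x_j` is in `S`, those of degree below `-N` in any case. -/
lemma exists_lc_local {n : ℕ} {i j : Fin (n + 1)} (hij : i ≤ j) (N : ℕ) (m : ℤ) :
    ∃ N' : ℕ, ∀ (τ : UpperHalfPlane) (P : Fin n → ℂ) (S : Finset (DivIdx (n + 1))),
      S ⊆ through τ (diag i j P) →
      ∃ S' ⊆ through τ P, S'.card ≤ (S.erase (divIdx hij)).card ∧
        ∀ g : (Fin (n + 1) → ℂ) → ℂ, AnalyticAt ℂ g (diag i j P) →
        ∃ G : (Fin n → ℂ) → ℂ, AnalyticAt ℂ G P ∧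
        (m < -N ∨ (divIdx hij ∉ S ∧ m < 0) → G = fun _ => 0) ∧
        ∀ᶠ y in 𝓝 P, y ∈ conf τ n → ∀ φ : ℂ → ℂ,
          (∀ᶠ t in 𝓝[≠] 0, φ t = g (diag i j y + t • Pi.single i 1) /
            locEq (diag i j P) S (diag i j y + t • Pi.single i 1) ^ N) →
          lc m φ = G y / locEq P S' y ^ N' := by
  classical
  set C := Fintype.card (DivIdx (n + 1))
  refine ⟨C * (N + (m + N).toNat), fun τ P S hS => ?_⟩
  obtain ⟨S', hc, hS'⟩ := exists_locEq_diag hij (S.erase (divIdx hij)) (Finset.notMem_erase _ _)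
  obtain ⟨hsub, B, hB, hBeq⟩ := hS' P
  have hsub := hsub τ ((Finset.erase_subset _ _).trans hS)
  refine ⟨S', hsub, hc, fun g hg => ?_⟩
  set D := locEq (diag i j P) (S.erase (divIdx hij)) with hD
  have hDa : ∀ Q, AnalyticAt ℂ D Q := analyticAt_locEq _ _
  set N₀ := if divIdx hij ∈ S then N else 0 with hN₀
  obtain ⟨G, hG, hG0, H⟩ := exists_lc_eq_div_pow (Pi.single i 1) hg (hDa (diag i j P)) N₀ N m
  have hle : (m + N₀).toNat ≤ (m + N).toNat := by
    rw [hN₀]; split_ifs <;> omega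
  refine ⟨fun y => G (diag i j y) * B y ^ (N + (m + N).toNat) *
    D (diag i j y) ^ ((m + N).toNat - (m + N₀).toNat), ?_, ?_, ?_⟩
  · have h1 : ∀ u : (Fin (n + 1) → ℂ) → ℂ, AnalyticAt ℂ u (diag i j P) →
        AnalyticAt ℂ (fun y => u (diag i j y)) P := fun u hu => hu.fun_comp (analyticAt_diag i j P)
    exact ((h1 G hG).mul ((hB P).pow _)).mul ((h1 D (hDa _)).pow _)
  · intro hm
    rw [hG0 ?_]
    · simp
    · rw [hN₀]
      rcases hm with hm | ⟨hnot, hm⟩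
      · split_ifs <;> omega
      · rw [if_neg hnot]; omega
  · filter_upwards [(tendsto_diag i j P).eventually H] with y hy hyc φ hφ
    have hne : locEq P S' y ≠ 0 := locEq_ne_zero hsub hyc
    have hDB : D (diag i j y) * B y = locEq P S' y ^ C := hBeq y
    have hprod : D (diag i j y) * B y ≠ 0 := hDB ▸ pow_ne_zero _ hne
    have hDne := left_ne_zero_of_mul hprod
    have hBne := right_ne_zero_of_mul hprod
    rw [hy hDne φ ?_, pow_mul, ← hDB]
    · obtain ⟨d, hd⟩ := Nat.exists_eq_add_of_le hle
      rw [hd, Nat.add_sub_cancel_left]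
      field_simp
      ring
    · filter_upwards [hφ] with t ht
      rw [ht, hN₀]
      split_ifs with hmem
      · rw [locEq_insert_line hij P y t S hmem, mul_pow]
      · rw [hD, Finset.erase_eq_of_notMem hmem, pow_zero, one_mul]

/-! ### Laurent coefficients of functions on configuration spaces -/

/-- Functions that near `P` are sums of products of at most `c` functions, each having poles along a
single divisor through `P`. -/
def locG (τ : UpperHalfPlane) {n : ℕ} (P : Fin n → ℂ) (c : ℤ) : Submodule ℂ ((Fin n → ℂ) → ℂ) where
  carrier := {F | ∃ (N : ℕ) (g : Finset (DivIdx n) → (Fin n → ℂ) → ℂ),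
    (∀ S, AnalyticAt ℂ (g S) P) ∧
    ∀ᶠ x in 𝓝 P, x ∈ conf τ n →
      F x = ∑ S ∈ (through τ P).powerset with (S.card : ℤ) ≤ c, g S x / locEq P S x ^ N}
  zero_mem' := ⟨0, fun _ _ => 0, fun _ => analyticAt_const, by simp⟩
  add_mem' := by
    rintro f f' ⟨N, g, hg, hfg⟩ ⟨N', g', hg', hfg'⟩
    refine ⟨N + N', fun S x => g S x * locEq P S x ^ N' + g' S x * locEq P S x ^ N,
      fun S => ((hg S).mul ((analyticAt_locEq P S P).pow _)).add
        ((hg' S).mul ((analyticAt_locEq P S P).pow _)), ?_⟩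
    filter_upwards [hfg, hfg'] with x hx hx' hxc
    rw [Pi.add_apply, hx hxc, hx' hxc, ← Finset.sum_add_distrib]
    refine Finset.sum_congr rfl fun S hS => ?_
    have hne := locEq_ne_zero (P := P)
      (Finset.mem_powerset.mp (Finset.mem_filter.mp hS).1) hxc
    field_simp
    ring
  smul_mem' := by
    rintro c f ⟨N, g, hg, hfg⟩
    refine ⟨N, fun S x => c * g S x, fun S => analyticAt_const.mul (hg S), ?_⟩
    filter_upwards [hfg] with x hx hxc
    simp [hx hxc, mul_div_assoc, Finset.mul_sum]

lemma mem_GGam_iff {τ : UpperHalfPlane} {n : ℕ} {q : ℤ} {f : Gam τ n} :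
    f ∈ GGam τ n q ↔ ∀ P, toFun τ n f ∈ locG τ P (q + n) := Iff.rfl

lemma locG_congr {τ : UpperHalfPlane} {n : ℕ} {P : Fin n → ℂ} {c : ℤ} {F F' : (Fin n → ℂ) → ℂ}
    (h : ∀ᶠ x in 𝓝 P, x ∈ conf τ n → F x = F' x) (hF' : F' ∈ locG τ P c) : F ∈ locG τ P c := by
  obtain ⟨N, g, hg, hfg⟩ := hF'
  refine ⟨N, g, hg, ?_⟩
  filter_upwards [h, hfg] with x h1 h2 hx
  rw [h1 hx, h2 hx]

lemma div_mem_locG {τ : UpperHalfPlane} {n : ℕ} {P : Fin n → ℂ} {c : ℤ} {g : (Fin n → ℂ) → ℂ}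
    (hg : AnalyticAt ℂ g P) {S : Finset (DivIdx n)} (hS : S ⊆ through τ P) (hc : (S.card : ℤ) ≤ c)
    (N : ℕ) : (fun x => g x / locEq P S x ^ N) ∈ locG τ P c := by
  classical
  refine ⟨N, fun S' => if S' = S then g else fun _ => 0, fun S' => ?_, ?_⟩
  · dsimp only
    split_ifs
    · exact hg
    · exact analyticAt_const
  · filter_upwards with x hx
    rw [Finset.sum_eq_single S]
    · simp
    · intro S' _ h; simp [h]
    · intro h
      exact absurd (Finset.mem_filter.mpr ⟨Finset.mem_powerset.mpr hS, hc⟩) h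

lemma locG_mono {τ : UpperHalfPlane} {n : ℕ} {P : Fin n → ℂ} {c c' : ℤ} (h : c ≤ c') :
    locG τ P c ≤ locG τ P c' := by
  rintro F ⟨N, g, hg, hfg⟩
  refine locG_congr hfg ?_
  have : (fun x => ∑ S ∈ (through τ P).powerset with (S.card : ℤ) ≤ c, g S x / locEq P S x ^ N) =
      ∑ S ∈ (through τ P).powerset with (S.card : ℤ) ≤ c, fun x => g S x / locEq P S x ^ N := by
    ext x; simp
  rw [this]
  refine Submodule.sum_mem _ fun S hS => ?_
  obtain ⟨h1, h2⟩ := Finset.mem_filter.mp hS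
  exact div_mem_locG (hg S) (Finset.mem_powerset.mp h1) (h2.trans h) N

lemma eventually_line {n : ℕ} {i j : Fin (n + 1)} {P : Fin n → ℂ} {p : (Fin (n + 1) → ℂ) → Prop}
    (h : ∀ᶠ x in 𝓝 (diag i j P), p x) :
    ∀ᶠ y in 𝓝 P, ∀ᶠ t in 𝓝 (0 : ℂ), p (diag i j y + t • Pi.single i 1) := by
  filter_upwards [(tendsto_diag i j P).eventually h.eventually_nhds] with y hy
  exact (tendsto_line _ _).eventually hy

/-- A property that holds on the configuration space near a point of the divisor `x_i = x_j` holds along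
the punctured lines transversal to nearby points of this divisor. -/
lemma eventually_line_conf {τ : UpperHalfPlane} {n : ℕ} {i j : Fin (n + 1)} (hij : i ≤ j)
    {P : Fin n → ℂ} {p : (Fin (n + 1) → ℂ) → Prop}
    (h : ∀ᶠ x in 𝓝 (diag i j P), x ∈ conf τ (n + 1) → p x) :
    ∀ᶠ y in 𝓝 P, y ∈ conf τ n → ∀ᶠ t in 𝓝[≠] (0 : ℂ), p (diag i j y + t • Pi.single i 1) := by
  filter_upwards [eventually_line h] with y hy hyc
  filter_upwards [hy.filter_mono nhdsWithin_le_nhds, eventually_mem_conf hij hyc] with t h1 h2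
  exact h1 h2

lemma through_diag {τ : UpperHalfPlane} {n : ℕ} {i j : Fin (n + 1)} (hij : i ≤ j)
    {y : Fin n → ℂ} (hy : y ∈ conf τ n) : through τ (diag i j y) = {divIdx hij} := by
  ext k
  rw [Finset.mem_singleton]
  constructor
  · intro hk
    by_contra hne
    exact hy _ (mem_through.mp ((divRestr_mem_through hij ⟨k, hne⟩ y).mp hk))
  · rintro rfl
    rw [mem_through, divFun_divIdx_diag]
    exact zero_mem _

lemma divFun_divIdx_line {n : ℕ} {i j : Fin (n + 1)} (hij : i ≤ j) (y : Fin n → ℂ) (t : ℂ) :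
    divFun (divIdx hij) (diag i j y + t • Pi.single i 1) = t := by
  rw [divFun_add, divFun_smul, divFun_divIdx_diag, divFun_divIdx_single, zero_add, mul_one]

/-- The local form of a function in `Γ_{n+1}` at a generic point of the divisor `x_i = x_j`. -/
lemma exists_generic_form {τ : UpperHalfPlane} {n : ℕ} {i j : Fin (n + 1)} (hij : i ≤ j)
    {f : (Fin (n + 1) → ℂ) → ℂ} (hf : f ∈ gamSubmodule τ (n + 1)) : ∃ N : ℕ, ∀ y ∈ conf τ n,
      ∃ h : (Fin (n + 1) → ℂ) → ℂ, AnalyticAt ℂ h (diag i j y) ∧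
      ∀ᶠ x in 𝓝 (diag i j y), x ∈ conf τ (n + 1) → f x = h x / divFun (divIdx hij) x ^ N := by
  obtain ⟨-, -, N, h3⟩ := hf
  refine ⟨N, fun y hy => ?_⟩
  obtain ⟨g, hg, hfg⟩ := h3 (diag i j y)
  refine ⟨g, hg, ?_⟩
  filter_upwards [hfg] with x hx hxc
  rw [hx hxc, through_diag hij hy, locEq, Finset.prod_singleton, divFun_divIdx_diag, sub_zero]

lemma analyticAt_line {E : Type*} [NormedAddCommGroup E] [NormedSpace ℂ E] {h : E → ℂ} {x : E}
    (v : E) (hh : AnalyticAt ℂ h x) : AnalyticAt ℂ (fun t : ℂ => h (x + t • v)) 0 :=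
  AnalyticAt.comp_of_eq (f := fun t : ℂ => x + t • v) hh (by fun_prop) (by simp)

lemma meromorphicAt_line {τ : UpperHalfPlane} {n : ℕ} {i j : Fin (n + 1)} (hij : i ≤ j)
    {f : (Fin (n + 1) → ℂ) → ℂ} (hf : f ∈ gamSubmodule τ (n + 1)) {y : Fin n → ℂ}
    (hy : y ∈ conf τ n) : MeromorphicAt (fun t : ℂ => f (diag i j y + t • Pi.single i 1)) 0 := by
  obtain ⟨N, h3⟩ := exists_generic_form hij hf
  obtain ⟨h, hh, H⟩ := h3 y hy
  refine meromorphicAt_of_eq_div_pow (N := N) (analyticAt_line (Pi.single i 1) hh) ?_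
  filter_upwards [(eventually_line_conf hij H).self_of_nhds hy] with t ht
  rw [ht, divFun_divIdx_line]

lemma diag_add_mem_lattice {τ : UpperHalfPlane} {n : ℕ} (i j : Fin (n + 1)) {v : Fin n → ℂ}
    (hv : ∀ k, v k ∈ (periods τ).lattice) (k : Fin (n + 1)) :
    diag i j v k ∈ (periods τ).lattice := by
  induction k using Fin.succAboveCases i with
  | x =>
    rw [diag, Fin.insertNth_apply_same]
    induction j using Fin.lastCases with
    | last => simp [pts]
    | cast j => simpa [pts] using hv j
  | p k => simpa [diag] using hv k

/-- Laurent coefficients of functions in `Γ_{n+1}` are in `Γ_n`. -/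
lemma laurentCoeff_mem {τ : UpperHalfPlane} {n : ℕ} {i j : Fin (n + 1)} (hij : i ≤ j) (m : ℤ)
    {f : (Fin (n + 1) → ℂ) → ℂ} (hf : f ∈ gamSubmodule τ (n + 1)) :
    laurentCoeff τ i j m f ∈ gamSubmodule τ n := by
  obtain ⟨-, h2, N, h3⟩ := hf
  refine ⟨fun x hx => laurentCoeff_of_notMem i j m f hx, fun x v hv => ?_, ?_⟩
  · by_cases hx : x ∈ conf τ n
    · rw [laurentCoeff_of_mem i j m f hx, laurentCoeff_of_mem i j m f ((add_mem_conf hv x).mpr hx)]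
      congr 1
      ext t
      have h4 : diag i j (x + v) = diag i j x + diag i j v := (diagL i j).map_add x v
      rw [h4, add_right_comm, h2 _ _ (diag_add_mem_lattice i j hv)]
    · rw [laurentCoeff_of_notMem i j m f hx,
        laurentCoeff_of_notMem i j m f (fun h => hx ((add_mem_conf hv x).mp h))]
  · obtain ⟨N', hN'⟩ := exists_lc_local hij N m
    refine ⟨N', fun P => ?_⟩
    obtain ⟨g, hg, hfg⟩ := h3 (diag i j P)
    obtain ⟨S', hS', -, H⟩ := hN' τ P _ subset_rfl
    obtain ⟨G, hG, -, HG⟩ := H g hg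
    classical
    refine ⟨fun y => G y * locEq P (through τ P \ S') y ^ N',
      hG.mul ((analyticAt_locEq _ _ _).pow _), ?_⟩
    filter_upwards [HG, eventually_line_conf hij hfg] with y hy1 hy2 hyc
    rw [laurentCoeff_of_mem i j m f hyc, hy1 hyc _ (hy2 hyc)]
    have e : locEq P (through τ P) y = locEq P (through τ P \ S') y * locEq P S' y :=
      (Finset.prod_sdiff hS').symm
    have e1 := locEq_ne_zero (P := P) (S := through τ P) subset_rfl hyc
    have e2 := locEq_ne_zero hS' hyc
    have e3 : locEq P (through τ P \ S') y ≠ 0 := left_ne_zero_of_mul (e ▸ e1)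
    rw [e]
    field_simp
    ring

/-- The Laurent coefficient of degree `m` along `x_i = x_j` as a linear map `Γ_{n+1} → Γ_n`. -/
def lcoeff (τ : UpperHalfPlane) {n : ℕ} {i j : Fin (n + 1)} (hij : i ≤ j) (m : ℤ) :
    Gam τ (n + 1) →ₗ[ℂ] Gam τ n :=
  LinearMap.codRestrict (gamSubmodule τ n)
    { toFun := fun f : gamSubmodule τ (n + 1) => laurentCoeff τ i j m f.1
      map_add' := fun f f' => by
        ext y
        by_cases hy : y ∈ conf τ n
        · simp only [Pi.add_apply, laurentCoeff_of_mem i j m _ hy]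
          exact lc_add (meromorphicAt_line hij f.2 hy) (meromorphicAt_line hij f'.2 hy)
        · simp only [Pi.add_apply, laurentCoeff_of_notMem i j m _ hy, add_zero]
      map_smul' := fun c f => by
        ext y
        by_cases hy : y ∈ conf τ n
        · simp only [Pi.smul_apply, smul_eq_mul, laurentCoeff_of_mem i j m _ hy]
          exact lc_const_mul c (meromorphicAt_line hij f.2 hy)
        · simp only [Pi.smul_apply, laurentCoeff_of_notMem i j m _ hy, smul_zero] }
    fun f => laurentCoeff_mem hij m f.2

lemma toFun_lcoeff (τ : UpperHalfPlane) {n : ℕ} {i j : Fin (n + 1)} (hij : i ≤ j) (m : ℤ)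
    (f : Gam τ (n + 1)) :
    toFun τ n (lcoeff τ hij m f) = laurentCoeff τ i j m (toFun τ (n + 1) f) := rfl

lemma toFun_injective (τ : UpperHalfPlane) (n : ℕ) : Function.Injective (toFun τ n) :=
  Subtype.val_injective

lemma toFun_mem (τ : UpperHalfPlane) (n : ℕ) (f : Gam τ n) : toFun τ n f ∈ gamSubmodule τ n := f.2

lemma Gam.ext_conf {τ : UpperHalfPlane} {n : ℕ} {f g : Gam τ n}
    (h : ∀ y ∈ conf τ n, toFun τ n f y = toFun τ n g y) : f = g := by
  apply toFun_injective
  ext y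
  by_cases hy : y ∈ conf τ n
  · exact h y hy
  · rw [(toFun_mem τ n f).1 y hy, (toFun_mem τ n g).1 y hy]

/-- The order of the pole along `x_i = x_j` is finite. -/
lemma exists_lcoeff_eq_zero (τ : UpperHalfPlane) {n : ℕ} {i j : Fin (n + 1)} (hij : i ≤ j)
    (f : Gam τ (n + 1)) : ∃ N : ℤ, ∀ m < N, lcoeff τ hij m f = 0 := by
  obtain ⟨N, h3⟩ := exists_generic_form hij (toFun_mem τ (n + 1) f)
  refine ⟨-N, fun m hm => Gam.ext_conf fun y hy => ?_⟩
  obtain ⟨h, hh, H⟩ := h3 y hy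
  rw [toFun_lcoeff, laurentCoeff_of_mem i j m _ hy, map_zero, Pi.zero_apply]
  refine lc_eq_zero_of_lt hm (analyticAt_line (Pi.single i 1) hh) ?_
  filter_upwards [(eventually_line_conf hij H).self_of_nhds hy] with t ht
  rw [ht, divFun_divIdx_line]

/-- The filtration of `Γ` under taking Laurent coefficients along `x_i = x_j`.  In negative degree only
the terms with a pole along `x_i = x_j` contribute, and these lose a divisor. -/
lemma lcoeff_mem_GGam {τ : UpperHalfPlane} {n : ℕ} {i j : Fin (n + 1)} (hij : i ≤ j) (m : ℤ)
    {q q' : ℤ} (hq : q' = q + 1 ∨ (m < 0 ∧ q' = q)) {f : Gam τ (n + 1)}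
    (hf : f ∈ GGam τ (n + 1) q) : lcoeff τ hij m f ∈ GGam τ n q' := by
  rw [mem_GGam_iff]
  intro P
  obtain ⟨N, g, hg, hfg⟩ := hf (diag i j P)
  obtain ⟨N', hN'⟩ := exists_lc_local hij N m
  choose! S' hS' hcard G hG hG0 HG using hN' τ P
  have key : ∀ᶠ y in 𝓝 P, y ∈ conf τ n → toFun τ n (lcoeff τ hij m f) y =
      (∑ S ∈ (through τ (diag i j P)).powerset with (S.card : ℤ) ≤ q + (n + 1 : ℕ),
        fun y => G S (g S) y / locEq P (S' S) y ^ N') y := by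
    have h1 : ∀ᶠ y in 𝓝 P, ∀ S ∈ (through τ (diag i j P)).powerset, y ∈ conf τ n → ∀ φ : ℂ → ℂ,
          (∀ᶠ t in 𝓝[≠] 0, φ t = g S (diag i j y + t • Pi.single i 1) /
            locEq (diag i j P) S (diag i j y + t • Pi.single i 1) ^ N) →
          lc m φ = G S (g S) y / locEq P (S' S) y ^ N' :=
      (Finset.eventually_all _).mpr fun S hS => HG S (Finset.mem_powerset.mp hS) (g S) (hg S)
    have h2 : ∀ᶠ y in 𝓝 P, ∀ S ∈ (through τ (diag i j P)).powerset,
        AnalyticAt ℂ (g S) (diag i j y) :=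
      (Finset.eventually_all _).mpr fun S _ =>
        (tendsto_diag i j P).eventually (hg S).eventually_analyticAt
    filter_upwards [h1, h2, eventually_line_conf hij hfg] with y hy1 hy2 hy3 hyc
    rw [toFun_lcoeff, laurentCoeff_of_mem i j m _ hyc, lc_congr (hy3 hyc), lc_sum, Finset.sum_apply]
    · refine Finset.sum_congr rfl fun S hS => ?_
      exact hy1 S (Finset.mem_filter.mp hS).1 hyc _ (Eventually.of_forall fun t => rfl)
    · intro S hS
      exact (analyticAt_line _ (hy2 S (Finset.mem_filter.mp hS).1)).meromorphicAt.div
        ((analyticAt_line _ (analyticAt_locEq _ _ _)).meromorphicAt.pow N)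
  refine locG_congr key (Submodule.sum_mem _ fun S hS => ?_)
  obtain ⟨hSt, hSc⟩ := Finset.mem_filter.mp hS
  have hSt := Finset.mem_powerset.mp hSt
  push_cast at hSc
  have hc : ((S' S).card : ℤ) ≤ (S.erase (divIdx hij)).card := by exact_mod_cast hcard S hSt
  have hc' : ((S.erase (divIdx hij)).card : ℤ) ≤ S.card := by
    exact_mod_cast Finset.card_erase_le
  rcases hq with rfl | ⟨hm, rfl⟩
  · exact div_mem_locG (hG S hSt _ (hg S)) (hS' S hSt) (by linarith) N'
  · by_cases hmem : divIdx hij ∈ S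
    · have := Finset.card_erase_add_one hmem
      exact div_mem_locG (hG S hSt _ (hg S)) (hS' S hSt) (by omega) N'
    · rw [hG0 S hSt _ (hg S) (Or.inr ⟨hmem, hm⟩)]
      simp only [zero_div]
      exact zero_mem _

lemma toFun_pd {τ : UpperHalfPlane} {n : ℕ} (k : Fin n) (f : Gam τ n) {x : Fin n → ℂ}
    (hx : x ∈ conf τ n) : toFun τ n (pd τ k f) x = dd (Pi.single k 1) (toFun τ n f) x :=
  Set.indicator_of_mem hx fun x => fderiv ℂ f.1 x (Pi.single k 1)

lemma differentiableAt_toFun {τ : UpperHalfPlane} {n : ℕ} (f : Gam τ n) {x : Fin n → ℂ}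
    (hx : x ∈ conf τ n) : DifferentiableAt ℂ (toFun τ n f) x :=
  differentiableAt_of_mem (toFun_mem τ n f) hx

/-- Laurent coefficients of the derivative with respect to the deleted variable. -/
lemma lcoeff_pd_self {τ : UpperHalfPlane} {n : ℕ} {i j : Fin (n + 1)} (hij : i ≤ j) (m : ℤ)
    (f : Gam τ (n + 1)) : lcoeff τ hij m (pd τ i f) = ((m : ℂ) + 1) • lcoeff τ hij (m + 1) f := by
  refine Gam.ext_conf fun y hy => ?_
  rw [map_smul, Pi.smul_apply, toFun_lcoeff, toFun_lcoeff, laurentCoeff_of_mem i j _ _ hy,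
    laurentCoeff_of_mem i j _ _ hy, smul_eq_mul,
    ← lc_deriv m (meromorphicAt_line hij (toFun_mem τ (n + 1) f) hy)]
  refine lc_congr ?_
  filter_upwards [eventually_mem_conf hij hy] with t ht
  rw [toFun_pd i f ht, deriv_line (differentiableAt_toFun f ht)]

lemma diag_single {n : ℕ} (i j : Fin (n + 1)) (k : Fin n) :
    diag i j (Pi.single k 1) = (Pi.single (i.succAbove k) 1 : Fin (n + 1) → ℂ) +
      if k.castSucc = j then Pi.single i 1 else 0 := by
  ext l
  induction l using Fin.succAboveCases i with
  | x =>
    have h1 : (Pi.single (i.succAbove k) 1 : Fin (n + 1) → ℂ) i = 0 :=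
      Pi.single_eq_of_ne (Fin.succAbove_ne i k).symm _
    rw [diag, Fin.insertNth_apply_same, Pi.add_apply, h1, zero_add]
    split_ifs with h
    · subst h; simp [pts]
    · induction j using Fin.lastCases with
      | last => simp [pts]
      | cast j =>
        have : j ≠ k := fun e => h (by rw [e])
        simp [pts, this]
  | p l =>
    have h1 : (if k.castSucc = j then Pi.single i 1 else 0 : Fin (n + 1) → ℂ) (i.succAbove l) = 0 := by
      split_ifs
      · exact Pi.single_eq_of_ne (Fin.succAbove_ne i l) _
      · rfl
    rw [diag, Fin.insertNth_apply_succAbove, Pi.add_apply, h1, add_zero]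
    by_cases hl : l = k
    · subst hl; simp
    · rw [Pi.single_eq_of_ne hl, Pi.single_eq_of_ne]
      exact fun e => hl (Fin.succAbove_right_injective e)

lemma dd_add_dir {E : Type*} [NormedAddCommGroup E] [NormedSpace ℂ E] (v w : E) (h : E → ℂ) (x : E) :
    dd (v + w) h x = dd v h x + dd w h x := by simp [dd]

/-- Derivatives of Laurent coefficients in the remaining variables. -/
lemma pd_lcoeff {τ : UpperHalfPlane} {n : ℕ} {i j : Fin (n + 1)} (hij : i ≤ j) (m : ℤ)
    (k : Fin n) (f : Gam τ (n + 1)) : pd τ k (lcoeff τ hij m f) =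
      lcoeff τ hij m (pd τ (i.succAbove k) f + if k.castSucc = j then pd τ i f else 0) := by
  refine Gam.ext_conf fun y hy => ?_
  obtain ⟨N, h3⟩ := exists_generic_form hij (toFun_mem τ (n + 1) f)
  obtain ⟨h, hh, H⟩ := h3 y hy
  set w : Fin (n + 1) → ℂ := diag i j (Pi.single k 1) with hw
  have hline : ∀ᶠ y' in 𝓝 y, toFun τ n (lcoeff τ hij m f) y' =
      ddc (m + N) (Pi.single i 1) h (diag i j y') := by
    filter_upwards [(isOpen_conf τ n).mem_nhds hy, eventually_line_conf hij H,
      (tendsto_diag i j y).eventually hh.eventually_analyticAt] with y' hy' hy2 hy3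
    rw [toFun_lcoeff, laurentCoeff_of_mem i j _ _ hy', ← tc_line _ _ hy3]
    refine lc_eq_tc N m (analyticAt_line _ hy3) ?_
    filter_upwards [hy2 hy'] with t ht
    rw [ht, divFun_divIdx_line]
  have e1 : toFun τ n (pd τ k (lcoeff τ hij m f)) y = ddc (m + N) (Pi.single i 1) (dd w h) (diag i j y) := by
    rw [toFun_pd k _ hy, (dd_congr _ hline).eq_of_nhds, ← dd_ddc _ _ _ hh]
    have hd := (analyticAt_ddc (m + N) (Pi.single i 1) hh).differentiableAt.hasFDerivAt.comp y
      (diagL i j).hasFDerivAt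
    exact congrArg (fun L => L (Pi.single k 1)) hd.fderiv
  rw [e1, toFun_lcoeff, laurentCoeff_of_mem i j _ _ hy, ← tc_line _ _ (analyticAt_dd w hh)]
  symm
  refine lc_eq_tc N m (analyticAt_line _ (analyticAt_dd w hh)) ?_
  have hw0 : divFun (divIdx hij) w = 0 := divFun_divIdx_diag hij _
  have hloc : ∀ᶠ x in 𝓝 (diag i j y), x ∈ conf τ (n + 1) →
      dd w (toFun τ (n + 1) f) x = dd w h x / divFun (divIdx hij) x ^ N := by
    filter_upwards [exists_nhds_conf (τ := τ) H, hh.eventually_analyticAt] with x hx hxa hxc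
    have hx0 : divFun (divIdx hij) x ≠ 0 := fun e => hxc (divIdx hij) (e ▸ zero_mem _)
    have hda := analyticAt_divFun (divIdx hij) x
    have hdd : dd w (divFun (divIdx hij)) x = 0 := by
      have := deriv_line (h := divFun (divIdx hij)) (x := x) (v := w) (t := 0)
        (by simpa using hda.differentiableAt)
      simp only [divFun_add, divFun_smul, hw0, mul_zero, add_zero, deriv_const, zero_smul] at this
      exact this.symm
    have hEq : toFun τ (n + 1) f =ᶠ[𝓝 x] fun z => h z / divFun (divIdx hij) z ^ N := by
      filter_upwards [hx hxc] with z hz using hz.2 hz.1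
    rw [(dd_congr w hEq).eq_of_nhds]
    have h1 : HasDerivAt (fun s : ℂ => x + s • w) w 0 := by
      simpa using ((hasDerivAt_id (0 : ℂ)).smul_const w).const_add x
    have d := deriv_line (h := fun z => h z / divFun (divIdx hij) z ^ N) (x := x) (v := w) (t := 0)
      (by simpa using (hxa.fun_div (hda.fun_pow N) (pow_ne_zero _ hx0)).differentiableAt)
    have d' := deriv_line (h := h) (x := x) (v := w) (t := 0) (by simpa using hxa.differentiableAt)
    simp only [divFun_add, divFun_smul, hw0, mul_zero, add_zero, zero_smul] at d d'
    rw [← d, ← d', deriv_div_const]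
  filter_upwards [(eventually_line_conf hij hloc).self_of_nhds hy, eventually_mem_conf hij hy]
    with t ht htc
  rw [divFun_divIdx_line] at ht
  rw [← ht, map_add, Pi.add_apply, toFun_pd _ f htc, hw, diag_single]
  split_ifs
  · rw [toFun_pd _ f htc, dd_add_dir]
  · simp

variable {V : Type*} [AddCommGroup V] [Module ℂ V]

/-! ### The translation operator -/

lemma choose_neg_two (j : ℕ) : (-1 : ℤ) ^ j * Ring.choose (-2 : ℤ) j = j + 1 := by
  have h : Ring.choose (-(2 : ℤ)) j = (-1 : ℤ) ^ j * (j + 1) := by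
    rw [Ring.choose_neg]
    have : (2 + (j : ℤ) - 1) = ((j + 1 : ℕ) : ℤ) := by push_cast; ring
    rw [this, Ring.choose_natCast, Nat.choose_succ_self_right]
    rcases Nat.even_or_odd j with hj | hj
    · simp [Int.negOnePow_even _ ((Int.even_coe_nat j).mpr hj), hj.neg_one_pow]
    · simp [Int.negOnePow_odd _ ((Int.odd_coe_nat j).mpr hj), hj.neg_one_pow]
      abel
  rw [h, ← mul_assoc, ← mul_pow]
  simp

lemma VertexAlgebra.T_apply (A : VertexAlgebra V) (a : V) : A.T a = A.prod (-2) a A.vac := rfl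

lemma VertexAlgebra.T_prod (A : VertexAlgebra V) (a c : V) (k : ℤ) :
    A.prod k (A.T a) c = -((k : ℂ) • A.prod (k - 1) a c) := by
  have h := A.borcherds a A.vac c 0 (-2) k
  rw [finsum_eq_single _ 0 (fun j hj => by
    have : Ring.choose (0 : ℤ) j = 0 := by
      obtain ⟨j, rfl⟩ := Nat.exists_eq_succ_of_ne_zero hj
      exact Ring.choose_zero_succ ℤ j
    rw [this, zero_smul])] at h
  simp only [Nat.cast_zero, Ring.choose_zero_right, one_smul, zero_add, add_zero, sub_zero] at h
  rw [VertexAlgebra.T_apply, h]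
  simp only [choose_neg_two, A.vac_prod]
  rw [finsum_eq_single _ (if k < 0 then (-1 - k).toNat else (k - 1).toNat) (fun j hj => by
    rw [if_neg (by split_ifs at hj <;> omega), if_neg (by split_ifs at hj <;> omega)]
    simp)]
  rcases lt_trichotomy k 0 with hk | hk | hk
  · obtain ⟨l, hl⟩ : ∃ l : ℕ, k = -1 - l := ⟨(-1 - k).toNat, by omega⟩
    subst hl
    have e : (-1 - (-1 - (l : ℤ))).toNat = l := by omega
    rw [if_pos hk, e, if_pos (by ring), if_neg (by omega)]
    rw [← Int.cast_smul_eq_zsmul ℂ, smul_zero, sub_zero, ← neg_smul]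
    congr 1
    · push_cast; ring
    · rw [show (-2 : ℤ) - l = -1 - l - 1 by ring]
  · subst hk
    simp
  · obtain ⟨l, hl⟩ : ∃ l : ℕ, k = l + 1 := ⟨(k - 1).toNat, by omega⟩
    subst hl
    have e : ((l : ℤ) + 1 - 1).toNat = l := by omega
    rw [if_neg (by omega), e, if_neg (by omega), if_pos (by ring)]
    rw [← Int.cast_smul_eq_zsmul ℂ, map_zero, zero_sub, smul_neg]
    simp [Int.negOnePow]

lemma VertexAlgebra.prod_vac_natCast (A : VertexAlgebra V) (b : V) (j : ℕ) :
    A.prod (-2 + j) b A.vac = if j = 0 then A.T b else if j = 1 then b else 0 := by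
  rcases j with _ | _ | j
  · simp [VertexAlgebra.T_apply]
  · simpa using A.prod_vac b
  · rw [A.prod_vac_of_nonneg _ _ (by push_cast; omega)]
    simp

lemma VertexAlgebra.T_derivation (A : VertexAlgebra V) (a b : V) (n : ℤ) :
    A.T (A.prod n a b) = A.prod n (A.T a) b + A.prod n a (A.T b) := by
  have h := A.borcherds a b A.vac 0 n (-2)
  rw [finsum_eq_single _ 0 (fun j hj => by
    have : Ring.choose (0 : ℤ) j = 0 := by
      obtain ⟨j, rfl⟩ := Nat.exists_eq_succ_of_ne_zero hj
      exact Ring.choose_zero_succ ℤ j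
    rw [this, zero_smul])] at h
  simp only [Nat.cast_zero, Ring.choose_zero_right, one_smul, zero_add, add_zero, sub_zero,
    A.prod_vac_natCast, A.prod_vac_of_nonneg a _ (Int.natCast_nonneg _), map_zero, smul_zero] at h
  rw [VertexAlgebra.T_apply, h, finsum_eq_sum_of_support_subset (s := Finset.range 2)]
  · rw [Finset.sum_range_succ, Finset.sum_range_one, A.T_prod]
    simp [← Int.cast_smul_eq_zsmul ℂ]
    abel
  · intro j hj
    rw [Finset.coe_range, Set.mem_Iio]
    by_contra hlt
    exact hj (by simp [show j ≠ 0 by omega, show j ≠ 1 by omega])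

/-! ### The differential before passing to the quotient -/

/-- The sum `∑ₘ Lₘ ⊗ μₘ` of tensor products of linear maps, when it is finite on every pure tensor. -/
def sumTensor {F F' W W' : Type*} [AddCommGroup F] [Module ℂ F] [AddCommGroup F'] [Module ℂ F']
    [AddCommGroup W] [Module ℂ W] [AddCommGroup W'] [Module ℂ W']
    (L : ℤ → F →ₗ[ℂ] F') (μ : ℤ → W →ₗ[ℂ] W')
    (h : ∀ f z, (Function.support fun m => L m f ⊗ₜ[ℂ] μ m z).Finite) :
    F ⊗[ℂ] W →ₗ[ℂ] F' ⊗[ℂ] W' :=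
  TensorProduct.lift <| LinearMap.mk₂ ℂ (fun f z => ∑ᶠ m, L m f ⊗ₜ[ℂ] μ m z)
    (fun f f' z => by
      rw [← finsum_add_distrib (h f z) (h f' z)]
      simp only [map_add, TensorProduct.add_tmul])
    (fun c f z => by
      rw [smul_finsum' c (h f z)]
      simp only [map_smul, TensorProduct.smul_tmul'])
    (fun f z z' => by
      rw [← finsum_add_distrib (h f z) (h f z')]
      simp only [map_add, TensorProduct.tmul_add])
    (fun c f z => by
      rw [smul_finsum' c (h f z)]
      simp only [map_smul, TensorProduct.tmul_smul])

lemma merge_update_castSucc (A : VertexAlgebra V) {n : ℕ} {i j : Fin (n + 1)} (hij : i ≤ j) (m : ℤ)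
    (a : Fin (n + 2) → V) (x : V) : merge A i j m (Function.update a i.castSucc x) =
      Function.update (i.castSucc.removeNth a) j (A.prod m x (a j.succ)) := by
  have h : j.succ ≠ i.castSucc := (Fin.castSucc_lt_succ_iff.mpr hij).ne'
  rw [merge, Fin.removeNth_update, Function.update_self, Function.update_of_ne h]

lemma merge_update_succAbove (A : VertexAlgebra V) {n : ℕ} {i j : Fin (n + 1)} (hij : i ≤ j) (m : ℤ)
    (a : Fin (n + 2) → V) (l : Fin (n + 1)) (x : V) :
    merge A i j m (Function.update a (i.castSucc.succAbove l) x) =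
      if l = j then Function.update (i.castSucc.removeNth a) j (A.prod m (a i.castSucc) x)
      else Function.update (merge A i j m a) l x := by
  have h1 : i.castSucc.removeNth (Function.update a (i.castSucc.succAbove l) x) =
      Function.update (i.castSucc.removeNth a) l x := by
    ext k
    by_cases hk : k = l
    · subst hk; simp [Fin.removeNth]
    · simp [Fin.removeNth, hk]
  have h2 : Function.update a (i.castSucc.succAbove l) x i.castSucc = a i.castSucc :=
    Function.update_of_ne (Fin.succAbove_ne _ _).symm _ _
  rw [merge, h1, h2]
  split_ifs with h
  · subst h
    rw [Function.update_idem, ← succAbove_of_le hij, Function.update_self]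
  · have h3 : j.succ ≠ i.castSucc.succAbove l := by
      rw [← succAbove_of_le hij]
      exact fun e => h (Fin.succAbove_right_injective e).symm
    rw [Function.update_of_ne h3, merge, Function.update_comm (Ne.symm h)]

lemma merge_eq_update (A : VertexAlgebra V) {n : ℕ} (i j : Fin (n + 1)) (m : ℤ)
    (a : Fin (n + 2) → V) : merge A i j m a =
      Function.update (i.castSucc.removeNth a) j (A.prod m (a i.castSucc) (a j.succ)) := rfl

/-- The map `a^1 ⊗ ⋯ ⊗ a^{n+2} ↦ ⋯ â^i ⋯ ⊗ a^i_(m) a^j ⊗ ⋯`. -/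
def mergeMap (A : VertexAlgebra V) {n : ℕ} {i j : Fin (n + 1)} (hij : i ≤ j) (m : ℤ) :
    TP V (n + 2) →ₗ[ℂ] TP V (n + 1) :=
  PiTensorProduct.lift
    { toFun := fun a => PiTensorProduct.tprod ℂ (merge A i j m a)
      map_update_add' := by
        intro inst a k x y
        rw [Subsingleton.elim inst (instDecidableEqFin _)]
        induction k using Fin.succAboveCases i.castSucc with
        | x =>
          simp only [merge_update_castSucc A hij, map_add, LinearMap.add_apply,
            MultilinearMap.map_update_add]
        | p l =>
          simp only [merge_update_succAbove A hij]
          split_ifs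
          · simp only [map_add, MultilinearMap.map_update_add]
          · simp only [MultilinearMap.map_update_add]
      map_update_smul' := by
        intro inst a k c x
        rw [Subsingleton.elim inst (instDecidableEqFin _)]
        induction k using Fin.succAboveCases i.castSucc with
        | x =>
          simp only [merge_update_castSucc A hij, map_smul, LinearMap.smul_apply,
            MultilinearMap.map_update_smul]
        | p l =>
          simp only [merge_update_succAbove A hij]
          split_ifs
          · simp only [map_smul, MultilinearMap.map_update_smul]
          · simp only [MultilinearMap.map_update_smul] }

lemma mergeMap_tprod (A : VertexAlgebra V) {n : ℕ} {i j : Fin (n + 1)} (hij : i ≤ j) (m : ℤ)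
    (a : Fin (n + 2) → V) : mergeMap A hij m (PiTensorProduct.tprod ℂ a) =
      PiTensorProduct.tprod ℂ (merge A i j m a) := by
  simp [mergeMap]

lemma exists_mergeMap_eq_zero (A : VertexAlgebra V) {n : ℕ} {i j : Fin (n + 1)} (hij : i ≤ j)
    (z : TP V (n + 2)) : ∃ M : ℤ, ∀ m, M ≤ m → mergeMap A hij m z = 0 := by
  induction z using PiTensorProduct.induction_on with
  | smul_tprod c a =>
    obtain ⟨M, hM⟩ := A.field (a i.castSucc) (a j.succ)
    refine ⟨M, fun m hm => ?_⟩
    rw [map_smul, mergeMap_tprod, merge_eq_update, hM m hm,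
      (PiTensorProduct.tprod ℂ).map_coord_zero j (Function.update_self _ _ _), smul_zero]
  | add z z' h h' =>
    obtain ⟨M, hM⟩ := h
    obtain ⟨M', hM'⟩ := h'
    refine ⟨max M M', fun m hm => ?_⟩
    rw [map_add, hM m ((le_max_left _ _).trans hm), hM' m ((le_max_right _ _).trans hm), add_zero]

lemma finite_support_lcoeff_tmul (τ : UpperHalfPlane) (A : VertexAlgebra V) {n : ℕ}
    {i j : Fin (n + 1)} (hij : i ≤ j) (f : Gam τ (n + 1)) (z : TP V (n + 2)) :
    (Function.support fun m => lcoeff τ hij m f ⊗ₜ[ℂ] mergeMap A hij m z).Finite := by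
  obtain ⟨N, hN⟩ := exists_lcoeff_eq_zero τ hij f
  obtain ⟨M, hM⟩ := exists_mergeMap_eq_zero A hij z
  refine (Set.finite_Ico N M).subset fun m hm => ?_
  rw [Function.mem_support] at hm
  constructor
  · by_contra h
    exact hm (by rw [hN m (not_le.mp h), TensorProduct.zero_tmul])
  · by_contra h
    exact hm (by rw [hM m (not_lt.mp h), TensorProduct.tmul_zero])

/-- The residue along `x_i = x_j` of `f ⊗ ⋯ Y(a^i, x_i - x_j) a^j ⋯`. -/
def resTerm (τ : UpperHalfPlane) (A : VertexAlgebra V) {n : ℕ} {i j : Fin (n + 1)} (hij : i ≤ j) :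
    PreChain τ V (n + 1) →ₗ[ℂ] PreChain τ V n :=
  sumTensor (lcoeff τ hij) (mergeMap A hij) (finite_support_lcoeff_tmul τ A hij)

lemma resTerm_tmul (τ : UpperHalfPlane) (A : VertexAlgebra V) {n : ℕ} {i j : Fin (n + 1)}
    (hij : i ≤ j) (f : Gam τ (n + 1)) (z : TP V (n + 2)) : resTerm τ A hij (f ⊗ₜ z) =
      ∑ᶠ m, lcoeff τ hij m f ⊗ₜ[ℂ] mergeMap A hij m z := rfl

/-- The differential on `C̃`. -/
def preD (τ : UpperHalfPlane) (A : VertexAlgebra V) (n : ℕ) :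
    PreChain τ V (n + 1) →ₗ[ℂ] PreChain τ V n :=
  ∑ i : Fin (n + 1), ∑ j : Fin (n + 1),
    if hij : i ≤ j then (-1 : ℂ) ^ (n - (i : ℕ)) • resTerm τ A hij else 0

lemma TAt_tprod (A : VertexAlgebra V) {n : ℕ} (i : Fin n) (a : Fin (n + 1) → V) :
    TAt A i (PiTensorProduct.tprod ℂ a) =
      PiTensorProduct.tprod ℂ (Function.update a i.castSucc (A.T (a i.castSucc))) := by
  rw [TAt, PiTensorProduct.map_tprod]
  congr 1
  ext k
  by_cases hk : k = i.castSucc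
  · subst hk; simp
  · simp [hk]

lemma mergeMap_TAt_self (A : VertexAlgebra V) {n : ℕ} {i j : Fin (n + 1)} (hij : i ≤ j) (m : ℤ)
    (z : TP V (n + 2)) : mergeMap A hij m (TAt A i z) = -((m : ℂ) • mergeMap A hij (m - 1) z) := by
  induction z using PiTensorProduct.induction_on with
  | smul_tprod c a =>
    rw [map_smul, map_smul, map_smul, TAt_tprod, mergeMap_tprod, mergeMap_tprod,
      merge_update_castSucc A hij, A.T_prod, merge_eq_update, ← neg_smul,
      MultilinearMap.map_update_smul, ← neg_smul, smul_comm]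
  | add z z' h h' => rw [map_add, map_add, h, h', map_add, smul_add, neg_add]

lemma TAt_mergeMap (A : VertexAlgebra V) {n : ℕ} {i j : Fin (n + 1)} (hij : i ≤ j) (m : ℤ)
    (l : Fin n) (z : TP V (n + 2)) : TAt A l (mergeMap A hij m z) =
      mergeMap A hij m (TAt A (i.succAbove l) z + if l.castSucc = j then TAt A i z else 0) := by
  induction z using PiTensorProduct.induction_on with
  | smul_tprod c a =>
    have e : (i.succAbove l).castSucc = i.castSucc.succAbove l.castSucc :=
      Fin.castSucc_succAbove_castSucc.symm
    have e' : i.castSucc.succAbove l.castSucc ≠ i.castSucc := Fin.succAbove_ne _ _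
    by_cases h : l.castSucc = j
    · simp only [map_smul, if_pos h, map_add, TAt_tprod, mergeMap_tprod, e]
      rw [merge_update_succAbove A hij, if_pos h, merge_update_castSucc A hij, ← smul_add]
      subst h
      rw [merge_eq_update, Function.update_idem, Function.update_self, A.T_derivation,
        MultilinearMap.map_update_add, add_comm (PiTensorProduct.tprod ℂ _),
        show a l.castSucc.succ = a (i.succAbove l).castSucc by rw [e, succAbove_of_le hij]]
    · simp only [map_smul, if_neg h, add_zero, TAt_tprod, mergeMap_tprod, e]
      rw [merge_update_succAbove A hij, if_neg h]
      congr 4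
      rw [merge_eq_update, Function.update_of_ne h, Fin.removeNth, e]
  | add z z' h h' =>
    rw [map_add, map_add, h, h', ← map_add]
    congr 1
    split_ifs
    · rw [map_add, map_add]; abel
    · rw [map_add]; abel

/-- The operator `∂_i + T_i`. -/
def relOp (τ : UpperHalfPlane) (A : VertexAlgebra V) {n : ℕ} (i : Fin n) :
    PreChain τ V n →ₗ[ℂ] PreChain τ V n :=
  TensorProduct.map (pd τ i) LinearMap.id + TensorProduct.map LinearMap.id (TAt A i)

lemma relOp_tmul (τ : UpperHalfPlane) (A : VertexAlgebra V) {n : ℕ} (i : Fin n) (f : Gam τ n)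
    (z : TP V (n + 1)) : relOp τ A i (f ⊗ₜ z) = pd τ i f ⊗ₜ z + f ⊗ₜ TAt A i z := rfl

/-- The residue of a total derivative in the residue variable vanishes. -/
lemma resTerm_relOp_self (τ : UpperHalfPlane) (A : VertexAlgebra V) {n : ℕ} {i j : Fin (n + 1)}
    (hij : i ≤ j) (x : PreChain τ V (n + 1)) : resTerm τ A hij (relOp τ A i x) = 0 := by
  induction x using TensorProduct.induction_on with
  | zero => simp
  | add x y hx hy => rw [map_add, map_add, hx, hy, add_zero]
  | tmul f z =>
    rw [relOp_tmul, map_add, resTerm_tmul, resTerm_tmul,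
      ← finsum_comp_equiv (Equiv.addRight (1 : ℤ))
        (f := fun m => lcoeff τ hij m f ⊗ₜ[ℂ] mergeMap A hij m (TAt A i z)),
      ← finsum_add_distrib (finite_support_lcoeff_tmul τ A hij _ _)]
    · rw [← finsum_zero (α := ℤ)]
      refine finsum_congr fun m => ?_
      simp only [Equiv.coe_addRight]
      rw [lcoeff_pd_self, mergeMap_TAt_self, add_sub_cancel_right, TensorProduct.tmul_neg,
        TensorProduct.tmul_smul, TensorProduct.smul_tmul']
      push_cast
      rw [add_neg_cancel]
    · exact (finite_support_lcoeff_tmul τ A hij _ _).preimage (Equiv.injective _).injOn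

/-- `∂_l + T_l` in a remaining variable lifts along a residue. -/
lemma relOp_resTerm (τ : UpperHalfPlane) (A : VertexAlgebra V) {n : ℕ} {i j : Fin (n + 1)}
    (hij : i ≤ j) (l : Fin n) (x : PreChain τ V (n + 1)) :
    resTerm τ A hij (relOp τ A (i.succAbove l) x) = relOp τ A l (resTerm τ A hij x) := by
  have key : relOp τ A l (resTerm τ A hij x) = resTerm τ A hij (relOp τ A (i.succAbove l) x +
      if l.castSucc = j then relOp τ A i x else 0) := by
    induction x using TensorProduct.induction_on with
    | zero => simp
    | add x y hx hy =>
      rw [map_add, map_add, hx, hy, ← map_add]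
      congr 1
      split_ifs
      · rw [map_add, map_add]; abel
      · rw [map_add]; abel
    | tmul f z =>
      have hmap : relOp τ A l (∑ᶠ m, lcoeff τ hij m f ⊗ₜ[ℂ] mergeMap A hij m z) =
          ∑ᶠ m, relOp τ A l (lcoeff τ hij m f ⊗ₜ[ℂ] mergeMap A hij m z) :=
        (relOp τ A l).toAddMonoidHom.map_finsum (finite_support_lcoeff_tmul τ A hij f z)
      have e1 : relOp τ A (i.succAbove l) (f ⊗ₜ[ℂ] z) +
          (if l.castSucc = j then relOp τ A i (f ⊗ₜ[ℂ] z) else 0) =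
          (pd τ (i.succAbove l) f + if l.castSucc = j then pd τ i f else 0) ⊗ₜ[ℂ] z +
          f ⊗ₜ[ℂ] (TAt A (i.succAbove l) z + if l.castSucc = j then TAt A i z else 0) := by
        split_ifs
        · simp only [relOp_tmul, TensorProduct.add_tmul, TensorProduct.tmul_add]; abel
        · simp only [relOp_tmul, add_zero]
      rw [e1, map_add, resTerm_tmul, resTerm_tmul, resTerm_tmul,
        hmap,
        ← finsum_add_distrib (finite_support_lcoeff_tmul τ A hij _ _)
          (finite_support_lcoeff_tmul τ A hij _ _)]
      refine finsum_congr fun m => ?_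
      rw [← pd_lcoeff, ← TAt_mergeMap]
      rfl
  rw [key, map_add]
  split_ifs
  · rw [resTerm_relOp_self, add_zero]
  · rw [map_zero, add_zero]

lemma relOp_mem_rel (τ : UpperHalfPlane) (A : VertexAlgebra V) {n : ℕ} (i : Fin n)
    (x : PreChain τ V n) : relOp τ A i x ∈ rel τ A n :=
  (le_iSup (fun i : Fin n => LinearMap.range (relOp τ A i)) i) ⟨x, rfl⟩

lemma resTerm_relOp_mem (τ : UpperHalfPlane) (A : VertexAlgebra V) {n : ℕ} {i j : Fin (n + 1)}
    (hij : i ≤ j) (k : Fin (n + 1)) (x : PreChain τ V (n + 1)) :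
    resTerm τ A hij (relOp τ A k x) ∈ rel τ A n := by
  induction k using Fin.succAboveCases i with
  | x => rw [resTerm_relOp_self]; exact zero_mem _
  | p l => rw [relOp_resTerm]; exact relOp_mem_rel τ A l _

lemma preD_apply_mem {τ : UpperHalfPlane} {A : VertexAlgebra V} {n : ℕ} {x : PreChain τ V (n + 1)}
    {W : Submodule ℂ (PreChain τ V n)} (h : ∀ (i j : Fin (n + 1)) (hij : i ≤ j), resTerm τ A hij x ∈ W) :
    preD τ A n x ∈ W := by
  simp only [preD, LinearMap.sum_apply]
  refine Submodule.sum_mem _ fun i _ => Submodule.sum_mem _ fun j _ => ?_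
  split_ifs with hij
  · exact Submodule.smul_mem _ _ (h i j hij)
  · exact zero_mem _

lemma rel_le_comap_preD (τ : UpperHalfPlane) (A : VertexAlgebra V) (n : ℕ) :
    rel τ A (n + 1) ≤ (rel τ A n).comap (preD τ A n) := by
  refine iSup_le fun k => ?_
  rintro _ ⟨x, rfl⟩
  exact preD_apply_mem fun i j hij => resTerm_relOp_mem τ A hij k x

/-- The differential of the ordered chiral complex. -/
def chainD (τ : UpperHalfPlane) (A : VertexAlgebra V) (n : ℕ) :
    Chain τ A (n + 1) →ₗ[ℂ] Chain τ A n :=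
  Submodule.mapQ _ _ (preD τ A n) (rel_le_comap_preD τ A n)

lemma chainD_mk (τ : UpperHalfPlane) (A : VertexAlgebra V) (n : ℕ) (x : PreChain τ V (n + 1)) :
    chainD τ A n (Submodule.Quotient.mk x) = Submodule.Quotient.mk (preD τ A n x) := rfl

lemma isChiralDifferential_chainD (τ : UpperHalfPlane) (A : VertexAlgebra V) :
    IsChiralDifferential τ A (chainD τ A) := by
  intro n f a
  refine ⟨_, ?_, chainD_mk τ A n _⟩
  simp only [preD, LinearMap.sum_apply, map_sum, dFormula]
  refine Finset.sum_congr rfl fun i _ => ?_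
  rw [Finset.sum_filter]
  refine Finset.sum_congr rfl fun j _ => ?_
  split_ifs with hij
  · rw [LinearMap.smul_apply, map_smul, resTerm_tmul]
    congr 1
    have h := (TensorProduct.map (toFun τ n)
      (LinearMap.id : TP V (n + 1) →ₗ[ℂ] TP V (n + 1))).toAddMonoidHom.map_finsum
      (finite_support_lcoeff_tmul τ A hij f (PiTensorProduct.tprod ℂ a))
    refine h.trans (finsum_congr fun m => ?_)
    simp only [LinearMap.toAddMonoidHom_coe, TensorProduct.map_tmul, mergeMap_tprod, toFun_lcoeff,
      LinearMap.id_apply]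
  · simp

/-! ### Iterated Laurent coefficients in two variables -/

lemma lc_zpow_mul (p m : ℤ) (φ : ℂ → ℂ) : lc m (fun t => t ^ p * φ t) = lc (m - p) φ := by
  have : ∀ᶠ r in 𝓝[>] (0 : ℝ), contourCoeff m (fun t => t ^ p * φ t) r = contourCoeff (m - p) φ r := by
    filter_upwards [self_mem_nhdsWithin] with r hr
    have hr : 0 < r := hr
    unfold contourCoeff
    rw [circleIntegral.integral_congr hr.le (g := fun t => φ t * t ^ (-(m - p) - 1)) fun t ht => ?_]
    have hne : t ≠ 0 := by
      rintro rfl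
      simp at ht
      exact hr.ne ht
    show t ^ p * φ t * t ^ (-m - 1) = φ t * t ^ (-(m - p) - 1)
    rw [show -(m - p) - 1 = p + (-m - 1) by ring, zpow_add₀ hne]
    ring
  unfold lc limUnder
  rw [Filter.map_congr this]

lemma prod_range_sub_eq_choose (r : ℤ) (k : ℕ) :
    ∏ i ∈ Finset.range k, ((r : ℂ) - i) = (k.factorial : ℂ) * (Ring.choose r k : ℤ) := by
  have h := Ring.descPochhammer_eq_factorial_smul_choose r k
  rw [← Polynomial.eval_eq_smeval, descPochhammer_eval_eq_prod_range, nsmul_eq_mul] at h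
  exact_mod_cast congrArg (Int.cast : ℤ → ℂ) h

lemma lc_zpow_mul_add_zpow {w : ℂ} (hw : w ≠ 0) (p r m : ℤ) :
    lc m (fun u => u ^ p * (u + w) ^ r) =
      if 0 ≤ m - p then (Ring.choose r (m - p).toNat : ℤ) * w ^ (r - (m - p)) else 0 := by
  have ha : AnalyticAt ℂ (fun u : ℂ => (u + w) ^ r) 0 :=
    AnalyticAt.fun_zpow (by fun_prop) (by simpa using hw)
  rw [lc_zpow_mul, lc_eq_tc (h := fun u => (u + w) ^ r) 0 _ ha (by simp)]
  simp only [Nat.cast_zero, add_zero]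
  split_ifs with h
  · obtain ⟨k, hk⟩ := Int.eq_ofNat_of_zero_le h
    rw [hk, tc_natCast, Int.toNat_natCast,
      congrFun (iteratedDeriv_comp_add_const k (fun x : ℂ => x ^ r) w) 0, zero_add,
      iteratedDeriv_eq_iterate, iter_deriv_zpow, prod_range_sub_eq_choose]
    have := Nat.factorial_ne_zero k
    field_simp
  · exact tc_of_neg (not_le.mp h) _

lemma lc_const_zpow (c : ℂ) (s m : ℤ) : lc m (fun v => c * v ^ s) = if m = s then c else 0 := by
  have h1 : (fun v : ℂ => c * v ^ s) = fun v => v ^ s * c := by ext; ring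
  rw [h1, lc_zpow_mul, lc_eq_tc (h := fun _ => c) 0 _ analyticAt_const (by simp)]
  simp only [Nat.cast_zero, add_zero]
  rcases lt_or_ge (m - s) 0 with h | h
  · rw [tc_of_neg h, if_neg (by omega)]
  · obtain ⟨k, hk⟩ := Int.eq_ofNat_of_zero_le h
    rw [hk, tc_natCast]
    rcases k with _ | k
    · rw [if_pos (by simp at hk; omega)]; simp
    · rw [if_neg (by push_cast at hk; omega)]
      simp [iteratedDeriv_succ']

/-- The function `g / (u v (u + ε v))^N` of two variables. -/
def tripleQuot (ε : ℂ) (N : ℕ) (g : ℂ × ℂ → ℂ) (u v : ℂ) : ℂ :=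
  g (u, v) / (u ^ N * (v * (u + ε * v)) ^ N)

/-- The coefficient of `u^m v^m'` in the expansion of `g / (u v (u + ε v))^N` in the domain
`|u| < |v|`. -/
def tripleCoeff (ε : ℂ) (N : ℕ) (g : ℂ × ℂ → ℂ) (m m' : ℤ) : ℂ :=
  lc m' fun v => lc m fun u => tripleQuot ε N g u v

lemma tendsto_pair_right : Tendsto (fun v : ℂ => ((0 : ℂ), v)) (𝓝 0) (𝓝 (0 : ℂ × ℂ)) :=
  (Continuous.prodMk continuous_const continuous_id).tendsto 0

lemma pair_add_smul (u v : ℂ) : ((0, v) : ℂ × ℂ) + u • (1, 0) = (u, v) := by simp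

lemma eventually_pair {p : ℂ × ℂ → Prop} (h : ∀ᶠ x in 𝓝 (0 : ℂ × ℂ), p x) :
    ∀ᶠ v in 𝓝 (0 : ℂ), ∀ᶠ u in 𝓝 (0 : ℂ), p (u, v) := by
  filter_upwards [tendsto_pair_right.eventually h.eventually_nhds] with v hv
  have := (tendsto_line ((0, v) : ℂ × ℂ) (1, 0)).eventually hv
  simpa only [pair_add_smul] using this

lemma analyticAt_pair_left {g : ℂ × ℂ → ℂ} {u v : ℂ} (hg : AnalyticAt ℂ g (u, v)) :
    AnalyticAt ℂ (fun u => g (u, v)) u :=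
  hg.fun_comp (f := fun u => (u, v)) (by fun_prop)

lemma analyticAt_pair_left_zero {g : ℂ × ℂ → ℂ} {v : ℂ} (hg : AnalyticAt ℂ g (0, v)) :
    AnalyticAt ℂ (fun u => g (u, v)) 0 := analyticAt_pair_left hg

lemma meromorphicAt_tripleQuot {g : ℂ × ℂ → ℂ} (ε : ℂ) (N : ℕ) {v : ℂ}
    (hg : AnalyticAt ℂ g (0, v)) : MeromorphicAt (fun u => tripleQuot ε N g u v) 0 := by
  unfold tripleQuot
  refine (analyticAt_pair_left_zero hg).meromorphicAt.fun_div (AnalyticAt.meromorphicAt ?_)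
  fun_prop

lemma meromorphicAt_lc_tripleQuot {g : ℂ × ℂ → ℂ} {ε : ℂ} (hε : ε ≠ 0) (N : ℕ) (m : ℤ)
    (hg : AnalyticAt ℂ g 0) : MeromorphicAt (fun v => lc m fun u => tripleQuot ε N g u v) 0 := by
  have hD : AnalyticAt ℂ (fun x : ℂ × ℂ => x.2 * (x.1 + ε * x.2)) 0 :=
    analyticAt_snd.mul (analyticAt_fst.add (analyticAt_const.mul analyticAt_snd))
  obtain ⟨G, hG, -, H⟩ := exists_lc_eq_div_pow ((1, 0) : ℂ × ℂ) hg hD N N m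
  have hGv : AnalyticAt ℂ (fun v => G (0, v)) 0 :=
    hG.comp_of_eq (f := fun v : ℂ => ((0 : ℂ), v)) (by fun_prop) rfl
  have hm : MeromorphicAt (fun v => G (0, v) / (v * (0 + ε * v)) ^ (N + (m + N).toNat)) 0 := by
    refine hGv.meromorphicAt.fun_div (AnalyticAt.meromorphicAt ?_)
    fun_prop
  refine hm.congr ?_
  filter_upwards [(tendsto_pair_right.eventually H).filter_mono nhdsWithin_le_nhds,
    self_mem_nhdsWithin] with v hv hv0
  have hv0 : v ≠ 0 := hv0
  refine (hv (by simp [hv0, hε]) _ (Eventually.of_forall fun u => ?_)).symm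
  simp only [pair_add_smul]
  rfl

lemma tripleCoeff_add {g g' : ℂ × ℂ → ℂ} {ε : ℂ} (hε : ε ≠ 0) (N : ℕ) (m m' : ℤ)
    (hg : AnalyticAt ℂ g 0) (hg' : AnalyticAt ℂ g' 0) :
    tripleCoeff ε N (fun x => g x + g' x) m m' =
      tripleCoeff ε N g m m' + tripleCoeff ε N g' m m' := by
  unfold tripleCoeff
  rw [← lc_add (meromorphicAt_lc_tripleQuot hε N m hg) (meromorphicAt_lc_tripleQuot hε N m hg')]
  refine lc_congr ?_
  filter_upwards [(tendsto_pair_right.eventually hg.eventually_analyticAt).filter_mono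
    nhdsWithin_le_nhds, (tendsto_pair_right.eventually hg'.eventually_analyticAt).filter_mono
    nhdsWithin_le_nhds] with v h1 h2
  rw [← lc_add (meromorphicAt_tripleQuot ε N h1) (meromorphicAt_tripleQuot ε N h2)]
  simp only [tripleQuot, add_div]

lemma tripleCoeff_const_mul {g : ℂ × ℂ → ℂ} {ε : ℂ} (hε : ε ≠ 0) (N : ℕ) (m m' : ℤ) (c : ℂ)
    (hg : AnalyticAt ℂ g 0) :
    tripleCoeff ε N (fun x => c * g x) m m' = c * tripleCoeff ε N g m m' := by
  unfold tripleCoeff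
  rw [← lc_const_mul c (meromorphicAt_lc_tripleQuot hε N m hg)]
  refine lc_congr ?_
  filter_upwards [(tendsto_pair_right.eventually hg.eventually_analyticAt).filter_mono
    nhdsWithin_le_nhds] with v h1
  rw [← lc_const_mul c (meromorphicAt_tripleQuot ε N h1)]
  simp only [tripleQuot, mul_div_assoc]

lemma tripleCoeff_eq_zero_of_lt {g : ℂ × ℂ → ℂ} {ε : ℂ} (hε : ε ≠ 0) {N : ℕ} {m : ℤ} (m' : ℤ)
    (hm : m < -N) (hg : AnalyticAt ℂ g 0) : tripleCoeff ε N g m m' = 0 := by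
  have : tripleCoeff ε N g m m' = lc m' fun v => 0 * v ^ (0 : ℤ) := by
    refine lc_congr ?_
    filter_upwards [(tendsto_pair_right.eventually hg.eventually_analyticAt).filter_mono
      nhdsWithin_le_nhds, self_mem_nhdsWithin] with v h1 hv
    have hv : v ≠ 0 := hv
    rw [zero_mul]
    refine lc_eq_zero_of_lt (h := fun u => g (u, v) / (v * (u + ε * v)) ^ N) (N := N) hm ?_ ?_
    · refine (analyticAt_pair_left_zero h1).fun_div (by fun_prop) (by simp [hv, hε])
    · filter_upwards with u
      rw [tripleQuot, div_div, mul_comm (u ^ N)]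
  rw [this, lc_const_zpow]
  simp

/-- If `g` vanishes to order `K` at the origin, the expansion of `g / (u v (u + ε v))^N` has no terms of
total degree less than `K - 3N`. -/
lemma tripleCoeff_eq_zero_of_isBigO {g : ℂ × ℂ → ℂ} {ε : ℂ} (hε : ‖ε‖ = 1) {N K : ℕ} {m m' : ℤ}
    (hK : m + m' + 3 * N < K) (hg : AnalyticAt ℂ g 0)
    (hO : g =O[𝓝 0] fun x => ‖x‖ ^ K) : tripleCoeff ε N g m m' = 0 := by
  have hε0 : ε ≠ 0 := by rintro rfl; simp at hε
  obtain ⟨C, hC⟩ := hO.bound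
  obtain ⟨δ, hδ, H⟩ := Metric.eventually_nhds_iff_ball.mp (hC.and hg.eventually_analyticAt)
  refine lc_eq_zero_of_bound (k := K - 3 * N - m) (C * 4 ^ N * (1 / 2 : ℝ) ^ (-m)) (by omega) ?_
  have hball : Metric.ball (0 : ℂ) δ ∈ 𝓝[≠] (0 : ℂ) :=
    mem_nhdsWithin_of_mem_nhds (Metric.ball_mem_nhds _ hδ)
  filter_upwards [hball, self_mem_nhdsWithin] with v hv hv0
  have hv0 : v ≠ 0 := hv0
  have hvn : 0 < ‖v‖ := norm_pos_iff.mpr hv0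
  have hvδ : ‖v‖ < δ := by simpa using hv
  set r := ‖v‖ / 2 with hr
  have hr0 : 0 < r := by positivity
  have hnorm : ∀ u : ℂ, ‖u‖ ≤ r → ‖((u, v) : ℂ × ℂ)‖ = ‖v‖ := fun u hu => by
    rw [Prod.norm_mk, max_eq_right (hu.trans (by rw [hr]; linarith))]
  have hin : ∀ u : ℂ, ‖u‖ ≤ r → ((u, v) : ℂ × ℂ) ∈ Metric.ball (0 : ℂ × ℂ) δ := fun u hu => by
    rw [mem_ball_zero_iff, hnorm u hu]; exact hvδ
  have hlow : ∀ u : ℂ, ‖u‖ ≤ r → r ≤ ‖u + ε * v‖ := fun u hu => by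
    have h1 : ‖ε * v‖ = ‖v‖ := by rw [norm_mul, hε, one_mul]
    have h2 : ‖ε * v‖ ≤ ‖u + ε * v‖ + ‖u‖ := by
      have := norm_sub_le (u + ε * v) u
      simpa using this
    rw [h1] at h2
    linarith
  set h : ℂ → ℂ := fun u => g (u, v) / (v * (u + ε * v)) ^ N with hh
  have han : ∀ u : ℂ, ‖u‖ ≤ r → AnalyticAt ℂ h u := fun u hu => by
    refine (analyticAt_pair_left (H _ (hin u hu)).2).fun_div (by fun_prop) (pow_ne_zero _ ?_)
    exact mul_ne_zero hv0 (norm_pos_iff.mp (hr0.trans_le (hlow u hu)))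
  have hφ : ∀ u, tripleQuot ε N g u v = h u / u ^ N := fun u => by
    rw [tripleQuot, hh, div_div, mul_comm (u ^ N)]
  have e1 : lc m (fun u => tripleQuot ε N g u v) =
      contourCoeff m (fun u => tripleQuot ε N g u v) r := by
    rw [lc_eq_tc (h := h) N m (han 0 (by simpa using hr0.le)) (Eventually.of_forall hφ),
      contourCoeff_eq_tc (h := h) hr0 N m (fun u hu => ?_) fun u _ => hφ u]
    exact (han u (by simpa using hu)).differentiableAt.differentiableWithinAt
  rw [e1]
  have hC0 : 0 ≤ C := by
    have h3 := (H (0, v) (hin 0 (by simpa using hr0.le))).1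
    have h4 : 0 ≤ C * ‖‖((0, v) : ℂ × ℂ)‖ ^ K‖ := (norm_nonneg _).trans h3
    have h5 : 0 < ‖‖((0, v) : ℂ × ℂ)‖ ^ K‖ := by
      rw [hnorm 0 (by simpa using hr0.le)]; exact norm_pos_iff.mpr (pow_pos hvn K).ne'
    exact nonneg_of_mul_nonneg_left h4 h5
  have hb : ‖(2 * Real.pi * Complex.I : ℂ)⁻¹ • ∮ u in C(0, r), tripleQuot ε N g u v * u ^ (-m - 1)‖
      ≤ r * (C * ‖v‖ ^ K / (r ^ N * (‖v‖ * r) ^ N) * r ^ (-m - 1)) := by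
    refine circleIntegral.norm_two_pi_i_inv_smul_integral_le_of_norm_le_const hr0.le fun u hu => ?_
    have hu' : ‖u‖ = r := by simpa using hu
    have hg1 : ‖g (u, v)‖ ≤ C * ‖v‖ ^ K := by
      have := (H _ (hin u hu'.le)).1
      rwa [hnorm u hu'.le, norm_pow, norm_norm] at this
    rw [norm_mul, norm_zpow, hu', tripleQuot, norm_div, norm_mul, norm_pow, norm_pow, norm_mul, hu']
    have := hlow u hu'.le
    gcongr
  refine hb.trans_eq ?_
  have h2 : r = (1 / 2) * ‖v‖ := by rw [hr]; ring
  have h3 : r * (C * ‖v‖ ^ K / (r ^ N * (‖v‖ * r) ^ N) * r ^ (-m - 1)) =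
      C * ‖v‖ ^ K / (r ^ N * (‖v‖ * r) ^ N) * r ^ (-m) := by
    rw [zpow_sub₀ hr0.ne', zpow_one]
    field_simp
  rw [h3, h2, mul_zpow, show (K : ℤ) - 3 * N - m = K - (3 * N : ℕ) + -m by push_cast; ring,
    zpow_add₀ hvn.ne', zpow_sub₀ hvn.ne', zpow_natCast, zpow_natCast,
    show (4 : ℝ) ^ N = 1 / ((1 / 2) ^ N * (1 / 2) ^ N) by
      rw [← mul_pow, one_div, ← inv_pow]; norm_num]
  rw [mul_pow, mul_pow, mul_pow, mul_comm 3 N, pow_mul]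
  field_simp

/-- The expansion of a monomial. -/
lemma tripleCoeff_of_monomial {g : ℂ × ℂ → ℂ} {ε : ℂ} (hε : ε ≠ 0) (N : ℕ) (p q r m m' : ℤ)
    (hg : ∀ u v : ℂ, u ≠ 0 → v ≠ 0 → u + ε * v ≠ 0 →
      tripleQuot ε N g u v = u ^ p * v ^ q * (u + ε * v) ^ r) :
    tripleCoeff ε N g m m' = if 0 ≤ m - p ∧ m' = q + r - (m - p) then
      (Ring.choose r (m - p).toNat : ℤ) * ε ^ (r - (m - p)) else 0 := by
  have h1 : tripleCoeff ε N g m m' = lc m' fun v => (if 0 ≤ m - p then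
      (Ring.choose r (m - p).toNat : ℤ) * ε ^ (r - (m - p)) else 0 : ℂ) *
        v ^ (q + r - (m - p)) := by
    refine lc_congr ?_
    filter_upwards [self_mem_nhdsWithin] with v hv
    have hv : v ≠ 0 := hv
    have hεv : ε * v ≠ 0 := mul_ne_zero hε hv
    have h2 : lc m (fun u => tripleQuot ε N g u v) =
        lc m fun u => v ^ q * (u ^ p * (u + ε * v) ^ r) := by
      refine lc_congr ?_
      have h3 : ∀ᶠ u in 𝓝[≠] (0 : ℂ), u + ε * v ≠ 0 := by
        have : ContinuousAt (fun u : ℂ => u + ε * v) 0 := by fun_prop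
        exact (this.eventually_ne (by simpa using hεv)).filter_mono nhdsWithin_le_nhds
      filter_upwards [h3, self_mem_nhdsWithin] with u hu hu0
      rw [hg u v hu0 hv hu]; ring
    have hmer : MeromorphicAt (fun u => u ^ p * (u + ε * v) ^ r) 0 :=
      ((MeromorphicAt.id 0).fun_zpow p).fun_mul
        (((MeromorphicAt.id 0).fun_add (MeromorphicAt.const _ _)).fun_zpow r)
    rw [h2, lc_const_mul _ hmer, lc_zpow_mul_add_zpow hεv]
    split_ifs
    · rw [mul_zpow, show q + r - (m - p) = q + (r - (m - p)) by ring, zpow_add₀ hv]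
      ring
    · ring
  rw [h1, lc_const_zpow]
  by_cases ha : 0 ≤ m - p <;> by_cases hb : m' = q + r - (m - p) <;> simp only [ha, hb] <;> simp

/-! ### The residue form of the Borcherds identity -/

section TripleSum

variable {W : Type*} [AddCommGroup W]

/-- The finiteness of the expansion `∑ X m m' u^(-m-1) v^(-m'-1)` of a product of two fields applied to
a vector. -/
def IsFieldFamily (X : ℤ → ℤ → W) : Prop :=
  (∃ M, ∀ m, M ≤ m → ∀ m', X m m' = 0) ∧ ∀ m, ∃ M', ∀ m', M' ≤ m' → X m m' = 0

lemma IsFieldFamily.exists_bound {X : ℤ → ℤ → W} (hX : IsFieldFamily X) (L : ℤ) :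
    ∃ D, ∀ m m', L ≤ m → D ≤ m + m' → X m m' = 0 := by
  obtain ⟨⟨M, hM⟩, h2⟩ := hX
  choose M' hM' using h2
  obtain ⟨D, hD⟩ := ((Finset.Ico L M).image fun m => m + M' m).exists_le
  refine ⟨D, fun m m' hm hmm' => ?_⟩
  rcases le_or_gt M m with h | h
  · exact hM m h m'
  · have := hD _ (Finset.mem_image_of_mem (fun m => m + M' m) (Finset.mem_Ico.mpr ⟨hm, h⟩))
    exact hM' m m' (by omega)

variable [Module ℂ W]

/-- The residue `Res_v Res_u` of `g / (u v (u + ε v))^N · ∑ X m m' u^(-m-1) v^(-m'-1)`, expanded in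
`|u| < |v|`. -/
def tripleSum (ε : ℂ) (N : ℕ) (g : ℂ × ℂ → ℂ) (X : ℤ → ℤ → W) : W :=
  ∑ᶠ p : ℤ × ℤ, tripleCoeff ε N g p.1 p.2 • X p.1 p.2

variable {X : ℤ → ℤ → W} {g g' : ℂ × ℂ → ℂ} {ε : ℂ} {N : ℕ}

lemma finite_support_tripleSum (hX : IsFieldFamily X) (hε : ‖ε‖ = 1) (hg : AnalyticAt ℂ g 0) :
    (Function.support fun p : ℤ × ℤ => tripleCoeff ε N g p.1 p.2 • X p.1 p.2).Finite := by
  have hε0 : ε ≠ 0 := by rintro rfl; simp at hε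
  obtain ⟨D, hD⟩ := hX.exists_bound (-N)
  obtain ⟨M, hM⟩ := hX.1
  have hfin : ((fun p : ℤ × ℤ => (p.1, p.1 + p.2)) ⁻¹'
      (Set.Ico (-N : ℤ) M ×ˢ Set.Ico (-(3 * N : ℤ)) D)).Finite := by
    refine Set.Finite.preimage (fun p _ q _ h => ?_) ((Set.finite_Ico _ _).prod (Set.finite_Ico _ _))
    simp only [Prod.mk.injEq] at h
    exact Prod.ext h.1 (by omega)
  refine hfin.subset fun p hp => ?_
  rw [Function.mem_support] at hp
  have h1 : -(N : ℤ) ≤ p.1 := by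
    by_contra h
    exact hp (by rw [tripleCoeff_eq_zero_of_lt hε0 _ (not_le.mp h) hg, zero_smul])
  refine ⟨⟨h1, ?_⟩, ?_, ?_⟩
  · by_contra h
    exact hp (by rw [hM _ (not_lt.mp h), smul_zero])
  · by_contra h
    have hO : g =O[𝓝 0] fun x => ‖x‖ ^ 0 := by
      simpa using hg.continuousAt.isBigO_one ℝ
    exact hp (by
      rw [tripleCoeff_eq_zero_of_isBigO hε (K := 0) (by simp only at h; push_cast; omega) hg hO,
        zero_smul])
  · by_contra h
    exact hp (by rw [hD _ _ h1 (not_lt.mp h), smul_zero])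

lemma tripleSum_add (hX : IsFieldFamily X) (hε : ‖ε‖ = 1) (hg : AnalyticAt ℂ g 0)
    (hg' : AnalyticAt ℂ g' 0) :
    tripleSum ε N (fun x => g x + g' x) X = tripleSum ε N g X + tripleSum ε N g' X := by
  have hε0 : ε ≠ 0 := by rintro rfl; simp at hε
  unfold tripleSum
  rw [← finsum_add_distrib (finite_support_tripleSum hX hε hg) (finite_support_tripleSum hX hε hg')]
  exact finsum_congr fun p => by rw [tripleCoeff_add hε0 N _ _ hg hg', add_smul]

lemma tripleSum_const_mul (hX : IsFieldFamily X) (hε : ‖ε‖ = 1) (c : ℂ) (hg : AnalyticAt ℂ g 0) :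
    tripleSum ε N (fun x => c * g x) X = c • tripleSum ε N g X := by
  have hε0 : ε ≠ 0 := by rintro rfl; simp at hε
  unfold tripleSum
  rw [smul_finsum' c (finite_support_tripleSum hX hε hg)]
  exact finsum_congr fun p => by rw [tripleCoeff_const_mul hε0 N _ _ c hg, mul_smul]

lemma exists_tripleSum_eq_zero (hX : IsFieldFamily X) (hε : ‖ε‖ = 1) (N : ℕ) :
    ∃ K₀ : ℕ, ∀ K ≥ K₀, ∀ g : ℂ × ℂ → ℂ, AnalyticAt ℂ g 0 → (g =O[𝓝 0] fun x => ‖x‖ ^ K) →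
      tripleSum ε N g X = 0 := by
  have hε0 : ε ≠ 0 := by rintro rfl; simp at hε
  obtain ⟨D, hD⟩ := hX.exists_bound (-N)
  refine ⟨(D + 3 * N).toNat, fun K hK g hg hO => ?_⟩
  unfold tripleSum
  rw [← finsum_zero (α := ℤ × ℤ)]
  refine finsum_congr fun p => ?_
  rcases lt_or_ge p.1 (-N) with h | h
  · rw [tripleCoeff_eq_zero_of_lt hε0 _ h hg, zero_smul]
  · rcases lt_or_ge (p.1 + p.2) D with h' | h'
    · rw [tripleCoeff_eq_zero_of_isBigO hε (by omega) hg hO, zero_smul]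
    · rw [hD _ _ h h', smul_zero]

lemma tripleSum_of_monomial (hε : ε ≠ 0) (p q r : ℤ)
    (hg : ∀ u v : ℂ, u ≠ 0 → v ≠ 0 → u + ε * v ≠ 0 →
      tripleQuot ε N g u v = u ^ p * v ^ q * (u + ε * v) ^ r) :
    tripleSum ε N g X = ∑ᶠ j : ℕ,
      (((Ring.choose r j : ℤ) : ℂ) * ε ^ (r - j)) • X (p + j) (q + r - j) := by
  set θ : ℕ → ℤ × ℤ := fun j => (p + j, q + r - j) with hθ
  have hinj : Function.Injective θ := fun j j' h => by
    simp only [hθ, Prod.mk.injEq] at h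
    omega
  set Φ : ℤ × ℤ → W := fun x => tripleCoeff ε N g x.1 x.2 • X x.1 x.2 with hΦ
  have hΦθ : ∀ j, Φ (θ j) =
      (((Ring.choose r j : ℤ) : ℂ) * ε ^ (r - j)) • X (p + j) (q + r - j) := fun j => by
    simp only [hΦ, hθ]
    rw [tripleCoeff_of_monomial hε N p q r _ _ hg, add_sub_cancel_left, if_pos (by constructor <;> omega),
      Int.toNat_natCast]
  have hsupp : Function.support Φ ⊆ Set.range θ := fun x hx => by
    by_contra h
    refine hx ?_
    simp only [hΦ]
    rw [tripleCoeff_of_monomial hε N p q r _ _ hg, if_neg, zero_smul]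
    rintro ⟨h1, h2⟩
    refine h ⟨(x.1 - p).toNat, Prod.ext ?_ ?_⟩ <;> simp only [hθ] <;> omega
  rw [← finsum_congr hΦθ, ← finsum_mem_range hinj, tripleSum]
  rw [← finsum_mem_univ (f := Φ)]
  refine finsum_mem_inter_support_eq Φ _ _ ?_
  rw [Set.univ_inter, Set.inter_eq_right.mpr hsupp]

end TripleSum

lemma isFieldFamily_iterate (A : VertexAlgebra V) (a b c : V) :
    IsFieldFamily fun m m' => A.prod m' b (A.prod m a c) := by
  refine ⟨?_, fun m => A.field b (A.prod m a c)⟩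
  obtain ⟨M, hM⟩ := A.field a c
  exact ⟨M, fun m hm m' => by simp only [hM m hm, map_zero]⟩

lemma isFieldFamily_comp (A : VertexAlgebra V) (a b c : V) :
    IsFieldFamily fun m m' => A.prod m' (A.prod m a b) c := by
  refine ⟨?_, fun m => A.field (A.prod m a b) c⟩
  obtain ⟨M, hM⟩ := A.field a b
  exact ⟨M, fun m hm m' => by
    simp only [hM m hm, map_zero, LinearMap.zero_apply]⟩

/-- The residue identity of `borcherds_residue` for the function `g`. -/
def ResidueIdentity (A : VertexAlgebra V) (a b c : V) (N : ℕ) (g : ℂ × ℂ → ℂ) : Prop :=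
  tripleSum (-1) N g (fun m m' => A.prod m' b (A.prod m a c)) +
      tripleSum 1 N (fun x => g (x.2 + x.1, x.2)) (fun m m' => A.prod m' (A.prod m a b) c) =
    tripleSum (-1) N (fun x => (-1) ^ N * g (x.2, x.1)) (fun m m' => A.prod m' a (A.prod m b c))

lemma analyticAt_swap {g : ℂ × ℂ → ℂ} (hg : AnalyticAt ℂ g 0) :
    AnalyticAt ℂ (fun x : ℂ × ℂ => g (x.2, x.1)) 0 :=
  hg.comp_of_eq (f := fun x : ℂ × ℂ => (x.2, x.1)) (analyticAt_snd.prod analyticAt_fst) rfl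

lemma analyticAt_shear {g : ℂ × ℂ → ℂ} (hg : AnalyticAt ℂ g 0) :
    AnalyticAt ℂ (fun x : ℂ × ℂ => g (x.2 + x.1, x.2)) 0 :=
  hg.comp_of_eq (f := fun x : ℂ × ℂ => (x.2 + x.1, x.2))
    ((analyticAt_snd.fun_add analyticAt_fst).prod analyticAt_snd) (by simp)

lemma finite_support_natShift {W : Type*} [AddCommGroup W] [Module ℂ W] {X : ℤ → ℤ → W}
    (hX : IsFieldFamily X) (p : ℤ) (q : ℕ → ℤ) (c : ℕ → ℂ) :
    (Function.support fun j : ℕ => c j • X (p + j) (q j)).Finite := by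
  obtain ⟨M, hM⟩ := hX.1
  refine (Set.finite_Iio (M - p).toNat).subset fun j hj => ?_
  by_contra h
  have h : (M - p).toNat ≤ j := not_lt.mp h
  exact hj (by simp only; rw [hM _ (by omega), smul_zero])

lemma residueIdentity_monomial (A : VertexAlgebra V) (a b c : V) (N α β : ℕ) :
    ResidueIdentity A a b c N fun x => x.1 ^ α * x.2 ^ β := by
  have h := A.borcherds a b c (α - N) (-N) (β - N)
  unfold ResidueIdentity
  rw [tripleSum_const_mul (g := fun x => x.2 ^ α * x.1 ^ β) (isFieldFamily_iterate A b a c) (by simp) _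
    ((analyticAt_snd.fun_pow α).fun_mul (analyticAt_fst.fun_pow β))]
  rw [tripleSum_of_monomial (by simp) (α - N) (β - N) (-N) (fun u v hu hv huv => ?_),
    tripleSum_of_monomial (by simp) (-N) (β - N) (α - N) (fun u v hu hv huv => ?_),
    tripleSum_of_monomial (by simp) (β - N) (α - N) (-N) (fun u v hu hv huv => ?_)]
  · have e1 : (∑ᶠ j : ℕ, (((Ring.choose ((α : ℤ) - N) j : ℤ) : ℂ) * 1 ^ ((α : ℤ) - N - j)) •
        A.prod (β - N + (α - N) - j) (A.prod (-N + j) a b) c) =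
        ∑ᶠ j : ℕ, Ring.choose ((α : ℤ) - N) j • A.prod (α - N + (β - N) - j) (A.prod (-N + j) a b) c := by
      refine finsum_congr fun j => ?_
      rw [one_zpow, mul_one, Int.cast_smul_eq_zsmul, add_comm ((β : ℤ) - N)]
    rw [e1, h]
    have hs : ∀ j : ℕ, (-1 : ℂ) ^ (-(N : ℤ) - j) = (-1) ^ N * (-1) ^ j := fun j => by
      rw [zpow_sub₀ (by simp), zpow_neg, zpow_natCast, zpow_natCast, ← inv_pow, div_eq_mul_inv, ← inv_pow]
      norm_num
    rw [smul_finsum' _ (finite_support_natShift (isFieldFamily_iterate A b a c) _ _ _),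
      ← finsum_add_distrib (finite_support_natShift (isFieldFamily_iterate A a b c) _ _ _)]
    · refine finsum_congr fun j => ?_
      have hN : ((Int.negOnePow (-(N : ℤ)) : ℤˣ) : ℤ) = (-1) ^ N := by
        rw [Int.negOnePow_neg, Int.negOnePow_def]; simp
      rw [hN, hs, ← Int.cast_smul_eq_zsmul ℂ, ← Int.cast_smul_eq_zsmul ℂ, smul_sub, smul_smul, smul_smul]
      have h1 : (-1 : ℂ) ^ N * (-1) ^ N = 1 := by rw [← mul_pow]; simp
      rw [show -(N : ℤ) + (α - N) - j = α - N + -N - j by ring,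
        show -(N : ℤ) + (β - N) - j = β - N + -N - j by ring]
      have h2 : (-1 : ℂ) ^ N * (((Ring.choose (-(N : ℤ)) j : ℤ) : ℂ) * ((-1) ^ N * (-1) ^ j)) =
          (((-1) ^ j * Ring.choose (-(N : ℤ)) j : ℤ) : ℂ) := by
        push_cast
        linear_combination ((Ring.choose (-(N : ℤ)) j : ℤ) : ℂ) * (-1) ^ j * h1
      have h3 : ((((-1) ^ j * Ring.choose (-(N : ℤ)) j : ℤ) : ℂ)) * (((-1) ^ N : ℤ) : ℂ) =
          (((Ring.choose (-(N : ℤ)) j : ℤ) : ℂ) * ((-1) ^ N * (-1) ^ j)) := by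
        push_cast; ring
      rw [h2, h3]
      abel
    · have h1 := finite_support_natShift (isFieldFamily_iterate A b a c) (β - N)
        (fun j => -N + (α - N) - j) (fun j => (((-1) ^ j * Ring.choose (-(N : ℤ)) j : ℤ) : ℂ))
      have h2 := finite_support_natShift (isFieldFamily_iterate A a b c) (α - N)
        (fun j => -N + (β - N) - j)
        (fun j => (((-1) ^ j * Ring.choose (-(N : ℤ)) j : ℤ) : ℂ) * ((Int.negOnePow (-(N : ℤ)) : ℤˣ) : ℤ))
      refine (h1.union h2).subset ?_
      refine (Function.support_sub _ _).trans' ?_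
      refine subset_of_eq (congrArg _ (funext fun j => ?_))
      rw [← Int.cast_smul_eq_zsmul ℂ, ← Int.cast_smul_eq_zsmul ℂ, smul_sub, smul_smul]
  · simp only [tripleQuot]
    generalize u + -1 * v = w at huv ⊢
    simp only [zpow_sub₀ hu, zpow_sub₀ hv, zpow_neg, zpow_natCast, mul_pow]
    field_simp
  · simp only [tripleQuot, show v + u = u + 1 * v by ring]
    generalize u + 1 * v = w at huv ⊢
    simp only [zpow_sub₀ huv, zpow_sub₀ hv, zpow_neg, zpow_natCast, mul_pow]
    field_simp
  · simp only [tripleQuot]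
    generalize u + -1 * v = w at huv ⊢
    simp only [zpow_sub₀ hu, zpow_sub₀ hv, zpow_neg, zpow_natCast, mul_pow]
    field_simp

section ResidueIdentity

variable {A : VertexAlgebra V} {a b c : V} {N : ℕ} {g g' : ℂ × ℂ → ℂ}

lemma ResidueIdentity.add (h : ResidueIdentity A a b c N g) (h' : ResidueIdentity A a b c N g')
    (hg : AnalyticAt ℂ g 0) (hg' : AnalyticAt ℂ g' 0) :
    ResidueIdentity A a b c N fun x => g x + g' x := by
  unfold ResidueIdentity at *
  simp only [mul_add]
  rw [tripleSum_add (isFieldFamily_iterate A a b c) (by simp) hg hg',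
    tripleSum_add (isFieldFamily_comp A a b c) (by simp) (analyticAt_shear hg) (analyticAt_shear hg'),
    tripleSum_add (isFieldFamily_iterate A b a c) (by simp)
      (analyticAt_const.fun_mul (analyticAt_swap hg)) (analyticAt_const.fun_mul (analyticAt_swap hg')),
    ← h, ← h']
  abel

lemma ResidueIdentity.const_mul (h : ResidueIdentity A a b c N g) (hg : AnalyticAt ℂ g 0) (r : ℂ) :
    ResidueIdentity A a b c N fun x => r * g x := by
  unfold ResidueIdentity at *
  have e : (fun x : ℂ × ℂ => (-1) ^ N * (r * g (x.2, x.1))) =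
      fun x => r * ((-1) ^ N * g (x.2, x.1)) := by ext; ring
  rw [e, tripleSum_const_mul (isFieldFamily_iterate A a b c) (by simp) r hg,
    tripleSum_const_mul (isFieldFamily_comp A a b c) (by simp) r (analyticAt_shear hg),
    tripleSum_const_mul (isFieldFamily_iterate A b a c) (by simp) r
      (analyticAt_const.fun_mul (analyticAt_swap hg)), ← h, smul_add]

lemma analyticAt_monomial (i j : ℕ) : AnalyticAt ℂ (fun x : ℂ × ℂ => x.1 ^ i * x.2 ^ j) 0 :=
  (analyticAt_fst.fun_pow i).fun_mul (analyticAt_snd.fun_pow j)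

lemma ResidueIdentity.sum {ι : Type*} (s : Finset ι) {g : ι → ℂ × ℂ → ℂ}
    (h : ∀ i ∈ s, AnalyticAt ℂ (g i) 0 ∧ ResidueIdentity A a b c N (g i)) :
    AnalyticAt ℂ (fun x => ∑ i ∈ s, g i x) 0 ∧
      ResidueIdentity A a b c N fun x => ∑ i ∈ s, g i x := by
  classical
  induction s using Finset.induction_on with
  | empty =>
    have := (residueIdentity_monomial A a b c N 0 0).const_mul (analyticAt_monomial 0 0) 0
    refine ⟨by simpa using analyticAt_const, by simpa using this⟩
  | insert i s hi ih =>
    obtain ⟨h1, h2⟩ := ih fun j hj => h j (Finset.mem_insert_of_mem hj)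
    obtain ⟨h3, h4⟩ := h i (Finset.mem_insert_self _ _)
    simp only [Finset.sum_insert hi]
    exact ⟨h3.fun_add h1, h4.add h2 h3 h1⟩

/-- Homogeneous Taylor polynomials in two variables are sums of monomials. -/
lemma multilinear_apply_eq_sum {k : ℕ} (p : (ℂ × ℂ) [×k]→L[ℂ] ℂ) (x : ℂ × ℂ) :
    p (fun _ => x) = ∑ s : Finset (Fin k),
      p (fun i => if i ∈ s then (1, 0) else (0, 1)) * (x.1 ^ s.card * x.2 ^ (k - s.card)) := by
  have e : (fun _ : Fin k => x) = (fun _ => x.1 • ((1, 0) : ℂ × ℂ)) + fun _ => x.2 • (0, 1) := by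
    ext i <;> simp
  have h := p.toMultilinearMap.map_add_univ (fun _ => x.1 • ((1, 0) : ℂ × ℂ)) (fun _ => x.2 • (0, 1))
  rw [e]
  refine h.trans (Finset.sum_congr rfl fun s _ => ?_)
  have e2 : s.piecewise (fun _ : Fin k => x.1 • ((1, 0) : ℂ × ℂ)) (fun _ => x.2 • (0, 1)) =
      fun i => (if i ∈ s then x.1 else x.2) • (if i ∈ s then ((1, 0) : ℂ × ℂ) else (0, 1)) := by
    ext1 i
    by_cases hi : i ∈ s <;> simp [hi]
  rw [e2, MultilinearMap.map_smul_univ, Finset.prod_ite, Finset.prod_const, Finset.prod_const,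
    smul_eq_mul, mul_comm]
  have h1 : (Finset.univ.filter fun i => i ∈ s).card = s.card := by simp
  have h2 : (Finset.univ.filter fun i => ¬ i ∈ s).card = k - s.card := by
    rw [← Finset.compl_filter, Finset.card_compl, h1, Fintype.card_fin]
  rw [h1, h2]
  rfl

lemma residueIdentity_partialSum (A : VertexAlgebra V) (a b c : V) (N K : ℕ)
    (p : FormalMultilinearSeries ℂ (ℂ × ℂ) ℂ) : AnalyticAt ℂ (fun x => p.partialSum K x) 0 ∧
      ResidueIdentity A a b c N fun x => p.partialSum K x := by
  simp only [FormalMultilinearSeries.partialSum, multilinear_apply_eq_sum]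
  refine ResidueIdentity.sum _ fun k _ => ResidueIdentity.sum _ fun s _ => ?_
  exact ⟨analyticAt_const.fun_mul (analyticAt_monomial _ _),
    (residueIdentity_monomial A a b c N _ _).const_mul (analyticAt_monomial _ _) _⟩

lemma isBigO_comp_linear {K : ℕ} (hO : g =O[𝓝 0] fun x => ‖x‖ ^ K) (L : (ℂ × ℂ) →L[ℂ] (ℂ × ℂ)) :
    (fun x => g (L x)) =O[𝓝 0] fun x => ‖x‖ ^ K := by
  have ht : Tendsto L (𝓝 0) (𝓝 0) := by simpa using L.continuous.tendsto 0
  exact (hO.comp_tendsto ht).trans ((L.isBigO_id _).norm_norm.pow K)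

/-- The Borcherds identity in its residue form: for every function `g(u, v) / (u v (u - v))^N` with
`g` holomorphic, the residue of its product with `Y(a, u) Y(b, v) c` in `|u| > |v|` is the sum of the
residues of its products with `Y(b, v) Y(a, u) c` in `|v| > |u|` and `Y(Y(a, u - v) b, v) c` in
`|v| > |u - v|`.  The Borcherds identity is the case of monomials, and the Taylor polynomial of `g` of
large degree determines all three residues. -/
theorem borcherds_residue (A : VertexAlgebra V) (a b c : V) (N : ℕ) (hg : AnalyticAt ℂ g 0) :
    ResidueIdentity A a b c N g := by
  obtain ⟨K₁, h1⟩ := exists_tripleSum_eq_zero (isFieldFamily_iterate A a b c) (ε := -1) (by simp) N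
  obtain ⟨K₂, h2⟩ := exists_tripleSum_eq_zero (isFieldFamily_comp A a b c) (ε := 1) (by simp) N
  obtain ⟨K₃, h3⟩ := exists_tripleSum_eq_zero (isFieldFamily_iterate A b a c) (ε := -1) (by simp) N
  set K := K₁ + K₂ + K₃ with hK
  obtain ⟨p, hp⟩ := id hg
  obtain ⟨hq, hqI⟩ := residueIdentity_partialSum A a b c N K p
  set R : ℂ × ℂ → ℂ := fun x => g x - p.partialSum K x with hR
  have hRa : AnalyticAt ℂ R 0 := hg.fun_sub hq
  have hRO : R =O[𝓝 0] fun x => ‖x‖ ^ K := by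
    simpa using hp.isBigO_sub_partialSum_pow K
  have hRI : ResidueIdentity A a b c N R := by
    unfold ResidueIdentity
    rw [h1 K (by omega) R hRa hRO, h2 K (by omega) _ (analyticAt_shear hRa)
      (isBigO_comp_linear hRO (((ContinuousLinearMap.snd ℂ ℂ ℂ) + (ContinuousLinearMap.fst ℂ ℂ ℂ)).prod
        (ContinuousLinearMap.snd ℂ ℂ ℂ))),
      h3 K (by omega) _ (analyticAt_const.fun_mul (analyticAt_swap hRa)) ?_, add_zero]
    exact (isBigO_comp_linear hRO ((ContinuousLinearMap.snd ℂ ℂ ℂ).prod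
      (ContinuousLinearMap.fst ℂ ℂ ℂ))).const_mul_left _
  have := hRI.add hqI hRa hq
  simpa [hR] using this

end ResidueIdentity

/-! ### Iterated residues of functions of two variables -/

/-- The three iterated expansions of `F(u, v) = g(u, v) / (u v (u - v))^N`. -/
lemma finsum_lc_borcherds (A : VertexAlgebra V) (a b c : V) {F : ℂ → ℂ → ℂ} {g : ℂ × ℂ → ℂ} {N : ℕ}
    (hg : AnalyticAt ℂ g 0)
    (hF : ∀ᶠ x in 𝓝 (0 : ℂ × ℂ), x.1 ≠ 0 → x.2 ≠ 0 → x.1 - x.2 ≠ 0 →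
      F x.1 x.2 = g x / (x.1 * x.2 * (x.1 - x.2)) ^ N) :
    ∑ᶠ p : ℤ × ℤ, (lc p.2 fun v => lc p.1 fun u => F u v) • A.prod p.2 b (A.prod p.1 a c) +
      ∑ᶠ p : ℤ × ℤ, (lc p.2 fun v => lc p.1 fun w => F (v + w) v) • A.prod p.2 (A.prod p.1 a b) c =
    ∑ᶠ p : ℤ × ℤ, (lc p.2 fun u => lc p.1 fun v => F u v) • A.prod p.2 a (A.prod p.1 b c) := by
  have key := borcherds_residue A a b c N hg
  have hne : ∀ ε v : ℂ, ε ≠ 0 → v ≠ 0 → ∀ᶠ u in 𝓝[≠] (0 : ℂ), u + ε * v ≠ 0 := fun ε v hε hv => by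
    have : ContinuousAt (fun u : ℂ => u + ε * v) 0 := by fun_prop
    exact (this.eventually_ne (by simpa using ⟨hε, hv⟩)).filter_mono nhdsWithin_le_nhds
  have hA : ∀ m m', (lc m' fun v => lc m fun u => F u v) = tripleCoeff (-1) N g m m' := by
    intro m m'
    refine lc_congr ?_
    filter_upwards [(eventually_pair hF).filter_mono nhdsWithin_le_nhds, self_mem_nhdsWithin] with v hv hv0
    refine lc_congr ?_
    filter_upwards [hv.filter_mono nhdsWithin_le_nhds, self_mem_nhdsWithin,
      hne (-1) v (by simp) hv0] with u hu hu0 huv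
    have e : u + -1 * v = u - v := by ring
    rw [e] at huv
    rw [hu hu0 hv0 huv, tripleQuot, e, ← mul_pow]
    ring
  have hC : ∀ m m', (lc m' fun v => lc m fun w => F (v + w) v) =
      tripleCoeff 1 N (fun x => g (x.2 + x.1, x.2)) m m' := by
    intro m m'
    refine lc_congr ?_
    have hF' : ∀ᶠ x in 𝓝 (0 : ℂ × ℂ), x.2 + x.1 ≠ 0 → x.2 ≠ 0 → x.2 + x.1 - x.2 ≠ 0 →
        F (x.2 + x.1) x.2 = g (x.2 + x.1, x.2) / ((x.2 + x.1) * x.2 * (x.2 + x.1 - x.2)) ^ N := by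
      have hc : Continuous fun x : ℂ × ℂ => (x.2 + x.1, x.2) := by fun_prop
      have ht := hc.tendsto 0
      simp only [Prod.fst_zero, Prod.snd_zero, add_zero] at ht
      exact ht.eventually hF
    filter_upwards [(eventually_pair hF').filter_mono nhdsWithin_le_nhds, self_mem_nhdsWithin] with v hv hv0
    refine lc_congr ?_
    filter_upwards [hv.filter_mono nhdsWithin_le_nhds, self_mem_nhdsWithin,
      hne 1 v (by simp) hv0] with u hu hu0 huv
    have e : u + 1 * v = v + u := by ring
    rw [e] at huv
    rw [hu huv hv0 (by simpa using hu0), tripleQuot, e, ← mul_pow]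
    ring
  have hB : ∀ m m', (lc m' fun u => lc m fun v => F u v) =
      tripleCoeff (-1) N (fun x => (-1) ^ N * g (x.2, x.1)) m m' := by
    intro m m'
    refine lc_congr ?_
    have hF' : ∀ᶠ x in 𝓝 (0 : ℂ × ℂ), x.2 ≠ 0 → x.1 ≠ 0 → x.2 - x.1 ≠ 0 →
        F x.2 x.1 = g (x.2, x.1) / (x.2 * x.1 * (x.2 - x.1)) ^ N := by
      have hc : Continuous fun x : ℂ × ℂ => (x.2, x.1) := by fun_prop
      exact (hc.tendsto 0).eventually hF
    filter_upwards [(eventually_pair hF').filter_mono nhdsWithin_le_nhds, self_mem_nhdsWithin] with v hv hv0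
    refine lc_congr ?_
    filter_upwards [hv.filter_mono nhdsWithin_le_nhds, self_mem_nhdsWithin,
      hne (-1) v (by simp) hv0] with u hu hu0 huv
    have e : u + -1 * v = -(v - u) := by ring
    rw [e] at huv
    have e2 : u * (v * -(v - u)) = -1 * (v * u * (v - u)) := by ring
    rw [hu hv0 hu0 (neg_ne_zero.mp huv), tripleQuot, e, ← mul_pow, e2, mul_pow (-1 : ℂ),
      mul_div_mul_left _ _ (pow_ne_zero _ (by simp))]
  simp only [hA, hB, hC]
  exact key

/-- Iterated Laurent coefficients along two transversal divisors do not depend on the order. -/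
lemma lc_lc_comm {F : ℂ → ℂ → ℂ} {g : ℂ × ℂ → ℂ} {N : ℕ} (hg : AnalyticAt ℂ g 0)
    (hF : ∀ᶠ x in 𝓝 (0 : ℂ × ℂ), x.1 ≠ 0 → x.2 ≠ 0 → F x.1 x.2 = g x / (x.1 * x.2) ^ N) (m m' : ℤ) :
    (lc m' fun v => lc m fun u => F u v) = ddc (m' + N) (0, 1) (ddc (m + N) (1, 0) g) 0 ∧
      (lc m fun u => lc m' fun v => F u v) = ddc (m' + N) (0, 1) (ddc (m + N) (1, 0) g) 0 := by
  constructor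
  · have hin : ∀ᶠ v in 𝓝[≠] (0 : ℂ), lc m (fun u => F u v) =
        ddc (m + N) (1, 0) g (0 + v • (0, 1)) / v ^ N := by
      filter_upwards [(eventually_pair hF).filter_mono nhdsWithin_le_nhds, self_mem_nhdsWithin,
        (tendsto_pair_right.eventually hg.eventually_analyticAt).filter_mono nhdsWithin_le_nhds]
        with v hv hv0 hgv
      have hv0 : v ≠ 0 := hv0
      have h1 := lc_eq_tc (h := fun u => (v ^ N)⁻¹ * g ((0, v) + u • (1, 0))) (φ := fun u => F u v) N m
        (analyticAt_const.fun_mul (analyticAt_line _ hgv)) (by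
          filter_upwards [hv.filter_mono nhdsWithin_le_nhds, self_mem_nhdsWithin] with u hu hu0
          have hu0 : u ≠ 0 := hu0
          rw [hu hu0 hv0, pair_add_smul, mul_pow]
          field_simp)
      rw [h1, tc_const_mul, tc_line _ _ hgv, div_eq_inv_mul]
      simp
    rw [← tc_line _ _ (analyticAt_ddc _ _ hg)]
    exact lc_eq_tc N m' (analyticAt_line _ (analyticAt_ddc _ _ hg)) hin
  · have hc : Continuous fun x : ℂ × ℂ => (x.2, x.1) := by fun_prop
    have hF' : ∀ᶠ x in 𝓝 (0 : ℂ × ℂ), x.2 ≠ 0 → x.1 ≠ 0 → F x.2 x.1 = g (x.2, x.1) / (x.2 * x.1) ^ N :=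
      (hc.tendsto 0).eventually hF
    have hin : ∀ᶠ u in 𝓝[≠] (0 : ℂ), lc m' (fun v => F u v) =
        ddc (m' + N) (0, 1) g (0 + u • (1, 0)) / u ^ N := by
      have hgu' : ∀ᶠ u in 𝓝 (0 : ℂ), AnalyticAt ℂ g (u, 0) := by
        have : Tendsto (fun u : ℂ => (u, (0 : ℂ))) (𝓝 0) (𝓝 (0 : ℂ × ℂ)) :=
          (Continuous.prodMk continuous_id continuous_const).tendsto 0
        exact this.eventually hg.eventually_analyticAt
      filter_upwards [(eventually_pair hF').filter_mono nhdsWithin_le_nhds, self_mem_nhdsWithin,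
        hgu'.filter_mono nhdsWithin_le_nhds] with u hu hu0 hgu
      have hu0 : u ≠ 0 := hu0
      have h1 := lc_eq_tc (h := fun v => (u ^ N)⁻¹ * g ((u, 0) + v • (0, 1))) (φ := fun v => F u v) N m'
        (analyticAt_const.fun_mul (analyticAt_line _ hgu)) (by
          filter_upwards [hu.filter_mono nhdsWithin_le_nhds, self_mem_nhdsWithin] with v hv hv0
          have hv0 : v ≠ 0 := hv0
          rw [hv hu0 hv0, mul_pow]
          simp only [Prod.smul_mk, mul_zero, smul_eq_mul, mul_one, Prod.mk_add_mk, add_zero, zero_add]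
          field_simp)
      rw [h1, tc_const_mul, tc_line _ _ hgu, div_eq_inv_mul]
      simp
    rw [ddc_comm _ _ _ _ hg, ← tc_line _ _ (analyticAt_ddc _ _ hg)]
    exact lc_eq_tc N m (analyticAt_line _ (analyticAt_ddc _ _ hg)) hin

/-! ### Evaluation at points of the configuration space -/

/-- The evaluation `f ⊗ z ↦ f(y) z`. -/
def evalAt (τ : UpperHalfPlane) {n : ℕ} (W : Type*) [AddCommGroup W] [Module ℂ W] (y : Fin n → ℂ) :
    Gam τ n ⊗[ℂ] W →ₗ[ℂ] W :=
  TensorProduct.lift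
    ((LinearMap.lsmul ℂ W : ℂ →ₗ[ℂ] W →ₗ[ℂ] W) ∘ₗ (LinearMap.proj y ∘ₗ toFun τ n))

lemma evalAt_tmul (τ : UpperHalfPlane) {n : ℕ} {W : Type*} [AddCommGroup W] [Module ℂ W]
    (y : Fin n → ℂ) (f : Gam τ n) (z : W) : evalAt τ W y (f ⊗ₜ z) = toFun τ n f y • z := rfl

/-- Tensors with coefficients in `Γ_n` are determined by their values. -/
lemma eq_of_evalAt_eq {τ : UpperHalfPlane} {n : ℕ} {W : Type*} [AddCommGroup W] [Module ℂ W]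
    {x x' : Gam τ n ⊗[ℂ] W} (h : ∀ y ∈ conf τ n, evalAt τ W y x = evalAt τ W y x') : x = x' := by
  classical
  set b := Module.Basis.ofVectorSpace ℂ W
  have key : ∀ (k) (y : Fin n → ℂ) (z : Gam τ n ⊗[ℂ] W),
      toFun τ n (TensorProduct.equivFinsuppOfBasisRight b z k) y = b.repr (evalAt τ W y z) k := by
    intro k y z
    induction z using TensorProduct.induction_on with
    | zero => simp
    | add z z' hz hz' =>
      rw [map_add, map_add, map_add, Finsupp.add_apply, Finsupp.add_apply, map_add, Pi.add_apply, hz, hz']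
    | tmul f w =>
      rw [evalAt_tmul, TensorProduct.equivFinsuppOfBasisRight_apply_tmul_apply, map_smul, map_smul]
      simp [mul_comm]
  refine (TensorProduct.equivFinsuppOfBasisRight b).injective (Finsupp.ext fun k => ?_)
  refine Gam.ext_conf fun y hy => ?_
  rw [key, key, h y hy]

/-! ### Two points moving at the same time -/

lemma insertNth_insertNth {α : Type*} {n : ℕ} {p q : Fin (n + 1)} (hpq : p ≤ q) (a b : α)
    (r : Fin n → α) : (p.castSucc.insertNth a (q.insertNth b r : Fin (n + 1) → α) : Fin (n + 2) → α) =
      q.succ.insertNth b (p.insertNth a r : Fin (n + 1) → α) := by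
  have h1 : p.castSucc.succAbove q = q.succ := Fin.succAbove_castSucc_of_le _ _ hpq
  have h2 : q.succ.succAbove p = p.castSucc := Fin.succAbove_succ_of_le _ _ hpq
  ext k
  induction k using Fin.succAboveCases p.castSucc with
  | x => rw [Fin.insertNth_apply_same, ← h2, Fin.insertNth_apply_succAbove, Fin.insertNth_apply_same]
  | p l =>
    rw [Fin.insertNth_apply_succAbove]
    induction l using Fin.succAboveCases q with
    | x => rw [Fin.insertNth_apply_same, h1, Fin.insertNth_apply_same]
    | p l =>
      have h3 : p.castSucc.succAbove (q.succAbove l) = q.succ.succAbove (p.succAbove l) := by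
        rcases lt_or_ge l.castSucc p with hl | hl
        · have hl' : l.castSucc < q := hl.trans_le hpq
          rw [Fin.succAbove_of_castSucc_lt _ _ hl, Fin.succAbove_of_castSucc_lt _ _ hl',
            Fin.succAbove_of_castSucc_lt _ _ (Fin.castSucc_lt_castSucc_iff.mpr hl),
            Fin.succAbove_of_castSucc_lt]
          simp only [Fin.lt_def, Fin.val_castSucc, Fin.val_succ] at *; omega
        · rw [Fin.succAbove_of_le_castSucc p _ hl]
          rcases lt_or_ge l.castSucc q with hl' | hl'
          · rw [Fin.succAbove_of_castSucc_lt _ _ hl', Fin.succAbove_of_le_castSucc,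
              Fin.succAbove_of_castSucc_lt]
            · rfl
            · simp only [Fin.lt_def, Fin.val_castSucc, Fin.val_succ] at *; omega
            · simp only [Fin.le_def, Fin.val_castSucc] at *; omega
          · rw [Fin.succAbove_of_le_castSucc _ _ hl', Fin.succAbove_of_le_castSucc,
              Fin.succAbove_of_le_castSucc]
            · simp only [Fin.le_def, Fin.val_castSucc, Fin.val_succ] at *; omega
            · simp only [Fin.le_def, Fin.val_castSucc, Fin.val_succ] at *; omega
      rw [Fin.insertNth_apply_succAbove, h3, Fin.insertNth_apply_succAbove,
        Fin.insertNth_apply_succAbove]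

/-- The configuration obtained from `y` by inserting two points: `b` at position `q`, then `a` at
position `p` of the result. For `p ≤ q` the point `b` ends up at position `q + 1`. -/
def ins₂ {n : ℕ} (p q : Fin (n + 1)) (y : Fin n → ℂ) (a b : ℂ) : Fin (n + 2) → ℂ :=
  p.castSucc.insertNth a (q.insertNth b y : Fin (n + 1) → ℂ)

lemma pts_ins₂ {n : ℕ} (p q : Fin (n + 1)) (y : Fin n → ℂ) (a b : ℂ) :
    pts (ins₂ p q y a b) =
      p.castSucc.castSucc.insertNth a (q.castSucc.insertNth b (pts y) : Fin (n + 2) → ℂ) := by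
  rw [ins₂, pts_insertNth, pts_insertNth]

lemma pts_sub_mem_lattice {τ : UpperHalfPlane} {n : ℕ} {y : Fin n → ℂ} (hy : y ∈ conf τ n)
    {a b : Fin (n + 1)} : pts y a - pts y b ∈ (periods τ).lattice ↔ a = b := by
  constructor
  · intro h
    rcases lt_trichotomy a b with hab | hab | hab
    · exact absurd h (hy ⟨(a, b), hab⟩)
    · exact hab
    · refine absurd ?_ (hy ⟨(b, a), hab⟩)
      have := neg_mem h
      rwa [neg_sub] at this
  · rintro rfl
    rw [sub_self]
    exact zero_mem _

lemma eventually_mem_conf_of_locEq_ne_zero (τ : UpperHalfPlane) {n : ℕ} (P : Fin n → ℂ) :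
    ∀ᶠ x in 𝓝 P, locEq P (through τ P) x ≠ 0 → x ∈ conf τ n := by
  have h : ∀ k : DivIdx n, ∀ᶠ x in 𝓝 P, locEq P (through τ P) x ≠ 0 →
      divFun k x ∉ (periods τ).lattice := by
    intro k
    have ht : Tendsto (divFun k) (𝓝 P) (𝓝 (divFun k P)) :=
      (analyticAt_divFun k P).continuousAt.tendsto
    by_cases hk : k ∈ through τ P
    · have h0 : ∀ᶠ z in 𝓝 (0 : ℂ), z ≠ 0 → z ∉ (periods τ).lattice :=
        eventually_nhdsWithin_iff.mp (eventually_notMem_lattice_zero τ)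
      have ht' : Tendsto (fun x => divFun k x - divFun k P) (𝓝 P) (𝓝 0) := by
        simpa using ht.sub_const (divFun k P)
      filter_upwards [ht'.eventually h0] with x hx hne hmem
      exact hx (Finset.prod_ne_zero_iff.mp hne k hk) (sub_mem hmem (mem_through.mp hk))
    · rw [mem_through] at hk
      filter_upwards [ht.eventually (eventually_notMem_lattice τ hk)] with x hx _ using hx
  filter_upwards [eventually_all.mpr h] with x hx hne k using hx k hne

/-- The labels of the points: the first moving point, the second one and the others. -/
lemma label_cases {n : ℕ} {p q : Fin (n + 1)} (hpq : p ≤ q) (k : Fin (n + 3)) :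
    k = p.castSucc.castSucc ∨ k = q.succ.castSucc ∨
      ∃ l, k = p.castSucc.castSucc.succAbove (q.castSucc.succAbove l) := by
  induction k using Fin.succAboveCases p.castSucc.castSucc with
  | x => exact Or.inl rfl
  | p k =>
    induction k using Fin.succAboveCases q.castSucc with
    | x =>
      refine Or.inr (Or.inl ?_)
      rw [Fin.succAbove_castSucc_of_le _ _ (Fin.castSucc_le_castSucc_iff.mpr hpq), Fin.succ_castSucc]
    | p l => exact Or.inr (Or.inr ⟨l, rfl⟩)

lemma first_lt_label {n : ℕ} {p : Fin (n + 1)} (q : Fin (n + 1)) {c : Fin (n + 1)} (hc : p ≤ c) :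
    p.castSucc.castSucc < p.castSucc.castSucc.succAbove (q.castSucc.succAbove c) := by
  refine Fin.lt_succAbove_iff_le_castSucc _ _ |>.mpr ?_
  rw [Fin.castSucc_le_castSucc_iff]
  rcases lt_or_ge c q with h | h
  · rw [Fin.succAbove_castSucc_of_lt _ _ h]; exact Fin.castSucc_le_castSucc_iff.mpr hc
  · rw [Fin.succAbove_castSucc_of_le _ _ h]
    exact (Fin.castSucc_lt_succ_iff.mpr hc).le

section Labels

variable {n : ℕ} {p q : Fin (n + 1)} (hpq : p ≤ q)
include hpq

lemma succ_castSucc_eq_succAbove :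
    q.succ.castSucc = p.castSucc.castSucc.succAbove q.castSucc := by
  rw [Fin.succAbove_castSucc_of_le _ _ (Fin.castSucc_le_castSucc_iff.mpr hpq), Fin.succ_castSucc]

lemma first_lt_second : p.castSucc.castSucc < q.succ.castSucc := by
  simp only [Fin.lt_def, Fin.le_def, Fin.val_castSucc, Fin.val_succ] at *; omega

lemma second_lt_label {c : Fin (n + 1)} (hc : q ≤ c) :
    q.succ.castSucc < p.castSucc.castSucc.succAbove (q.castSucc.succAbove c) := by
  rw [Fin.succAbove_castSucc_of_le _ _ hc, Fin.succAbove_castSucc_of_le]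
  · simp only [Fin.lt_def, Fin.le_def, Fin.val_castSucc, Fin.val_succ] at *; omega
  · simp only [Fin.le_def, Fin.val_castSucc, Fin.val_succ] at *; omega

end Labels

/-- The value of a quantity attached to the points of a configuration with two moving points. -/
lemma ins_apply_first {α : Type*} {n : ℕ} (p q : Fin (n + 1)) (a b : α) (r : Fin (n + 1) → α) :
    (p.castSucc.castSucc.insertNth a (q.castSucc.insertNth b r : Fin (n + 2) → α) : Fin (n + 3) → α)
      p.castSucc.castSucc = a := Fin.insertNth_apply_same _ _ _

lemma ins_apply_second {α : Type*} {n : ℕ} {p q : Fin (n + 1)} (hpq : p ≤ q) (a b : α)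
    (r : Fin (n + 1) → α) :
    (p.castSucc.castSucc.insertNth a (q.castSucc.insertNth b r : Fin (n + 2) → α) : Fin (n + 3) → α)
      q.succ.castSucc = b := by
  rw [succ_castSucc_eq_succAbove hpq, Fin.insertNth_apply_succAbove, Fin.insertNth_apply_same]

lemma ins_apply_label {α : Type*} {n : ℕ} (p q : Fin (n + 1)) (a b : α) (r : Fin (n + 1) → α)
    (l : Fin (n + 1)) :
    (p.castSucc.castSucc.insertNth a (q.castSucc.insertNth b r : Fin (n + 2) → α) : Fin (n + 3) → α)
      (p.castSucc.castSucc.succAbove (q.castSucc.succAbove l)) = r l := by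
  rw [Fin.insertNth_apply_succAbove, Fin.insertNth_apply_succAbove]

section TwoPoints

variable {τ : UpperHalfPlane} {n : ℕ} {p q c c' : Fin (n + 1)} {y : Fin n → ℂ}

/-- The divisor on which the first inserted point coincides with the point labelled `c` in the
configuration without the inserted points. -/
def divFirst (q : Fin (n + 1)) (hc : p ≤ c) : DivIdx (n + 2) :=
  ⟨(p.castSucc.castSucc, p.castSucc.castSucc.succAbove (q.castSucc.succAbove c)), first_lt_label q hc⟩

/-- The divisor on which the second inserted point coincides with the point labelled `c'`. -/
def divSecond (hpq : p ≤ q) (hc : q ≤ c') : DivIdx (n + 2) :=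
  ⟨(q.succ.castSucc, p.castSucc.castSucc.succAbove (q.castSucc.succAbove c')), second_lt_label hpq hc⟩

/-- The divisor on which the two inserted points coincide. -/
def divBoth (hpq : p ≤ q) : DivIdx (n + 2) :=
  ⟨(p.castSucc.castSucc, q.succ.castSucc), first_lt_second hpq⟩

lemma mem_through_ins₂ (hpq : p ≤ q) (hc : p ≤ c) (hc' : q ≤ c') (hy : y ∈ conf τ n)
    (k : DivIdx (n + 2)) : k ∈ through τ (ins₂ p q y (pts y c) (pts y c')) ↔
      (k = divFirst q hc ∨ k = divSecond hpq hc' ∨ (c = c' ∧ k = divBoth hpq)) := by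
  rw [mem_through, divFun, pts_ins₂]
  constructor
  · obtain ⟨⟨a, b⟩, hab⟩ := k
    have hab : a < b := hab
    intro h
    simp only at h
    rcases label_cases hpq a with rfl | rfl | ⟨l, rfl⟩ <;>
      rcases label_cases hpq b with rfl | rfl | ⟨l', rfl⟩ <;>
      simp only [ins_apply_first, ins_apply_second hpq, ins_apply_label, pts_sub_mem_lattice hy] at h
    · exact absurd hab (lt_irrefl _)
    · exact Or.inr (Or.inr ⟨h, rfl⟩)
    · subst h; exact Or.inl rfl
    · exact absurd hab (first_lt_second hpq).not_gt
    · exact absurd hab (lt_irrefl _)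
    · subst h; exact Or.inr (Or.inl rfl)
    · subst h; exact absurd hab (first_lt_label q hc).not_gt
    · subst h; exact absurd hab (second_lt_label hpq hc').not_gt
    · subst h; exact absurd hab (lt_irrefl _)
  · rintro (rfl | rfl | ⟨rfl, rfl⟩) <;>
      simp only [divFirst, divSecond, divBoth, ins_apply_first, ins_apply_second hpq, ins_apply_label,
        sub_self] <;> exact zero_mem _

lemma divFun_first (hc : p ≤ c) (u v : ℂ) :
    divFun (divFirst q hc) (ins₂ p q y (pts y c + u) (pts y c' + v)) -
      divFun (divFirst q hc) (ins₂ p q y (pts y c) (pts y c')) = u := by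
  simp only [divFun, pts_ins₂, divFirst, ins_apply_first, ins_apply_label]; ring

lemma divFun_second (hpq : p ≤ q) (hc' : q ≤ c') (u v : ℂ) :
    divFun (divSecond hpq hc') (ins₂ p q y (pts y c + u) (pts y c' + v)) -
      divFun (divSecond hpq hc') (ins₂ p q y (pts y c) (pts y c')) = v := by
  simp only [divFun, pts_ins₂, divSecond, ins_apply_second hpq, ins_apply_label]; ring

lemma divFun_both (hpq : p ≤ q) (u v : ℂ) :
    divFun (divBoth hpq) (ins₂ p q y (pts y c + u) (pts y c' + v)) -
      divFun (divBoth hpq) (ins₂ p q y (pts y c) (pts y c')) = u - v := by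
  simp only [divFun, pts_ins₂, divBoth, ins_apply_first, ins_apply_second hpq]; ring

lemma divFirst_ne_divSecond (hpq : p ≤ q) (hc : p ≤ c) (hc' : q ≤ c') :
    divFirst q hc ≠ divSecond hpq hc' := fun h =>
  (first_lt_second hpq).ne (congrArg (fun k => k.1.1) h)

lemma divBoth_ne_divSecond (hpq : p ≤ q) (hc' : q ≤ c') : divBoth hpq ≠ divSecond hpq hc' := fun h =>
  (first_lt_second hpq).ne (congrArg (fun k => k.1.1) h)

lemma divFirst_ne_divBoth (hpq : p ≤ q) (hc : p ≤ c) : divFirst q hc ≠ divBoth hpq := fun h => by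
  have h1 : p.castSucc.castSucc.succAbove (q.castSucc.succAbove c) = q.succ.castSucc :=
    congrArg (fun k => k.1.2) h
  rw [succ_castSucc_eq_succAbove hpq] at h1
  exact Fin.succAbove_ne _ _ (Fin.succAbove_right_injective h1)

lemma through_ins₂_of_ne (hpq : p ≤ q) (hc : p ≤ c) (hc' : q ≤ c') (hcc : c ≠ c')
    (hy : y ∈ conf τ n) : through τ (ins₂ p q y (pts y c) (pts y c')) =
      {divFirst q hc, divSecond hpq hc'} := by
  ext k
  simp [mem_through_ins₂ hpq hc hc' hy, hcc]

lemma through_ins₂_self (hpq : p ≤ q) (hc' : q ≤ c') (hy : y ∈ conf τ n) :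
    through τ (ins₂ p q y (pts y c') (pts y c')) =
      {divFirst q (hpq.trans hc'), divBoth hpq, divSecond hpq hc'} := by
  ext k
  simp only [mem_through_ins₂ hpq (hpq.trans hc') hc' hy, Finset.mem_insert, Finset.mem_singleton]
  tauto

lemma locEq_ins₂_of_ne (hpq : p ≤ q) (hc : p ≤ c) (hc' : q ≤ c') (hcc : c ≠ c')
    (hy : y ∈ conf τ n) (u v : ℂ) :
    locEq (ins₂ p q y (pts y c) (pts y c')) (through τ (ins₂ p q y (pts y c) (pts y c')))
      (ins₂ p q y (pts y c + u) (pts y c' + v)) = u * v := by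
  rw [through_ins₂_of_ne hpq hc hc' hcc hy, locEq, Finset.prod_insert, Finset.prod_singleton,
    divFun_first hc, divFun_second hpq hc']
  simpa using divFirst_ne_divSecond hpq hc hc'

lemma locEq_ins₂_self (hpq : p ≤ q) (hc' : q ≤ c') (hy : y ∈ conf τ n) (u v : ℂ) :
    locEq (ins₂ p q y (pts y c') (pts y c')) (through τ (ins₂ p q y (pts y c') (pts y c')))
      (ins₂ p q y (pts y c' + u) (pts y c' + v)) = u * v * (u - v) := by
  rw [through_ins₂_self hpq hc' hy, locEq, Finset.prod_insert, Finset.prod_insert,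
    Finset.prod_singleton, divFun_first (hpq.trans hc'), divFun_second hpq hc', divFun_both hpq]
  · ring
  · simpa using divBoth_ne_divSecond hpq hc'
  · rw [Finset.mem_insert, Finset.mem_singleton, not_or]
    exact ⟨divFirst_ne_divBoth hpq (hpq.trans hc'), divFirst_ne_divSecond hpq (hpq.trans hc') hc'⟩

lemma analyticAt_ins₂ (p q : Fin (n + 1)) (y : Fin n → ℂ) (a b : ℂ) (x : ℂ × ℂ) :
    AnalyticAt ℂ (fun x : ℂ × ℂ => ins₂ p q y (a + x.1) (b + x.2)) x := by
  rw [analyticAt_pi_iff]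
  intro k
  induction k using Fin.succAboveCases p.castSucc with
  | x => simpa [ins₂] using analyticAt_const.fun_add analyticAt_fst
  | p k =>
    induction k using Fin.succAboveCases q with
    | x => simpa [ins₂] using analyticAt_const.fun_add analyticAt_snd
    | p k => simpa [ins₂] using analyticAt_const

/-- The local form of a function in `Γ_{n+2}` when two points approach two other points. -/
lemma exists_form_ins₂ {f : (Fin (n + 2) → ℂ) → ℂ} (hf : f ∈ gamSubmodule τ (n + 2))
    (a b : ℂ) : ∃ (N : ℕ) (g : ℂ × ℂ → ℂ), AnalyticAt ℂ g 0 ∧ ∀ᶠ x in 𝓝 (0 : ℂ × ℂ),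
      locEq (ins₂ p q y a b) (through τ (ins₂ p q y a b)) (ins₂ p q y (a + x.1) (b + x.2)) ≠ 0 →
      f (ins₂ p q y (a + x.1) (b + x.2)) = g x /
        locEq (ins₂ p q y a b) (through τ (ins₂ p q y a b)) (ins₂ p q y (a + x.1) (b + x.2)) ^ N := by
  obtain ⟨-, -, N, h3⟩ := hf
  obtain ⟨g, hg, hfg⟩ := h3 (ins₂ p q y a b)
  have hφ := analyticAt_ins₂ p q y a b 0
  have h0 : ins₂ p q y (a + (0 : ℂ × ℂ).1) (b + (0 : ℂ × ℂ).2) = ins₂ p q y a b := by simp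
  have ht : Tendsto (fun x : ℂ × ℂ => ins₂ p q y (a + x.1) (b + x.2)) (𝓝 0) (𝓝 (ins₂ p q y a b)) := by
    have := hφ.continuousAt.tendsto
    rwa [h0] at this
  refine ⟨N, fun x => g (ins₂ p q y (a + x.1) (b + x.2)),
    hg.comp_of_eq (f := fun x : ℂ × ℂ => ins₂ p q y (a + x.1) (b + x.2)) hφ h0, ?_⟩
  filter_upwards [ht.eventually hfg, ht.eventually (eventually_mem_conf_of_locEq_ne_zero τ _)]
    with x h1 h2 hne using h1 (h2 hne)

end TwoPoints

/-! ### Iterated residues -/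

lemma toFun_lcoeff_lcoeff (τ : UpperHalfPlane) {n : ℕ} {i j : Fin (n + 2)} (hij : i ≤ j)
    {i' j' : Fin (n + 1)} (hij' : i' ≤ j') (m m' : ℤ) (f : Gam τ (n + 2)) {y : Fin n → ℂ}
    (hy : y ∈ conf τ n) : toFun τ n (lcoeff τ hij' m' (lcoeff τ hij m f)) y =
      lc m' fun v => lc m fun u => toFun τ (n + 2) f
        (i.insertNth (pts (i'.insertNth (pts y j' + v) y : Fin (n + 1) → ℂ) j + u)
          (i'.insertNth (pts y j' + v) y : Fin (n + 1) → ℂ)) := by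
  rw [toFun_lcoeff, laurentCoeff_of_mem _ _ _ _ hy]
  refine lc_congr ?_
  filter_upwards [eventually_mem_conf hij' hy] with v hv
  rw [toFun_lcoeff, laurentCoeff_of_mem _ _ _ _ hv, insertNth_eq_diag i' j' y v]
  simp only [insertNth_eq_diag]

/-- Double Laurent coefficients are bounded below, so a family which is bounded above in the same
sense makes the double sum finite. -/
lemma finite_support_lcoeff_lcoeff_smul (τ : UpperHalfPlane) {n : ℕ} {i j : Fin (n + 2)} (hij : i ≤ j)
    {i' j' : Fin (n + 1)} (hij' : i' ≤ j') (f : Gam τ (n + 2)) (y : Fin n → ℂ)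
    {W : Type*} [AddCommGroup W] [Module ℂ W] {ψ : ℤ → ℤ → W}
    (h1 : ∃ M : ℤ, ∀ m, M ≤ m → ∀ m', ψ m m' = 0) (h2 : ∀ m, ∃ M : ℤ, ∀ m', M ≤ m' → ψ m m' = 0) :
    (Function.support fun p : ℤ × ℤ =>
      toFun τ n (lcoeff τ hij' p.2 (lcoeff τ hij p.1 f)) y • ψ p.1 p.2).Finite := by
  obtain ⟨N, hN⟩ := exists_lcoeff_eq_zero τ hij f
  obtain ⟨M, hM⟩ := h1
  choose M' hM' using h2
  choose N' hN' using fun m => exists_lcoeff_eq_zero τ hij' (lcoeff τ hij m f)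
  refine ((Set.finite_Ico N M).biUnion (t := fun m => {m} ×ˢ Set.Ico (N' m) (M' m)) fun m _ =>
    (Set.finite_singleton m).prod (Set.finite_Ico _ _)).subset ?_
  rintro ⟨m, m'⟩ hm
  rw [Function.mem_support] at hm
  have e0 : toFun τ n (0 : Gam τ n) y = 0 := by simp
  refine Set.mem_biUnion (x := m) ⟨?_, ?_⟩ ⟨rfl, ?_, ?_⟩
  · by_contra h
    exact hm (by simp only [hN m (not_le.mp h), map_zero, e0, zero_smul])
  · by_contra h
    exact hm (by simp only [hM m (not_lt.mp h), smul_zero])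
  · by_contra h
    exact hm (by simp only [hN' m m' (not_le.mp h), e0, zero_smul])
  · by_contra h
    exact hm (by simp only [hM' m m' (not_lt.mp h), smul_zero])

lemma evalAt_resTerm_resTerm (τ : UpperHalfPlane) (A : VertexAlgebra V) {n : ℕ} {i j : Fin (n + 2)}
    (hij : i ≤ j) {i' j' : Fin (n + 1)} (hij' : i' ≤ j') (f : Gam τ (n + 2)) (a : Fin (n + 3) → V)
    (y : Fin n → ℂ) :
    evalAt τ _ y (resTerm τ A hij' (resTerm τ A hij (f ⊗ₜ PiTensorProduct.tprod ℂ a))) =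
      ∑ᶠ p : ℤ × ℤ, toFun τ n (lcoeff τ hij' p.2 (lcoeff τ hij p.1 f)) y •
        PiTensorProduct.tprod ℂ (merge A i' j' p.2 (merge A i j p.1 a)) := by
  have hψ1 : ∃ M : ℤ, ∀ m, M ≤ m → ∀ m',
      PiTensorProduct.tprod ℂ (merge A i' j' m' (merge A i j m a)) = 0 := by
    obtain ⟨M, hM⟩ := exists_mergeMap_eq_zero A hij (PiTensorProduct.tprod ℂ a)
    refine ⟨M, fun m hm m' => ?_⟩
    rw [← mergeMap_tprod A hij', ← mergeMap_tprod A hij, hM m hm, map_zero]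
  have hψ2 : ∀ m, ∃ M : ℤ, ∀ m', M ≤ m' →
      PiTensorProduct.tprod ℂ (merge A i' j' m' (merge A i j m a)) = 0 := by
    intro m
    obtain ⟨M, hM⟩ := exists_mergeMap_eq_zero A hij' (PiTensorProduct.tprod ℂ (merge A i j m a))
    refine ⟨M, fun m' hm => ?_⟩
    rw [← mergeMap_tprod A hij', hM m' hm]
  rw [finsum_curry _ (finite_support_lcoeff_lcoeff_smul τ hij hij' f y hψ1 hψ2), resTerm_tmul]
  refine ((evalAt τ _ y ∘ₗ resTerm τ A hij').toAddMonoidHom.map_finsum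
    (finite_support_lcoeff_tmul τ A hij f _)).trans (finsum_congr fun m => ?_)
  simp only [LinearMap.toAddMonoidHom_coe, LinearMap.comp_apply, resTerm_tmul]
  refine ((evalAt τ _ y).toAddMonoidHom.map_finsum
    (finite_support_lcoeff_tmul τ A hij' _ _)).trans (finsum_congr fun m' => ?_)
  simp only [LinearMap.toAddMonoidHom_coe, evalAt_tmul, mergeMap_tprod]

lemma merge_insertNth (A : VertexAlgebra V) {n : ℕ} {i j : Fin (n + 1)} (hij : i ≤ j) (m : ℤ)
    (α : V) (s : Fin (n + 1) → V) : merge A i j m (i.castSucc.insertNth α s : Fin (n + 2) → V) =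
      Function.update s j (A.prod m α (s j)) := by
  rw [merge_eq_update, Fin.removeNth_insertNth, Fin.insertNth_apply_same, ← succAbove_of_le hij,
    Fin.insertNth_apply_succAbove]

section Pairs

variable {n : ℕ} {p q c c' : Fin (n + 1)}

lemma castSucc_le_succAbove (hc : p ≤ c) : p.castSucc ≤ q.castSucc.succAbove c := by
  rcases lt_or_ge c q with h | h
  · rw [Fin.succAbove_castSucc_of_lt _ _ h]; exact Fin.castSucc_le_castSucc_iff.mpr hc
  · rw [Fin.succAbove_castSucc_of_le _ _ h]; exact (Fin.castSucc_lt_succ_iff.mpr hc).le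

lemma le_of_castSucc_le_succAbove (hpq : p ≤ q) (h : p.castSucc ≤ q.castSucc.succAbove c) : p ≤ c := by
  rcases lt_or_ge c q with h' | h'
  · rwa [Fin.succAbove_castSucc_of_lt _ _ h', Fin.castSucc_le_castSucc_iff] at h
  · exact hpq.trans h'

variable (τ : UpperHalfPlane) (A : VertexAlgebra V) (f : Gam τ (n + 2)) (α β : V) (r : Fin (n + 1) → V)
  {y : Fin n → ℂ}

/-- The iterated residue in which the point `p` approaches `c` first and the point `q` approaches `c'`
afterwards. -/
lemma evalAt_first_second (hc : p ≤ c) (hc' : q ≤ c') (hy : y ∈ conf τ n) :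
    evalAt τ _ y (resTerm τ A hc' (resTerm τ A (castSucc_le_succAbove (q := q) hc)
      (f ⊗ₜ PiTensorProduct.tprod ℂ (p.castSucc.castSucc.insertNth α
        (q.castSucc.insertNth β r : Fin (n + 2) → V) : Fin (n + 3) → V)))) =
    ∑ᶠ m : ℤ × ℤ, (lc m.2 fun v => lc m.1 fun u =>
        toFun τ (n + 2) f (ins₂ p q y (pts y c + u) (pts y c' + v))) •
      PiTensorProduct.tprod ℂ (Function.update (Function.update r c (A.prod m.1 α (r c))) c'
        (A.prod m.2 β (Function.update r c (A.prod m.1 α (r c)) c'))) := by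
  rw [evalAt_resTerm_resTerm]
  refine finsum_congr fun m => ?_
  rw [toFun_lcoeff_lcoeff τ _ hc' _ _ f hy, merge_insertNth A (castSucc_le_succAbove hc),
    Fin.insertNth_apply_succAbove, ← Fin.insertNth_update, merge_insertNth A hc']
  simp only [pts_insertNth, Fin.insertNth_apply_succAbove]
  rfl

/-- The iterated residue in which the point `q` approaches `c'` first and the point `p` approaches `c`
afterwards. -/
lemma evalAt_second_first (hpq : p ≤ q) (hc : p ≤ c) (hc' : q ≤ c') (hy : y ∈ conf τ n) :
    evalAt τ _ y (resTerm τ A hc (resTerm τ A (Fin.succ_le_succ_iff.mpr hc')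
      (f ⊗ₜ PiTensorProduct.tprod ℂ (p.castSucc.castSucc.insertNth α
        (q.castSucc.insertNth β r : Fin (n + 2) → V) : Fin (n + 3) → V)))) =
    ∑ᶠ m : ℤ × ℤ, (lc m.2 fun u => lc m.1 fun v =>
        toFun τ (n + 2) f (ins₂ p q y (pts y c + u) (pts y c' + v))) •
      PiTensorProduct.tprod ℂ (Function.update (Function.update r c' (A.prod m.1 β (r c'))) c
        (A.prod m.2 α (Function.update r c' (A.prod m.1 β (r c')) c))) := by
  have hs : p.castSucc.succAbove c' = c'.succ := Fin.succAbove_castSucc_of_le _ _ (hpq.trans hc')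
  have ha : (p.castSucc.castSucc.insertNth α
        (q.castSucc.insertNth β r : Fin (n + 2) → V) : Fin (n + 3) → V) =
      q.succ.castSucc.insertNth β (p.castSucc.insertNth α r : Fin (n + 2) → V) :=
    insertNth_insertNth (Fin.castSucc_le_castSucc_iff.mpr hpq) α β r
  rw [evalAt_resTerm_resTerm]
  refine finsum_congr fun m => ?_
  rw [toFun_lcoeff_lcoeff τ _ hc _ _ f hy, ha, merge_insertNth A (Fin.succ_le_succ_iff.mpr hc'), ← hs,
    Fin.insertNth_apply_succAbove, ← Fin.insertNth_update, merge_insertNth A hc]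
  simp only [pts_insertNth, Fin.insertNth_apply_succAbove, ← insertNth_insertNth hpq]
  rfl

/-- The iterated residue in which the point `p` approaches the point `q` first and the resulting
point approaches `c'` afterwards. -/
lemma evalAt_both (hpq : p ≤ q) (hc' : q ≤ c') (hy : y ∈ conf τ n) :
    evalAt τ _ y (resTerm τ A hc' (resTerm τ A (Fin.castSucc_le_castSucc_iff.mpr hpq)
      (f ⊗ₜ PiTensorProduct.tprod ℂ (p.castSucc.castSucc.insertNth α
        (q.castSucc.insertNth β r : Fin (n + 2) → V) : Fin (n + 3) → V)))) =
    ∑ᶠ m : ℤ × ℤ, (lc m.2 fun v => lc m.1 fun w =>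
        toFun τ (n + 2) f (ins₂ p q y (pts y c' + (v + w)) (pts y c' + v))) •
      PiTensorProduct.tprod ℂ (Function.update r c' (A.prod m.2 (A.prod m.1 α β) (r c'))) := by
  rw [evalAt_resTerm_resTerm]
  refine finsum_congr fun m => ?_
  rw [toFun_lcoeff_lcoeff τ _ hc' _ _ f hy, merge_insertNth A (Fin.castSucc_le_castSucc_iff.mpr hpq),
    Fin.insertNth_apply_same, Fin.update_insertNth, merge_insertNth A hc']
  simp only [pts_insertNth, Fin.insertNth_apply_same, add_assoc]
  rfl

end Pairs

/-! ### The square of the differential -/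

/-- `resTerm` extended by zero to all pairs of labels. -/
def resTot (τ : UpperHalfPlane) (A : VertexAlgebra V) {n : ℕ} (i j : Fin (n + 1)) :
    PreChain τ V (n + 1) →ₗ[ℂ] PreChain τ V n :=
  if hij : i ≤ j then resTerm τ A hij else 0

lemma resTot_of_le (τ : UpperHalfPlane) (A : VertexAlgebra V) {n : ℕ} {i j : Fin (n + 1)}
    (hij : i ≤ j) : resTot τ A i j = resTerm τ A hij := dif_pos hij

lemma resTot_of_not_le (τ : UpperHalfPlane) (A : VertexAlgebra V) {n : ℕ} {i j : Fin (n + 1)}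
    (hij : ¬i ≤ j) : resTot τ A i j = 0 := dif_neg hij

lemma preD_eq_sum_resTot (τ : UpperHalfPlane) (A : VertexAlgebra V) (n : ℕ)
    (x : PreChain τ V (n + 1)) : preD τ A n x =
      ∑ i : Fin (n + 1), (-1 : ℂ) ^ (n - (i : ℕ)) • ∑ j : Fin (n + 1), resTot τ A i j x := by
  simp only [preD, LinearMap.sum_apply, Finset.smul_sum]
  refine Finset.sum_congr rfl fun i _ => Finset.sum_congr rfl fun j _ => ?_
  rw [resTot]
  split_ifs <;> simp

/-- It suffices to compare maps on pure tensors, written with two factors set apart, and at points of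
the configuration space. -/
lemma preChain_induction {τ : UpperHalfPlane} {n : ℕ} {L L' : PreChain τ V (n + 2) →ₗ[ℂ] PreChain τ V n}
    (p q : Fin (n + 1))
    (h : ∀ (f : Gam τ (n + 2)) (α β : V) (r : Fin (n + 1) → V), ∀ y ∈ conf τ n,
      evalAt τ _ y (L (f ⊗ₜ PiTensorProduct.tprod ℂ (p.castSucc.castSucc.insertNth α
        (q.castSucc.insertNth β r : Fin (n + 2) → V) : Fin (n + 3) → V))) =
      evalAt τ _ y (L' (f ⊗ₜ PiTensorProduct.tprod ℂ (p.castSucc.castSucc.insertNth α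
        (q.castSucc.insertNth β r : Fin (n + 2) → V) : Fin (n + 3) → V)))) : L = L' := by
  refine TensorProduct.ext' fun f z => ?_
  induction z using PiTensorProduct.induction_on with
  | smul_tprod c a =>
    rw [TensorProduct.tmul_smul, map_smul, map_smul]
    congr 1
    rw [← Fin.insertNth_self_removeNth p.castSucc.castSucc a,
      ← Fin.insertNth_self_removeNth q.castSucc (p.castSucc.castSucc.removeNth a)]
    exact eq_of_evalAt_eq fun y hy => h f _ _ _ y hy
  | add z z' hz hz' => rw [TensorProduct.tmul_add, map_add, map_add, hz, hz']

section Pairs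

variable (τ : UpperHalfPlane) (A : VertexAlgebra V) {n : ℕ} {p q c c' : Fin (n + 1)}

/-- Residues at different points commute. -/
lemma resTerm_comm (hpq : p ≤ q) (hc : p ≤ c) (hc' : q ≤ c') (hcc : c ≠ c') :
    resTerm τ A hc' ∘ₗ resTerm τ A (castSucc_le_succAbove (q := q) hc) =
      resTerm τ A hc ∘ₗ resTerm τ A (Fin.succ_le_succ_iff.mpr hc') := by
  refine preChain_induction p q fun f α β r y hy => ?_
  obtain ⟨N, g, hg, hF⟩ := exists_form_ins₂ (p := p) (q := q) (y := y) (toFun_mem τ (n + 2) f)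
    (pts y c) (pts y c')
  simp only [locEq_ins₂_of_ne hpq hc hc' hcc hy] at hF
  have hF' : ∀ᶠ x in 𝓝 (0 : ℂ × ℂ), x.1 ≠ 0 → x.2 ≠ 0 →
      toFun τ (n + 2) f (ins₂ p q y (pts y c + x.1) (pts y c' + x.2)) = g x / (x.1 * x.2) ^ N := by
    filter_upwards [hF] with x hx h1 h2 using hx (mul_ne_zero h1 h2)
  have hlc := fun m m' => lc_lc_comm
    (F := fun u v => toFun τ (n + 2) f (ins₂ p q y (pts y c + u) (pts y c' + v))) hg hF' m m'
  rw [LinearMap.comp_apply, LinearMap.comp_apply, evalAt_first_second τ A f α β r hc hc' hy,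
    evalAt_second_first τ A f α β r hpq hc hc' hy, ← finsum_comp_equiv (Equiv.prodComm ℤ ℤ)]
  refine finsum_congr fun m => ?_
  simp only [Equiv.prodComm_apply, Prod.fst_swap, Prod.snd_swap]
  rw [(hlc m.2 m.1).1, (hlc m.2 m.1).2, Function.update_of_ne hcc, Function.update_of_ne hcc.symm,
    Function.update_comm hcc]

/-- Residues at the same point satisfy the Borcherds identity. -/
lemma resTerm_borcherds (hpq : p ≤ q) (hc' : q ≤ c') :
    resTerm τ A hc' ∘ₗ resTerm τ A (castSucc_le_succAbove (q := q) (hpq.trans hc')) +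
        resTerm τ A hc' ∘ₗ resTerm τ A (Fin.castSucc_le_castSucc_iff.mpr hpq) =
      resTerm τ A (hpq.trans hc') ∘ₗ resTerm τ A (Fin.succ_le_succ_iff.mpr hc') := by
  refine preChain_induction p q fun f α β r y hy => ?_
  obtain ⟨N, g, hg, hF⟩ := exists_form_ins₂ (p := p) (q := q) (y := y) (toFun_mem τ (n + 2) f)
    (pts y c') (pts y c')
  simp only [locEq_ins₂_self hpq hc' hy] at hF
  set F : ℂ → ℂ → ℂ := fun u v => toFun τ (n + 2) f (ins₂ p q y (pts y c' + u) (pts y c' + v))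
    with hFdef
  have hF' : ∀ᶠ x in 𝓝 (0 : ℂ × ℂ), x.1 ≠ 0 → x.2 ≠ 0 → x.1 - x.2 ≠ 0 →
      F x.1 x.2 = g x / (x.1 * x.2 * (x.1 - x.2)) ^ N := by
    filter_upwards [hF] with x hx h1 h2 h3 using hx (mul_ne_zero (mul_ne_zero h1 h2) h3)
  have key := finsum_lc_borcherds A α β (r c') hg hF'
  -- The double sums in the identity for `a, b, c` are finite, so it can be inserted into a tensor.
  let L : V →ₗ[ℂ] TP V (n + 1) := (PiTensorProduct.tprod ℂ).toLinearMap r c'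
  have hL : ∀ x, L x = PiTensorProduct.tprod ℂ (Function.update r c' x) := fun x => rfl
  have push : ∀ {i j : Fin (n + 2)} (hij : i ≤ j) {i' j' : Fin (n + 1)} (hij' : i' ≤ j')
      (C : ℤ × ℤ → ℂ) (ψ : ℤ → ℤ → V),
      (∀ m, C m = toFun τ n (lcoeff τ hij' m.2 (lcoeff τ hij m.1 f)) y) →
      (∃ M : ℤ, ∀ m, M ≤ m → ∀ m', ψ m m' = 0) → (∀ m, ∃ M : ℤ, ∀ m', M ≤ m' → ψ m m' = 0) →
      ∑ᶠ m : ℤ × ℤ, C m • L (ψ m.1 m.2) = L (∑ᶠ m : ℤ × ℤ, C m • ψ m.1 m.2) := by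
    intro i j hij i' j' hij' C ψ hC h1 h2
    have hfin := finite_support_lcoeff_lcoeff_smul τ hij hij' f y h1 h2
    simp only [← hC] at hfin
    refine Eq.symm ((L.toAddMonoidHom.map_finsum hfin).trans (finsum_congr fun m => ?_))
    simp
  rw [LinearMap.add_apply, map_add, LinearMap.comp_apply, LinearMap.comp_apply, LinearMap.comp_apply,
    evalAt_first_second τ A f α β r (hpq.trans hc') hc' hy, evalAt_both τ A f α β r hpq hc' hy,
    evalAt_second_first τ A f α β r hpq (hpq.trans hc') hc' hy]
  simp only [Function.update_self, Function.update_idem, ← hL]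
  have e1 := push (castSucc_le_succAbove (q := q) (hpq.trans hc')) hc'
    (fun m => lc m.2 fun v => lc m.1 fun u => F u v) (fun m m' => A.prod m' β (A.prod m α (r c')))
    (fun m => by
      rw [toFun_lcoeff_lcoeff τ _ hc' _ _ f hy]
      simp only [pts_insertNth, Fin.insertNth_apply_succAbove]
      rfl)
    (by
      obtain ⟨M, hM⟩ := A.field α (r c')
      exact ⟨M, fun m hm m' => by rw [hM m hm, map_zero]⟩)
    (fun m => A.field β _)
  have e2 := push (Fin.castSucc_le_castSucc_iff.mpr hpq) hc'
    (fun m => lc m.2 fun v => lc m.1 fun w => F (v + w) v)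
    (fun m m' => A.prod m' (A.prod m α β) (r c'))
    (fun m => by
      rw [toFun_lcoeff_lcoeff τ _ hc' _ _ f hy]
      simp only [pts_insertNth, Fin.insertNth_apply_same, add_assoc]
      rfl)
    (by
      obtain ⟨M, hM⟩ := A.field α β
      exact ⟨M, fun m hm m' => by rw [hM m hm, map_zero, LinearMap.zero_apply]⟩)
    (fun m => A.field _ _)
  have e3 := push (Fin.succ_le_succ_iff.mpr hc') (hpq.trans hc')
    (fun m => lc m.2 fun u => lc m.1 fun v => F u v) (fun m m' => A.prod m' α (A.prod m β (r c')))
    (fun m => by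
      have hs : p.castSucc.succAbove c' = c'.succ := Fin.succAbove_castSucc_of_le _ _ (hpq.trans hc')
      rw [toFun_lcoeff_lcoeff τ _ (hpq.trans hc') _ _ f hy]
      simp only [pts_insertNth, ← hs, Fin.insertNth_apply_succAbove, ← insertNth_insertNth hpq]
      rfl)
    (by
      obtain ⟨M, hM⟩ := A.field β (r c')
      exact ⟨M, fun m hm m' => by rw [hM m hm, map_zero]⟩)
    (fun m => A.field α _)
  rw [← key, map_add, ← e1, ← e2] at e3
  exact e3.symm

end Pairs

/-- The sum over all targets of the iterated residues does not depend on which of the two points is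
removed first. -/
lemma sum_resTot_eq (τ : UpperHalfPlane) (A : VertexAlgebra V) {n : ℕ} {p q : Fin (n + 1)}
    (hpq : p ≤ q) (x : PreChain τ V (n + 2)) :
    ∑ c', ∑ j, resTot τ A q c' (resTot τ A p.castSucc j x) =
      ∑ c, ∑ j, resTot τ A p c (resTot τ A q.succ j x) := by
  have hleft : ∀ c', ∑ j, resTot τ A q c' (resTot τ A p.castSucc j x) =
      resTot τ A q c' (resTot τ A p.castSucc q.castSucc x) +
        ∑ c, resTot τ A q c' (resTot τ A p.castSucc (q.castSucc.succAbove c) x) := fun c' =>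
    Fin.sum_univ_succAbove _ q.castSucc
  have hright : ∀ c, ∑ j, resTot τ A p c (resTot τ A q.succ j x) =
      ∑ c' : Fin (n + 1), resTot τ A p c (resTot τ A q.succ c'.succ x) := fun c => by
    rw [Fin.sum_univ_succ, resTot_of_not_le τ A (i := q.succ) (j := 0) (by simp)]
    simp
  simp only [hleft, hright]
  rw [Finset.sum_comm (f := fun c c' : Fin (n + 1) => resTot τ A p c (resTot τ A q.succ c'.succ x))]
  refine Finset.sum_congr rfl fun c' _ => ?_
  by_cases hc' : q ≤ c'
  · have hne : ∀ c ≠ c', resTot τ A q c' (resTot τ A p.castSucc (q.castSucc.succAbove c) x) =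
        resTot τ A p c (resTot τ A q.succ c'.succ x) := by
      intro c hcc
      by_cases hc : p ≤ c
      · rw [resTot_of_le τ A hc', resTot_of_le τ A hc, resTot_of_le τ A (castSucc_le_succAbove hc),
          resTot_of_le τ A (Fin.succ_le_succ_iff.mpr hc')]
        exact LinearMap.congr_fun (resTerm_comm τ A hpq hc hc' hcc) x
      · rw [resTot_of_not_le τ A hc,
          resTot_of_not_le τ A fun h => hc (le_of_castSucc_le_succAbove hpq h)]
        simp
    have hself : resTot τ A q c' (resTot τ A p.castSucc (q.castSucc.succAbove c') x) +
        resTot τ A q c' (resTot τ A p.castSucc q.castSucc x) =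
        resTot τ A p c' (resTot τ A q.succ c'.succ x) := by
      rw [resTot_of_le τ A hc', resTot_of_le τ A (hpq.trans hc'),
        resTot_of_le τ A (castSucc_le_succAbove (hpq.trans hc')),
        resTot_of_le τ A (Fin.castSucc_le_castSucc_iff.mpr hpq),
        resTot_of_le τ A (Fin.succ_le_succ_iff.mpr hc')]
      exact LinearMap.congr_fun (resTerm_borcherds τ A hpq hc') x
    rw [← Finset.add_sum_erase _ _ (Finset.mem_univ c'), ← Finset.add_sum_erase _ _ (Finset.mem_univ c'),
      ← add_assoc, add_comm (resTot τ A q c' (resTot τ A p.castSucc q.castSucc x)), hself]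
    congr 1
    exact Finset.sum_congr rfl fun c hc => hne c (Finset.ne_of_mem_erase hc)
  · have h : ¬q.succ ≤ c'.succ := fun h => hc' (Fin.succ_le_succ_iff.mp h)
    simp [resTot_of_not_le τ A hc', resTot_of_not_le τ A h]

lemma sum_eq_sum_castSucc_add_sum_succ {M : Type*} [AddCommMonoid M] {n : ℕ} (g : Fin (n + 2) → M)
    (i : Fin (n + 1)) : ∑ k, g k = (∑ p : Fin (n + 1), if p ≤ i then g p.castSucc else 0) +
      ∑ q : Fin (n + 1), if i ≤ q then g q.succ else 0 := by
  have h : g i.castSucc = ∑ p : Fin (n + 1), if p = i then g p.castSucc else 0 := by simp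
  rw [Fin.sum_univ_succAbove _ i.castSucc, h, ← Finset.sum_add_distrib, ← Finset.sum_add_distrib]
  refine Finset.sum_congr rfl fun p _ => ?_
  rcases lt_trichotomy p i with hp | rfl | hp
  · rw [Fin.succAbove_castSucc_of_lt _ _ hp, if_neg hp.ne, if_pos hp.le, if_neg hp.not_ge, zero_add,
      add_zero]
  · rw [Fin.succAbove_castSucc_self, if_pos rfl, if_pos le_rfl, if_pos le_rfl]
  · rw [Fin.succAbove_castSucc_of_le _ _ hp.le, if_neg hp.ne', if_neg hp.not_ge, if_pos hp.le]

/-- The iterated residues cancel in pairs: the terms in which `x_p` is removed before `x_q` against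
those in which it is removed after `x_q`. -/
theorem preD_preD (τ : UpperHalfPlane) (A : VertexAlgebra V) (n : ℕ) (x : PreChain τ V (n + 2)) :
    preD τ A n (preD τ A (n + 1) x) = 0 := by
  set Φ : Fin (n + 2) → Fin (n + 1) → PreChain τ V n := fun i i' =>
    ∑ c', ∑ j, resTot τ A i' c' (resTot τ A i j x) with hΦ
  have h : preD τ A n (preD τ A (n + 1) x) = ∑ i' : Fin (n + 1), ∑ i : Fin (n + 2),
      ((-1 : ℂ) ^ (n - (i' : ℕ)) * (-1) ^ (n + 1 - (i : ℕ))) • Φ i i' := by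
    rw [preD_eq_sum_resTot, preD_eq_sum_resTot]
    refine Finset.sum_congr rfl fun i' _ => ?_
    simp only [map_sum, map_smul, hΦ, mul_smul, Finset.smul_sum]
    exact Finset.sum_comm
  rw [h]
  simp only [fun i' : Fin (n + 1) => sum_eq_sum_castSucc_add_sum_succ
    (fun i => ((-1 : ℂ) ^ (n - (i' : ℕ)) * (-1) ^ (n + 1 - (i : ℕ))) • Φ i i') i']
  rw [Finset.sum_add_distrib, Finset.sum_comm (f := fun i' q : Fin (n + 1) => if i' ≤ q then
    ((-1 : ℂ) ^ (n - (i' : ℕ)) * (-1) ^ (n + 1 - (q.succ : ℕ))) • Φ q.succ i' else 0),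
    ← Finset.sum_add_distrib]
  refine Finset.sum_eq_zero fun q _ => ?_
  rw [← Finset.sum_add_distrib]
  refine Finset.sum_eq_zero fun p _ => ?_
  split_ifs with hpq
  · have hp : n + 1 - (p : ℕ) = (n - p) + 1 := by omega
    have hq : n + 1 - ((q : ℕ) + 1) = n - q := by omega
    rw [show Φ p.castSucc q = Φ q.succ p from sum_resTot_eq τ A hpq x, ← add_smul, Fin.val_castSucc,
      Fin.val_succ, hp, hq, pow_succ]
    rw [show (-1 : ℂ) ^ (n - (q : ℕ)) * ((-1) ^ (n - (p : ℕ)) * -1) +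
      (-1) ^ (n - (p : ℕ)) * (-1) ^ (n - (q : ℕ)) = 0 by ring, zero_smul]
  · rw [add_zero]

lemma chainD_comp_chainD (τ : UpperHalfPlane) (A : VertexAlgebra V) (n : ℕ) :
    chainD τ A n ∘ₗ chainD τ A (n + 1) = 0 := by
  refine LinearMap.ext fun x => ?_
  obtain ⟨x, rfl⟩ := Submodule.Quotient.mk_surjective _ x
  rw [LinearMap.comp_apply, chainD_mk, chainD_mk, preD_preD]
  rfl

/-! ### Partial fractions -/

/-- A high power of a sum lies in the ideal generated by the `N + 1`-st powers of its terms. -/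
lemma exists_sum_pow_eq {σ : Type*} (s : Finset σ) (N : ℕ) : ∃ q : σ → MvPolynomial σ ℂ, ∀ z : σ → ℂ,
    (∑ i ∈ s, z i) ^ (s.card * N + 1) = ∑ i ∈ s, MvPolynomial.aeval z (q i) * z i ^ (N + 1) := by
  have h := Ideal.sum_pow_mem_span_pow s (fun i => (MvPolynomial.X i : MvPolynomial σ ℂ)) N
  obtain ⟨q, hq⟩ := (Submodule.mem_span_image_finset_iff_exists_fun' _).mp h
  refine ⟨q, fun z => ?_⟩
  have h2 := congrArg (MvPolynomial.aeval z) hq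
  simpa using h2.symm

/-- The linear form `x_i - x_j` cutting out a divisor. -/
def divForm {n : ℕ} (k : DivIdx n) : Module.Dual ℂ (Fin n → ℂ) where
  toFun := divFun k
  map_add' := divFun_add k
  map_smul' := divFun_smul k

lemma divFun_sub {n : ℕ} (k : DivIdx n) (x P : Fin n → ℂ) :
    divFun k x - divFun k P = divForm k (x - P) := ((divForm k).map_sub x P).symm

/-- More than `n` hyperplanes through a point of `ℂ^n` are linearly dependent. -/
lemma exists_relation {n : ℕ} {S : Finset (DivIdx n)} (hS : n < S.card) :
    ∃ k₀ ∈ S, ∃ b : DivIdx n → ℂ, ∀ x P : Fin n → ℂ, divFun k₀ x - divFun k₀ P =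
      ∑ k ∈ S.erase k₀, b k * (divFun k x - divFun k P) := by
  have hdep : ¬LinearIndepOn ℂ (divForm (n := n)) (S : Set (DivIdx n)) := by
    intro h
    have h1 := LinearIndependent.fintype_card_le_finrank h
    rw [Subspace.dual_finrank_eq, Module.finrank_fin_fun] at h1
    simp only [Finset.coe_sort_coe, Fintype.card_coe] at h1
    omega
  rw [linearIndepOn_finset_iff] at hdep
  push Not at hdep
  obtain ⟨c, hc, k₀, hk₀, hne⟩ := hdep
  refine ⟨k₀, hk₀, fun k => -(c k / c k₀), fun x P => ?_⟩
  have h1 := LinearMap.congr_fun hc (x - P)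
  rw [LinearMap.sum_apply, ← Finset.add_sum_erase _ _ hk₀] at h1
  simp only [LinearMap.smul_apply, smul_eq_mul, LinearMap.zero_apply, ← divFun_sub] at h1
  rw [eq_neg_of_add_eq_zero_left h1 |> (eq_div_of_mul_eq hne <| (mul_comm _ _).trans ·),
    neg_div, Finset.sum_div, ← Finset.sum_neg_distrib]
  refine Finset.sum_congr rfl fun k _ => ?_
  ring

lemma cancel_pole {u v w : ℂ} (hu : u ≠ 0) (hv : v ≠ 0) (hw : w ≠ 0) (g a b : ℂ) (N M : ℕ) :
    g * (a * (b * v) ^ (N + 1)) / (u ^ M * (u * (v * w)) ^ N) =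
      g * (a * b ^ (N + 1) * v) * w ^ M / (u * w) ^ (N + M) := by
  rw [div_eq_div_iff (mul_ne_zero (pow_ne_zero _ hu) (pow_ne_zero _ (mul_ne_zero hu (mul_ne_zero hv hw))))
    (pow_ne_zero _ (mul_ne_zero hu hw))]
  ring

/-- Partial fractions: an induction on the number `s` of divisors in the denominator, which drops as
long as it exceeds `n`. -/
lemma div_locEq_mem_locG (τ : UpperHalfPlane) {n : ℕ} (P : Fin n → ℂ) (s : ℕ) :
    ∀ S ⊆ through τ P, S.card = s → ∀ (N : ℕ) (g : (Fin n → ℂ) → ℂ), AnalyticAt ℂ g P →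
      (fun x => g x / locEq P S x ^ N) ∈ locG τ P n := by
  classical
  induction s with
  | zero =>
    intro S hS hs N g hg
    exact div_mem_locG hg hS (by omega) N
  | succ s ih =>
    intro S hS hs N g hg
    rcases le_or_gt S.card n with hle | hlt
    · exact div_mem_locG hg hS (by exact_mod_cast hle) N
    obtain ⟨k₀, hk₀, b, hb⟩ := exists_relation hlt
    obtain ⟨q, hq⟩ := exists_sum_pow_eq (S.erase k₀) N
    set M := (S.erase k₀).card * N + 1 with hM
    set l : DivIdx n → (Fin n → ℂ) → ℂ := fun k x => divFun k x - divFun k P with hl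
    have hla : ∀ k, AnalyticAt ℂ (l k) P := fun k => (analyticAt_divFun k P).sub analyticAt_const
    -- The `k`-th term of the expansion of `l k₀ ^ M` cancels the pole along the divisor `k`.
    set G : DivIdx n → (Fin n → ℂ) → ℂ := fun k x => g x *
      (MvPolynomial.aeval (fun i => b i * l i x) (q k) * b k ^ (N + 1) * l k x) *
      locEq P ((S.erase k₀).erase k) x ^ M with hG
    have hGa : ∀ k, AnalyticAt ℂ (G k) P := fun k =>
      (hg.mul (((AnalyticAt.aeval_mvPolynomial (fun i => analyticAt_const.mul (hla i)) (q k)).mul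
        analyticAt_const).mul (hla k))).mul ((analyticAt_locEq P _ P).pow M)
    have hmem : ∀ k ∈ S.erase k₀, (fun x => G k x / locEq P (S.erase k) x ^ (N + M)) ∈ locG τ P n := by
      intro k hk
      refine ih _ ((Finset.erase_subset _ _).trans hS) ?_ _ _ (hGa k)
      rw [Finset.card_erase_of_mem (Finset.mem_of_mem_erase hk), hs]
      rfl
    refine locG_congr (Filter.Eventually.of_forall fun x hx => ?_) (Submodule.sum_mem _ hmem)
    have hne : ∀ S' ⊆ S, locEq P S' x ≠ 0 := fun S' h => locEq_ne_zero (h.trans hS) hx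
    have hsplit : ∀ S' : Finset (DivIdx n), ∀ k ∈ S', locEq P S' x = l k x * locEq P (S'.erase k) x :=
      fun S' k hk => (Finset.mul_prod_erase S' (fun k => divFun k x - divFun k P) hk).symm
    have hpow : l k₀ x ^ M = ∑ k ∈ S.erase k₀,
        MvPolynomial.aeval (fun i => b i * l i x) (q k) * (b k * l k x) ^ (N + 1) := by
      rw [← hq]
      exact congrArg (· ^ M) (hb x P)
    have h0 : l k₀ x ≠ 0 := fun h => hne S subset_rfl (by rw [hsplit S k₀ hk₀, h, zero_mul])
    rw [Finset.sum_apply]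
    have e1 : g x / locEq P S x ^ N = g x * l k₀ x ^ M / (l k₀ x ^ M * locEq P S x ^ N) := by
      field_simp
    rw [e1, hpow, Finset.mul_sum, Finset.sum_div, ← hpow]
    refine Finset.sum_congr rfl fun k hk => ?_
    have hk0 : k₀ ∈ S.erase k :=
      Finset.mem_erase.mpr ⟨(Finset.ne_of_mem_erase hk).symm, hk₀⟩
    have hR := hne ((S.erase k₀).erase k) ((Finset.erase_subset _ _).trans (Finset.erase_subset _ _))
    have hlk : l k x ≠ 0 := fun h => hne (S.erase k₀) (Finset.erase_subset _ _)
      (by rw [hsplit _ k hk, h, zero_mul])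
    simp only [hG]
    rw [hsplit S k₀ hk₀, hsplit _ k hk, hsplit _ k₀ hk0, Finset.erase_right_comm (a := k) (b := k₀)]
    exact cancel_pole h0 hlk hR _ _ _ N M

/-- A function with poles along arbitrarily many hyperplanes is, locally, a sum of functions each of
which has poles along at most `n` of them. -/
lemma GGam_zero (τ : UpperHalfPlane) (n : ℕ) : GGam τ n 0 = ⊤ := by
  refine eq_top_iff.mpr fun f _ => mem_GGam_iff.mpr fun P => ?_
  obtain ⟨-, -, N, h3⟩ := toFun_mem τ n f
  obtain ⟨g, hg, hfg⟩ := h3 P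
  rw [zero_add]
  exact locG_congr hfg (div_locEq_mem_locG τ P _ _ subset_rfl rfl N g hg)

lemma GGam_mono (τ : UpperHalfPlane) (n : ℕ) : Monotone (GGam τ n) := fun _ _ h _ hf =>
  mem_GGam_iff.mpr fun P => locG_mono (by omega) (mem_GGam_iff.mp hf P)

lemma GGam_of_nonneg (τ : UpperHalfPlane) (n : ℕ) {s : ℤ} (hs : 0 ≤ s) : GGam τ n s = ⊤ :=
  eq_top_iff.mpr ((GGam_zero τ n).ge.trans (GGam_mono τ n hs))

/-- No set of divisors has fewer than zero elements, so no terms are allowed. -/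
lemma GGam_of_lt (τ : UpperHalfPlane) (n : ℕ) {s : ℤ} (hs : s < -n) : GGam τ n s = ⊥ := by
  refine eq_bot_iff.mpr fun f hf => (Submodule.mem_bot ℂ).mpr (Gam.ext_conf fun y hy => ?_)
  obtain ⟨N, g, -, hfg⟩ := hf y
  rw [hfg.self_of_nhds hy, Finset.sum_eq_zero]
  · simp
  · intro S hS
    have := (Finset.mem_filter.mp hS).2
    omega

/-! ### The differential and the filtrations -/

lemma mergeMap_mem_GTP (A : VertexAlgebra V) {G : ℤ → Submodule ℂ V} {n : ℕ} {i j : Fin (n + 1)}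
    (hij : i ≤ j) {m ε : ℤ} (hm : ∀ p q x y, x ∈ G p → y ∈ G q → A.prod m x y ∈ G (p + q - ε))
    {r : ℤ} {z : TP V (n + 2)} (hz : z ∈ GTP G (n + 2) r) :
    mergeMap A hij m z ∈ GTP G (n + 1) (r - ε) := by
  suffices h : GTP G (n + 2) r ≤ (GTP G (n + 1) (r - ε)).comap (mergeMap A hij m) from h hz
  refine Submodule.span_le.mpr ?_
  rintro _ ⟨s, a, ha, hs, rfl⟩
  rw [SetLike.mem_coe, Submodule.mem_comap, mergeMap_tprod]
  refine Submodule.subset_span ⟨Function.update (i.castSucc.removeNth s) j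
    (s i.castSucc + s j.succ - ε), _, fun k => ?_, ?_, rfl⟩
  · by_cases hk : k = j
    · subst hk
      rw [merge_eq_update, Function.update_self, Function.update_self]
      exact hm _ _ _ _ (ha _) (ha _)
    · rw [merge_eq_update, Function.update_of_ne hk, Function.update_of_ne hk]
      exact ha _
  · have h1 : ∑ k, s k = s i.castSucc + (s j.succ +
        ∑ k ∈ Finset.univ.erase j, s (i.castSucc.succAbove k)) := by
      rw [Fin.sum_univ_succAbove s i.castSucc, ← Finset.add_sum_erase _ _ (Finset.mem_univ j),
        succAbove_of_le hij]
    have h2 : ∑ k ∈ Finset.univ.erase j, Function.update (i.castSucc.removeNth s) j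
        (s i.castSucc + s j.succ - ε) k = ∑ k ∈ Finset.univ.erase j, s (i.castSucc.succAbove k) :=
      Finset.sum_congr rfl fun k hk => Function.update_of_ne (Finset.ne_of_mem_erase hk) _ _
    rw [← Finset.add_sum_erase _ _ (Finset.mem_univ j), Function.update_self, h2]
    omega

/-- The part `∑ G_p Γ_n ⊗ G_r V^{⊗ n+1}`, over `p ≥ q` and `p + r ≤ t`, of `G_t C̃_n`. -/
def bigPre (τ : UpperHalfPlane) (G : ℤ → Submodule ℂ V) (n : ℕ) (t q : ℤ) :
    Submodule ℂ (PreChain τ V n) :=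
  Submodule.span ℂ {z | ∃ (p r : ℤ) (f : Gam τ n) (a : TP V (n + 1)), q ≤ p ∧ p + r ≤ t ∧
    f ∈ GGam τ n p ∧ a ∈ GTP G (n + 1) r ∧ z = f ⊗ₜ a}

lemma tmul_mem_bigPre {τ : UpperHalfPlane} {G : ℤ → Submodule ℂ V} {n : ℕ} {t q p r : ℤ}
    {f : Gam τ n} {a : TP V (n + 1)} (hp : q ≤ p) (ht : p + r ≤ t) (hf : f ∈ GGam τ n p)
    (ha : a ∈ GTP G (n + 1) r) : f ⊗ₜ[ℂ] a ∈ bigPre τ G n t q :=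
  Submodule.subset_span ⟨p, r, f, a, hp, ht, hf, ha, rfl⟩

lemma GPre_mono (τ : UpperHalfPlane) (G : ℤ → Submodule ℂ V) (n : ℕ) : Monotone (GPre τ G n) :=
  fun _ _ h => iSup₂_mono fun _ _ => iSup_mono' fun h' => ⟨h'.trans h, le_rfl⟩

lemma bigPre_le_GPre (τ : UpperHalfPlane) (G : ℤ → Submodule ℂ V) (n : ℕ) (t q : ℤ) :
    bigPre τ G n t q ≤ GPre τ G n t := by
  refine Submodule.span_le.mpr ?_
  rintro _ ⟨p, r, f, a, -, ht, hf, ha, rfl⟩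
  exact GPre_mono τ G n ht (mk_mem_GPre τ G n p r f a hf ha)

lemma GPre_le_bigPre (τ : UpperHalfPlane) (G : ℤ → Submodule ℂ V) (n : ℕ) {t q : ℤ} (hq : q ≤ -n) :
    GPre τ G n t ≤ bigPre τ G n t q := by
  refine iSup₂_le fun s r => iSup_le fun h => Submodule.map₂_le.mpr fun f hf a ha => ?_
  rcases lt_or_ge s (-n) with hs | hs
  · rw [GGam_of_lt τ n hs, Submodule.mem_bot] at hf
    rw [hf, map_zero, LinearMap.zero_apply]
    exact zero_mem _
  · exact tmul_mem_bigPre (hq.trans hs) h hf ha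

/-- A nonnegative product raises the pole degree of the function by at most one and lowers the
degree of the tensor by one; a negative product raises neither. -/
lemma preD_mem_bigPre {τ : UpperHalfPlane} {A : VertexAlgebra V} {G : ℤ → Submodule ℂ V}
    (hG : IsGoodFiltration A G) {n : ℕ} {t q : ℤ} {x : PreChain τ V (n + 1)}
    (hx : x ∈ bigPre τ G (n + 1) t q) : preD τ A n x ∈ bigPre τ G n t q := by
  suffices h : bigPre τ G (n + 1) t q ≤ (bigPre τ G n t q).comap (preD τ A n) from h hx
  refine Submodule.span_le.mpr ?_
  rintro _ ⟨p, r, f, a, hp, ht, hf, ha, rfl⟩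
  refine preD_apply_mem (W := bigPre τ G n t q) fun i j hij => ?_
  rw [resTerm_tmul]
  refine finsum_induction (· ∈ bigPre τ G n t q) (zero_mem _) (fun _ _ h h' => add_mem h h') fun m => ?_
  rcases lt_or_ge m 0 with hm | hm
  · refine tmul_mem_bigPre (p := p) (r := r - 0) hp (by omega)
      (lcoeff_mem_GGam hij m (Or.inr ⟨hm, rfl⟩) hf) (mergeMap_mem_GTP A hij ?_ ha)
    intro p q x y hx hy
    rw [sub_zero]
    exact hG.prod_mem _ _ _ _ _ hx hy
  · exact tmul_mem_bigPre (p := p + 1) (r := r - 1) (by omega) (by omega)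
      (lcoeff_mem_GGam hij m (Or.inl rfl) hf) (mergeMap_mem_GTP A hij
        (fun p q x y hx hy => hG.prod_mem_of_nonneg _ _ _ _ _ hx hy hm) ha)

lemma preD_mem_GPre {τ : UpperHalfPlane} {A : VertexAlgebra V} {G : ℤ → Submodule ℂ V}
    (hG : IsGoodFiltration A G) {n : ℕ} {t : ℤ} {x : PreChain τ V (n + 1)}
    (hx : x ∈ GPre τ G (n + 1) t) : preD τ A n x ∈ GPre τ G n t :=
  bigPre_le_GPre τ G n t _ (preD_mem_bigPre hG (GPre_le_bigPre τ G (n + 1) le_rfl hx))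

lemma GC_le_comap_chainD {τ : UpperHalfPlane} {A : VertexAlgebra V} {G : ℤ → Submodule ℂ V}
    (hG : IsGoodFiltration A G) (n : ℕ) (t : ℤ) :
    GC τ A G (n + 1) t ≤ (GC τ A G n t).comap (chainD τ A n) := by
  rintro _ ⟨x, hx, rfl⟩
  exact ⟨preD τ A n x, preD_mem_GPre hG hx, rfl⟩

/-! ### Classes in the associated graded complex -/

/-- The class in `gr_t C_n` of an element of `G_t C̃_n`. -/
def grClass (τ : UpperHalfPlane) (A : VertexAlgebra V) (G : ℤ → Submodule ℂ V) (n : ℕ) (t : ℤ) :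
    ↥(GPre τ G n t) →ₗ[ℂ] Gr (GC τ A G n) :=
  DirectSum.lof ℂ ℤ (GrPiece (GC τ A G n)) t ∘ₗ Submodule.mkQ _ ∘ₗ
    (rel τ A n).mkQ.restrict (Submodule.le_comap_map _ _)

lemma grClass_eq_zero (τ : UpperHalfPlane) (A : VertexAlgebra V) {G : ℤ → Submodule ℂ V} {n : ℕ} {t : ℤ}
    {x : PreChain τ V n} (hx : x ∈ GPre τ G n t) (hx' : x ∈ GPre τ G n (t - 1)) :
    grClass τ A G n t ⟨x, hx⟩ = 0 := by
  have h : (Submodule.Quotient.mk ⟨(rel τ A n).mkQ x, ⟨x, hx, rfl⟩⟩ : GrPiece (GC τ A G n) t) = 0 :=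
    (Submodule.Quotient.mk_eq_zero _).mpr ⟨x, hx', rfl⟩
  exact (congrArg (DirectSum.lof ℂ ℤ (GrPiece (GC τ A G n)) t) h).trans (map_zero _)

lemma piMap_tmul (τ : UpperHalfPlane) (A : VertexAlgebra V) (G : ℤ → Submodule ℂ V) (n : ℕ) (p r : ℤ)
    (f : GGam τ n p) (a : GTP G (n + 1) r) :
    piMap τ A G n (DirectSum.lof ℂ ℤ (GrPiece (GGam τ n)) p (Submodule.Quotient.mk f) ⊗ₜ
      DirectSum.lof ℂ ℤ (GrPiece (GTP G (n + 1))) r (Submodule.Quotient.mk a)) =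
    grClass τ A G n (p + r) ⟨f.1 ⊗ₜ a.1, mk_mem_GPre τ G n p r f a f.2 a.2⟩ := by
  simp only [piMap, grBilin, LinearMap.comp_apply, TensorProduct.lift.tmul, DirectSum.toModule_lof,
    LinearMap.flip_apply, LinearMap.compr₂_apply, grMap, DirectSum.lmap_lof]
  rfl

/-- `E^q` is spanned by the classes of pure tensors. -/
lemma E_le {τ : UpperHalfPlane} {A : VertexAlgebra V} {G : ℤ → Submodule ℂ V} {n : ℕ} {q : ℤ}
    {S : Submodule ℂ (Gr (GC τ A G n))}
    (h : ∀ (p r : ℤ) (f : GGam τ n p) (a : GTP G (n + 1) r), q ≤ p →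
      grClass τ A G n (p + r) ⟨f.1 ⊗ₜ a.1, mk_mem_GPre τ G n p r f a f.2 a.2⟩ ∈ S) :
    E τ A G n q ≤ S := by
  rw [E, Submodule.map_le_iff_le_comap]
  refine iSup₂_le fun p hp => ?_
  rintro _ ⟨x, rfl⟩
  rw [Submodule.mem_comap]
  induction x using TensorProduct.induction_on with
  | zero => simp
  | add x y hx hy => rw [map_add, map_add]; exact add_mem hx hy
  | tmul f z =>
    obtain ⟨f, rfl⟩ := Submodule.Quotient.mk_surjective _ f
    rw [TensorProduct.map_tmul, LinearMap.id_apply]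
    induction z using DirectSum.induction_on with
    | zero => simp
    | add x y hx hy => rw [TensorProduct.tmul_add, map_add]; exact add_mem hx hy
    | of r a =>
      obtain ⟨a, rfl⟩ := Submodule.Quotient.mk_surjective _ a
      have := h p r f a hp
      rw [← piMap_tmul] at this
      exact this

/-- The terms of total degree less than `t` do not contribute to the class in `gr_t`. -/
lemma grClass_mem_E {τ : UpperHalfPlane} {A : VertexAlgebra V} {G : ℤ → Submodule ℂ V} {n : ℕ} {t q : ℤ}
    {x : PreChain τ V n} (hx : x ∈ bigPre τ G n t q) (hx' : x ∈ GPre τ G n t) :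
    grClass τ A G n t ⟨x, hx'⟩ ∈ E τ A G n q := by
  have h : bigPre τ G n t q ≤ ((E τ A G n q).comap (grClass τ A G n t)).map (GPre τ G n t).subtype := by
    refine Submodule.span_le.mpr ?_
    rintro _ ⟨p, r, f, a, hp, ht, hf, ha, rfl⟩
    have hm : f ⊗ₜ a ∈ GPre τ G n (p + r) := mk_mem_GPre τ G n p r f a hf ha
    refine ⟨⟨f ⊗ₜ a, GPre_mono τ G n ht hm⟩, ?_, rfl⟩
    rw [SetLike.mem_coe, Submodule.mem_comap]
    rcases ht.lt_or_eq with hlt | rfl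
    · have hle : p + r ≤ t - 1 := by omega
      rw [grClass_eq_zero τ A _ (GPre_mono τ G n hle hm)]
      exact zero_mem _
    · have := piMap_tmul τ A G n p r ⟨f, hf⟩ ⟨a, ha⟩
      rw [← this]
      exact Submodule.mem_map_of_mem ((le_iSup₂_of_le p hp le_rfl :
        LinearMap.range (TensorProduct.map (DirectSum.lof ℂ ℤ (GrPiece (GGam τ n)) p)
          (LinearMap.id : Gr (GTP G (n + 1)) →ₗ[ℂ] Gr (GTP G (n + 1)))) ≤ _) ⟨_ ⊗ₜ _, rfl⟩)
  obtain ⟨x', h1, rfl⟩ := h hx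
  exact h1

lemma grMap_grClass {τ : UpperHalfPlane} {A : VertexAlgebra V} {G : ℤ → Submodule ℂ V}
    (hG : IsGoodFiltration A G) {n : ℕ} {t : ℤ} (x : GPre τ G (n + 1) t) :
    grMap _ _ (chainD τ A n) (GC_le_comap_chainD hG n) (grClass τ A G (n + 1) t x) =
      grClass τ A G n t ⟨preD τ A n x, preD_mem_GPre hG x.2⟩ := by
  simp only [grMap, grClass, LinearMap.comp_apply, DirectSum.lmap_lof]
  rfl

lemma E_le_comap_grMap {τ : UpperHalfPlane} {A : VertexAlgebra V} {G : ℤ → Submodule ℂ V}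
    (hG : IsGoodFiltration A G) (n : ℕ) (q : ℤ) : E τ A G (n + 1) q ≤
      (E τ A G n q).comap (grMap _ _ (chainD τ A n) (GC_le_comap_chainD hG n)) := by
  refine E_le fun p r f a hp => ?_
  rw [Submodule.mem_comap, grMap_grClass hG]
  exact grClass_mem_E (preD_mem_bigPre hG (tmul_mem_bigPre hp le_rfl f.2 a.2)) _

lemma antitone_E (τ : UpperHalfPlane) (A : VertexAlgebra V) (G : ℤ → Submodule ℂ V) (n : ℕ) :
    Antitone (E τ A G n) := fun _ _ h =>
  Submodule.map_mono (iSup_mono fun _ => iSup_mono' fun h' => ⟨h.trans h', le_rfl⟩)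

lemma E_neg_eq_top (τ : UpperHalfPlane) (A : VertexAlgebra V) (G : ℤ → Submodule ℂ V) (n : ℕ) :
    E τ A G n (-n) = ⊤ := by
  refine eq_top_iff.mpr fun z _ => ?_
  induction z using DirectSum.induction_on with
  | zero => exact zero_mem _
  | add x y hx hy => exact add_mem (hx trivial) (hy trivial)
  | of t y =>
    obtain ⟨⟨_, x, hx, rfl⟩, rfl⟩ := Submodule.Quotient.mk_surjective _ y
    exact grClass_mem_E (GPre_le_bigPre τ G n le_rfl hx) hx

/-- A function of degree `p ≥ 1` is already of degree `p - 1`, so the classes it gives vanish. -/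
lemma E_one_eq_bot (τ : UpperHalfPlane) (A : VertexAlgebra V) (G : ℤ → Submodule ℂ V) (n : ℕ) :
    E τ A G n 1 = ⊥ := by
  refine eq_bot_iff.mpr (E_le fun p r f a hp => (Submodule.mem_bot ℂ).mpr ?_)
  have hf : f.1 ∈ GGam τ n (p - 1) := by
    rw [GGam_of_nonneg τ n (by omega)]
    trivial
  refine grClass_eq_zero τ A _ ?_
  rw [show p + r - 1 = p - 1 + r by ring]
  exact mk_mem_GPre τ G n _ _ _ _ hf a.2

end ChiralHodge

end

theorem mainTheorem10 (τ : UpperHalfPlane) {V : Type*} [AddCommGroup V] [Module ℂ V]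
    (A : ChiralHodge.GradedVertexAlgebra V) (G : ℤ → Submodule ℂ V)
    (hG : ChiralHodge.IsGoodFiltration A.toVertexAlgebra G) :
    ∃ d : ∀ n : ℕ, ChiralHodge.Chain τ A.toVertexAlgebra (n + 1) →ₗ[ℂ]
        ChiralHodge.Chain τ A.toVertexAlgebra n,
      ChiralHodge.IsChiralDifferential τ A.toVertexAlgebra d ∧
      (∀ n, d n ∘ₗ d (n + 1) = 0) ∧
      ∃ hd : ∀ n p, ChiralHodge.GC τ A.toVertexAlgebra G (n + 1) p ≤
          (ChiralHodge.GC τ A.toVertexAlgebra G n p).comap (d n),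
        (∀ n q, ChiralHodge.E τ A.toVertexAlgebra G (n + 1) q ≤
          (ChiralHodge.E τ A.toVertexAlgebra G n q).comap
            (ChiralHodge.grMap (ChiralHodge.GC τ A.toVertexAlgebra G (n + 1))
              (ChiralHodge.GC τ A.toVertexAlgebra G n) (d n) (hd n))) ∧
        (∀ n, Antitone (ChiralHodge.E τ A.toVertexAlgebra G n)) ∧
        (∀ n : ℕ, ChiralHodge.E τ A.toVertexAlgebra G n (-(n : ℤ)) = ⊤ ∧
          ChiralHodge.E τ A.toVertexAlgebra G n 1 = ⊥) := by
  exact ⟨ChiralHodge.chainD τ A.toVertexAlgebra, ChiralHodge.isChiralDifferential_chainD τ _,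
    ChiralHodge.chainD_comp_chainD τ _, ChiralHodge.GC_le_comap_chainD hG,
    ChiralHodge.E_le_comap_grMap hG, ChiralHodge.antitone_E τ _ G,
    fun n => ⟨ChiralHodge.E_neg_eq_top τ _ G n, ChiralHodge.E_one_eq_bot τ _ G n⟩⟩
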